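/- Let $T^n=(\mathbb R/\mathbb Z)^n$, $\Omega=T^n\times\mathbb R$ with points $(x,y)$, and let $g\in H^1(T^n)\cap L^\infty(T^n)$ with $|g|\le M$ a.e. for a constant $M$. For $\varepsilon>0$ and $h:T^n\to\mathbb R$ put $\xi_h=(0,\dots,0,\xi_h^n)\in\mathbb R^{n+1}$, where $\xi_h^n(x,y)=-1$ if $h(x)<y\le 0$, $\xi_h^n(x,y)=1$ if $0<y\le h(x)$, and $\xi_h^n(x,y)=0$ otherwise. For $u:\Omega\to\mathbb R$ define $$\mathcal F_\varepsilon(u)=\int_\Omega\tfrac12\Big|\nabla u-\tfrac1\varepsilon\,\xi_{\varepsilon g}\Big|^2\,dx\,dy\quad\text{if }u\in H^1_{\mathrm{loc}}(\Omega),\qquad \mathcal F_\varepsilon(u)=\infty\ \text{ otherwise,}$$ and $$\mathcal F(u)=\int_{\Omega\setminus\{y=0\}}\tfrac12|\nabla u|^2\,dx\,dy\quad\text{if }u\in H^1_{\mathrm{loc}}(\Omega\setminus\{y=0\})\text{ and }[u]=g\text{ a.e. on }T^n,\qquad \mathcal F(u)=\infty\ \text{ otherwise,}$$ where $[u]$ is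 the trace of $u$ on $\{y=0\}$ from above minus the trace from below; the condition $[u]=g$ includes the existence of both traces, in the sense of $L^1$-convergence in average over the strips $T^n\times(0,h)$, respectively $T^n\times(-h,0)$, as $h\downarrow0$. Let $(\varepsilon_j)_{j\in\mathbb N}$ be a decreasing sequence of positive real numbers converging to $0$. For functions $u_{\varepsilon_j}:\Omega\to\mathbb R$ and $y>0$ write $$u_{\varepsilon_j}^+(x,y)=u_{\varepsilon_j}(x,y+M\varepsilon_j),\qquad u_{\varepsilon_j}^-(x,y)=u_{\varepsilon_j}(x,-y-M\varepsilon_j).$$ Then the following hold. (i) (Compactness) If $\sup_j\mathcal F_{\varepsilon_j}(u_{\varepsilon_j})<\infty$, then there are a subsequence (not relabelled), real constants $c_j$ and functions $u^\pm\in H^1_{\mathrm{loc}}(T^n\times(0,\infty))$ such that $u_{\varepsilon_j}^+-c_j\rightharpoonup u^+$ and $u_{\varepsilon_j}^--c_j\rightharpoonup u^-$ weakly in $H^1_{\mathrm{loc}}(T^n\times(0,\infty))$ and strongly in $L^1_{\mathrm{loc}}(T^n\times(0,\infty))$. (ii) (Liminf inequality) If $u_{\varepsilon_j}^\pm\to u^\pm$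 in $L^1_{\mathrm{loc}}(T^n\times(0,\infty))$, then $$\liminf_{j\to\infty}\mathcal F_{\varepsilon_j}(u_{\varepsilon_j})\ge\mathcal F(u),$$ where $u(x,y)=u^+(x,y)$ for $y>0$ and $u(x,y)=u^-(x,-y)$ for $y<0$. (iii) (Recovery sequence) For every $u\in H^1_{\mathrm{loc}}(\Omega\setminus\{y=0\})$, in particular for every $u\in H^1(\Omega\setminus\{y=0\})$, there are functions $u_{\varepsilon_j}$ such that $u_{\varepsilon_j}^+\to u(x,y)$ and $u_{\varepsilon_j}^-\to u(x,-y)$ in $L^1_{\mathrm{loc}}(T^n\times(0,\infty))$, and $$\limsup_{j\to\infty}\mathcal F_{\varepsilon_j}(u_{\varepsilon_j})\le\mathcal F(u).$$ -/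

import Mathlib

open MeasureTheory Filter Set
open scoped Topology ENNReal ContDiff

noncomputable section

namespace InterfaceEnergy

/-! ### Weak derivatives on flat quotients of `ℝ^m`

The torus and the cylinder are both handled through their covering homomorphism
`π : ℝ^m → X`. -/

section WeakDerivatives

variable {m : ℕ} {X : Type*} [AddCommGroup X] [TopologicalSpace X] [MeasureSpace X]

/-- The `i`-th partial derivative of a function on `X`, in the coordinates given by `π`. -/
def pderiv (π : (Fin m → ℝ) → X) (i : Fin m) (φ : X → ℝ) (x : X) : ℝ :=
  deriv (fun t : ℝ => φ (x + π (Pi.single i t))) 0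

/-- `φ ∈ C_c^∞(U)`. -/
structure IsTestFunction (π : (Fin m → ℝ) → X) (U : Set X) (φ : X → ℝ) : Prop where
  smooth : ContDiff ℝ ∞ (φ ∘ π)
  hasCompactSupport : HasCompactSupport φ
  tsupport_subset : tsupport φ ⊆ U

/-- The integration by parts identity saying that `G` is the distributional gradient of `u`
on `U`. It is used together with local square integrability of `u` and `G`. -/
def IsWeakGrad (π : (Fin m → ℝ) → X) (U : Set X) (u : X → ℝ)
    (G : X → EuclideanSpace ℝ (Fin m)) : Prop :=
  ∀ φ : X → ℝ, IsTestFunction π U φ → ∀ i : Fin m,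
    ∫ x in U, u x * pderiv π i φ x = - ∫ x in U, G x i * φ x

/-- `u ∈ H¹_loc(U)` with weak gradient `∇u = G` (which is unique up to null sets).
`H¹_loc` refers to compact subsets of the open set `U`. -/
structure IsH1LocGrad (π : (Fin m → ℝ) → X) (U : Set X) (u : X → ℝ)
    (G : X → EuclideanSpace ℝ (Fin m)) : Prop where
  memLp_fun : ∀ K : Set X, IsCompact K → K ⊆ U → MemLp u 2 (volume.restrict K)
  memLp_grad : ∀ K : Set X, IsCompact K → K ⊆ U → MemLp G 2 (volume.restrict K)
  weakGrad : IsWeakGrad π U u G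

/-- `u ∈ H¹_loc(U)`. -/
def MemH1Loc (π : (Fin m → ℝ) → X) (U : Set X) (u : X → ℝ) : Prop :=
  ∃ G, IsH1LocGrad π U u G

/-- `u ∈ H¹(U)`. -/
def MemH1 (π : (Fin m → ℝ) → X) (U : Set X) (u : X → ℝ) : Prop :=
  ∃ G, MemLp u 2 (volume.restrict U) ∧ MemLp G 2 (volume.restrict U) ∧ IsWeakGrad π U u G

/-- `u_j ⇀ u` weakly in `H¹_loc(U)`: all functions are in `H¹_loc(U)`, and functions and
gradients converge weakly in `L²(K)` for every compact `K ⊆ U`. -/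
def WeakH1LocTendsto (π : (Fin m → ℝ) → X) (U : Set X) (u : ℕ → X → ℝ) (v : X → ℝ) : Prop :=
  ∃ (G : ℕ → X → EuclideanSpace ℝ (Fin m)) (H : X → EuclideanSpace ℝ (Fin m)),
    (∀ j, IsH1LocGrad π U (u j) (G j)) ∧ IsH1LocGrad π U v H ∧
    ∀ K : Set X, IsCompact K → K ⊆ U → ∀ ψ : X → ℝ, MemLp ψ 2 (volume.restrict K) →
      Tendsto (fun j => ∫ x in K, u j x * ψ x) atTop (𝓝 (∫ x in K, v x * ψ x)) ∧
      ∀ i : Fin m,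
        Tendsto (fun j => ∫ x in K, G j x i * ψ x) atTop (𝓝 (∫ x in K, H x i * ψ x))

/-- `u_j → v` (strongly) in `L¹_loc(U)`. -/
def L1LocTendsto (U : Set X) (u : ℕ → X → ℝ) (v : X → ℝ) : Prop :=
  ∀ K : Set X, IsCompact K → K ⊆ U →
    (∀ j, IntegrableOn (u j) K) ∧ IntegrableOn v K ∧
    Tendsto (fun j => ∫⁻ x in K, ‖u j x - v x‖ₑ) atTop (𝓝 0)

end WeakDerivatives

/-! ### The torus `T^n` and the cylinder `Ω = T^n × ℝ` -/

/-- The torus `T^n = (ℝ/ℤ)^n`. -/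
abbrev Torus (n : ℕ) : Type := UnitAddTorus (Fin n)

/-- The cylinder `Ω = T^n × ℝ`, with points `(x, y)`. -/
abbrev Cyl (n : ℕ) : Type := Torus n × ℝ

/-- The covering `ℝ^n → T^n`. -/
def torusCover (n : ℕ) (v : Fin n → ℝ) : Torus n := fun i => (v i : UnitAddCircle)

/-- The covering `ℝ^{n+1} → Ω`; the last coordinate is `y`. -/
def cylCover (n : ℕ) (v : Fin (n + 1) → ℝ) : Cyl n :=
  (fun i => (v i.castSucc : UnitAddCircle), v (Fin.last n))

/-- `T^n × (0, ∞)`. -/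
def upperHalf (n : ℕ) : Set (Cyl n) := {p | 0 < p.2}

/-- `Ω ∖ {y = 0}`. -/
def slitCyl (n : ℕ) : Set (Cyl n) := {p | p.2 ≠ 0}

variable {n : ℕ}

/-! ### The energies -/

/-- The last component of the transformation strain for the interface `y = g(x)`. -/
def strainLast (g : Torus n → ℝ) (p : Cyl n) : ℝ :=
  if p.2 ≤ 0 then (if p.2 ≤ g p.1 then 0 else -1) else (if p.2 ≤ g p.1 then 1 else 0)

/-- The transformation strain `ξ_g = (0, …, 0, ξ_g^n)`. -/
def strain (g : Torus n → ℝ) (p : Cyl n) : EuclideanSpace ℝ (Fin (n + 1)) :=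
  EuclideanSpace.single (Fin.last n) (strainLast g p)

/-- `F_ε(u) = ∫_Ω ½ |∇u - ε⁻¹ ξ_{εg}|²` if `u ∈ H¹_loc(Ω)`, and `∞` otherwise. The infimum is
over all representatives `G` of the weak gradient of `u`: it is `∞` if there is none, and
otherwise all of them give the same value. -/
def energyEps (g : Torus n → ℝ) (ε : ℝ) (u : Cyl n → ℝ) : ℝ≥0∞ :=
  ⨅ (G : Cyl n → EuclideanSpace ℝ (Fin (n + 1))) (_ : IsH1LocGrad (cylCover n) univ u G),
    ∫⁻ p, ENNReal.ofReal (1 / 2 * ‖G p - ε⁻¹ • strain (fun x => ε * g x) p‖ ^ 2)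

/-- `τ` is the trace of `u` on `{y = 0}` from above: `u` converges to `τ` in `L¹` average over
the strips `T^n × (0, h)` as `h ↓ 0`. -/
def IsTraceAbove (u : Cyl n → ℝ) (τ : Torus n → ℝ) : Prop :=
  Integrable τ ∧
  Tendsto (fun h : ℝ => (∫⁻ p in {p : Cyl n | 0 < p.2 ∧ p.2 < h}, ‖u p - τ p.1‖ₑ) /
    ENNReal.ofReal h) (𝓝[>] 0) (𝓝 0)

/-- `τ` is the trace of `u` on `{y = 0}` from below. -/
def IsTraceBelow (u : Cyl n → ℝ) (τ : Torus n → ℝ) : Prop :=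
  Integrable τ ∧
  Tendsto (fun h : ℝ => (∫⁻ p in {p : Cyl n | -h < p.2 ∧ p.2 < 0}, ‖u p - τ p.1‖ₑ) /
    ENNReal.ofReal h) (𝓝[>] 0) (𝓝 0)

/-- The jump condition `[u] = g` a.e.: `u` has traces on both sides of `{y = 0}` and the trace
from above minus the trace from below is `g`. -/
def HasJump (u : Cyl n → ℝ) (g : Torus n → ℝ) : Prop :=
  ∃ τp τm : Torus n → ℝ, IsTraceAbove u τp ∧ IsTraceBelow u τm ∧
    ∀ᵐ x, τp x - τm x = g x

/-- `F(u) = ∫_{Ω ∖ {y=0}} ½ |∇u|²` if `u ∈ H¹_loc(Ω ∖ {y=0})` and `[u] = g` a.e., and `∞`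
otherwise. -/
def energyLimit (g : Torus n → ℝ) (u : Cyl n → ℝ) : ℝ≥0∞ :=
  ⨅ (G : Cyl n → EuclideanSpace ℝ (Fin (n + 1)))
    (_ : IsH1LocGrad (cylCover n) (slitCyl n) u G) (_ : HasJump u g),
    ∫⁻ p in slitCyl n, ENNReal.ofReal (1 / 2 * ‖G p‖ ^ 2)

/-! ### Cut-out and glueing -/

/-- `(x, y) ↦ u(x, y + δ)`. -/
def shiftUp (δ : ℝ) (u : Cyl n → ℝ) : Cyl n → ℝ := fun p => u (p.1, p.2 + δ)

/-- `(x, y) ↦ u(x, -y - δ)`. -/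
def shiftDown (δ : ℝ) (u : Cyl n → ℝ) : Cyl n → ℝ := fun p => u (p.1, -p.2 - δ)

/-- The function `u` with `u(x, y) = u⁺(x, y)` for `y > 0` and `u(x, y) = u⁻(x, -y)` for
`y < 0` (the null set `y = 0` is irrelevant). -/
def glue (up um : Cyl n → ℝ) : Cyl n → ℝ :=
  fun p => if 0 < p.2 then up p else um (p.1, -p.2)

end InterfaceEnergy

end

open MeasureTheory Filter Set
open scoped Topology ENNReal ContDiff

noncomputable section

namespace InterfaceEnergy

variable {n : ℕ}

/-! ### The cylinder as a measured group -/

/-! For `|y| > M ε` the strain of the interface `ε g` vanishes, so above and below the layer `|y| ≤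
M ε` the energy is plain Dirichlet energy. Inside the layer the strain prescribes a vertical slope
`±1/ε` over a height `ε |g x|`, that is, a total increment `g x` of `u`. By Cauchy–Schwarz across
the thickness `2 M ε`, the actual increment differs from `g` by a function `r` with `‖r‖² ≤ 2 M ε ·
(twice the energy)`. As `ε → 0` the layer collapses to a jump of exactly `g`, and only the Dirichlet
energy of the two sides survives. `exists_trace_repr` and `lintegral_gradUp_add_gradDown_le` record
these two facts.

Weak derivatives are handled through one equivalence: `F` is the weak derivative of `u` in direction
`i` iff, for every `t > 0`, the increment of `u` along a segment of length `t` is almost everywhere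
the integral of `F` along it (`translate_ae`, `isWeakPDeriv_of_translate`). It yields `L²` bounds on
translates, traces as initial values of vertical primitives, and weak differentiability of glued
functions.

Compactness: `exists_trace_sub_const_le` bounds the upper trace in `L²` after subtracting a
constant. The lower trace is the upper one minus `g + r`, so the same constant serves both sides.
`exists_halfTendsto` extracts weak limits, using the weight `exp (-y)` to control growth in `y`, and
`tendsto_lintegral_slab_of_weak` upgrades to strong local `L¹` convergence by averaging over small
translations.

Liminf: along a subsequence with energies below `b`, the limits have gradients in `L²`, and weak
lower semicontinuity (`HalfTendsto.two_mul_lintegral_le`) bounds their energy by `b`. On the strip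
`T^n × (0, h)`, the `L¹` distance between the difference of the two limits and `g` is `O(h^{3/2})`,
since the `r` contribution disappears in the limit. Dividing by `h` identifies the jump of the
traces.

Recovery: lowering the upper half of `u` by `g` removes the jump, and adding `min (y⁺/ε) (g + y⁻/ε)`
restores `u` outside the layer. The vertical derivative of this profile is exactly the scaled
strain. What is left over is horizontal, supported in the layer and bounded by `|∇g|`, so its
squared norm is at most `2 M ε ‖∇g‖²` and vanishes in the limit. -/

instance isProbabilityMeasure_unitAddCircle :
    IsProbabilityMeasure (volume : Measure UnitAddCircle) := ⟨by simp⟩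

instance isProbabilityMeasure_torus : IsProbabilityMeasure (volume : Measure (Torus n)) :=
  inferInstanceAs (IsProbabilityMeasure (Measure.pi fun _ => volume))

instance isAddHaarMeasure_cyl : (volume : Measure (Cyl n)).IsAddHaarMeasure :=
  Measure.prod.instIsAddHaarMeasure (volume : Measure (Torus n)) (volume : Measure ℝ)

/-- The translation by `t` in the `i`-th coordinate direction. -/
def dirVec (i : Fin (n + 1)) (t : ℝ) : Cyl n := cylCover n (Pi.single i t)

theorem cylCover_add (v w : Fin (n + 1) → ℝ) :
    cylCover n (v + w) = cylCover n v + cylCover n w := by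
  ext i
  · simp [cylCover]
  · simp [cylCover]

theorem cylCover_zero : cylCover n 0 = 0 := by
  ext i
  · simp [cylCover]
  · simp [cylCover]

theorem dirVec_add (i : Fin (n + 1)) (s t : ℝ) :
    dirVec i (s + t) = dirVec i s + dirVec i t := by
  rw [dirVec, Pi.single_add, cylCover_add]; rfl

@[simp] theorem dirVec_zero (i : Fin (n + 1)) : dirVec i 0 = 0 := by
  rw [dirVec, Pi.single_zero, cylCover_zero]

@[simp] theorem dirVec_castSucc_snd (i : Fin n) (t : ℝ) :
    (dirVec i.castSucc t : Cyl n).2 = 0 := by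
  simp [dirVec, cylCover, Pi.single_apply, Fin.ext_iff, i.2.ne']

@[simp] theorem dirVec_last_snd (t : ℝ) : (dirVec (Fin.last n) t : Cyl n).2 = t := by
  simp [dirVec, cylCover]

theorem dirVec_last (t : ℝ) : (dirVec (Fin.last n) t : Cyl n) = (0, t) := by
  ext i
  · simp [dirVec, cylCover, Pi.single_apply, Fin.ext_iff, i.2.ne]
  · simp

theorem dirVec_castSucc (i : Fin n) (t : ℝ) :
    (dirVec i.castSucc t : Cyl n) = (torusCover n (Pi.single i t), 0) := by
  ext k
  · simp [dirVec, cylCover, torusCover, Pi.single_apply, Fin.ext_iff]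
  · simp

theorem continuous_cylCover : Continuous (cylCover n) := by
  unfold cylCover
  refine Continuous.prodMk (continuous_pi fun i => ?_) (continuous_apply _)
  exact (AddCircle.continuous_mk' 1).comp (continuous_apply _)

theorem continuous_dirVec (i : Fin (n + 1)) : Continuous (dirVec i : ℝ → Cyl n) :=
  continuous_cylCover.comp (continuous_single (A := fun _ => ℝ) i)

/-- Being a quotient map lets continuity on the cylinder be checked on `ℝ^{n+1}`; openness is what
survives products of quotient maps, and it also makes images of small boxes open. -/
theorem isOpenQuotientMap_cylCover : IsOpenQuotientMap (cylCover n) := by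
  let h : (Fin (n + 1) → ℝ) ≃ₜ (Fin n → ℝ) × ℝ :=
    { toFun := fun v => (fun i => v i.castSucc, v (Fin.last n))
      invFun := fun w => Fin.snoc w.1 w.2
      left_inv := fun v => by
        ext i
        refine Fin.lastCases ?_ (fun k => ?_) i <;> simp
      right_inv := fun w => by ext i <;> simp
      continuous_toFun := by fun_prop
      continuous_invFun := by fun_prop }
  have h1 : IsOpenQuotientMap (Pi.map (fun (_ : Fin n) (t : ℝ) => (t : UnitAddCircle))) :=
    IsOpenQuotientMap.piMap fun _ => QuotientAddGroup.isOpenQuotientMap_mk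
  exact (h1.prodMap (IsOpenQuotientMap.id (X := ℝ))).comp h.isOpenQuotientMap

theorem measurePreserving_add_const (b : Cyl n) :
    MeasurePreserving (fun p : Cyl n => p + b) volume volume :=
  measurePreserving_add_right volume b

/-! ### Test functions on the cylinder -/

section TestFunctions

variable {U V : Set (Cyl n)} {φ : Cyl n → ℝ}

theorem IsTestFunction.mono (h : IsTestFunction (cylCover n) U φ) (hUV : U ⊆ V) :
    IsTestFunction (cylCover n) V φ := ⟨h.1, h.2, h.3.trans hUV⟩

theorem IsTestFunction.continuous (h : IsTestFunction (cylCover n) U φ) : Continuous φ :=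
  isOpenQuotientMap_cylCover.isQuotientMap.continuous_iff.2 h.smooth.continuous

theorem IsTestFunction.pderiv_cover (h : IsTestFunction (cylCover n) U φ) (i : Fin (n + 1))
    (v : Fin (n + 1) → ℝ) :
    HasDerivAt (fun t : ℝ => φ (cylCover n v + dirVec i t))
      (fderiv ℝ (φ ∘ cylCover n) v (Pi.single i 1)) 0 := by
  have h1 : HasFDerivAt (φ ∘ cylCover n) (fderiv ℝ (φ ∘ cylCover n) v) (v + Pi.single i 0) := by
    simpa using (h.smooth.differentiable (by simp) v).hasFDerivAt
  have h2 : HasDerivAt (fun t : ℝ => v + (Pi.single i t : Fin (n + 1) → ℝ)) (Pi.single i 1) 0 := by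
    exact (hasDerivAt_single i (0 : ℝ)).const_add v
  have h3 := h1.comp_hasDerivAt (0 : ℝ) h2
  refine h3.congr_deriv rfl |>.congr_of_eventuallyEq (Eventually.of_forall fun t => ?_)
  simp [Function.comp, cylCover_add, dirVec]

theorem IsTestFunction.pderiv_eq (h : IsTestFunction (cylCover n) U φ) (i : Fin (n + 1))
    (v : Fin (n + 1) → ℝ) :
    pderiv (cylCover n) i φ (cylCover n v) = fderiv ℝ (φ ∘ cylCover n) v (Pi.single i 1) :=
  (h.pderiv_cover i v).deriv

theorem IsTestFunction.hasDerivAt (h : IsTestFunction (cylCover n) U φ) (i : Fin (n + 1))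
    (x : Cyl n) (t : ℝ) :
    HasDerivAt (fun t : ℝ => φ (x + dirVec i t)) (pderiv (cylCover n) i φ (x + dirVec i t)) t := by
  obtain ⟨v, hv⟩ := isOpenQuotientMap_cylCover.surjective (x + dirVec i t)
  have h1 := h.pderiv_cover i v
  rw [← h.pderiv_eq i v, hv] at h1
  change HasDerivAt _ (pderiv (cylCover n) i φ (x + dirVec i t)) 0 at h1
  have h2 : HasDerivAt (fun s : ℝ => s - t) 1 t := (hasDerivAt_id t).sub_const t
  rw [← sub_self t] at h1
  have h3 := HasDerivAt.comp (h₂ := fun r : ℝ => φ (x + dirVec i t + dirVec i r))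
    (h := fun s : ℝ => s - t) t h1 h2
  rw [mul_one] at h3
  refine h3.congr_of_eventuallyEq (Eventually.of_forall fun s => ?_)
  simp only [Function.comp]
  rw [add_assoc, ← dirVec_add]; congr 3; ring

theorem IsTestFunction.continuous_pderiv (h : IsTestFunction (cylCover n) U φ) (i : Fin (n + 1)) :
    Continuous (pderiv (cylCover n) i φ) := by
  rw [isOpenQuotientMap_cylCover.isQuotientMap.continuous_iff]
  have : pderiv (cylCover n) i φ ∘ cylCover n =
      fun v => fderiv ℝ (φ ∘ cylCover n) v (Pi.single i 1) := by
    ext v; exact h.pderiv_eq i v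
  rw [this]
  exact (h.smooth.continuous_fderiv (by simp)).clm_apply continuous_const

theorem pderiv_eq_zero_of_notMem_tsupport (i : Fin (n + 1)) {x : Cyl n} (hx : x ∉ tsupport φ) :
    pderiv (cylCover n) i φ x = 0 := by
  have h0 : φ =ᶠ[𝓝 x] 0 := notMem_tsupport_iff_eventuallyEq.1 hx
  have hc : Tendsto (fun t : ℝ => x + dirVec i t) (𝓝 0) (𝓝 x) := by
    have : Continuous fun t : ℝ => x + dirVec i t := continuous_const.add (continuous_dirVec i)
    simpa using this.tendsto 0
  have h1 : (fun t : ℝ => φ (x + dirVec i t)) =ᶠ[𝓝 0] fun _ => 0 := hc.eventually h0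
  exact (h1.deriv_eq).trans (by simp)

theorem IsTestFunction.exists_bound (h : IsTestFunction (cylCover n) U φ) :
    ∃ C : ℝ, 0 ≤ C ∧ ∀ x, |φ x| ≤ C := by
  obtain ⟨C, hC⟩ := h.continuous.bounded_above_of_compact_support h.hasCompactSupport
  exact ⟨C, (norm_nonneg _).trans (hC 0), hC⟩

theorem IsTestFunction.exists_bound_pderiv (h : IsTestFunction (cylCover n) U φ)
    (i : Fin (n + 1)) : ∃ C : ℝ, 0 ≤ C ∧ ∀ x, |pderiv (cylCover n) i φ x| ≤ C := by
  have hs : HasCompactSupport (pderiv (cylCover n) i φ) := by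
    refine HasCompactSupport.intro h.hasCompactSupport fun x hx => ?_
    exact pderiv_eq_zero_of_notMem_tsupport i hx
  obtain ⟨C, hC⟩ := (h.continuous_pderiv i).bounded_above_of_compact_support hs
  exact ⟨C, (norm_nonneg _).trans (hC 0), hC⟩

theorem IsTestFunction.comp_add (h : IsTestFunction (cylCover n) U φ) (b : Cyl n)
    (hV : ∀ x, x + b ∈ tsupport φ → x ∈ V) :
    IsTestFunction (cylCover n) V (fun x => φ (x + b)) := by
  obtain ⟨w, rfl⟩ := isOpenQuotientMap_cylCover.surjective b
  refine ⟨?_, ?_, ?_⟩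
  · have : (fun x => φ (x + cylCover n w)) ∘ cylCover n = (φ ∘ cylCover n) ∘ fun v => v + w := by
      ext v; simp [cylCover_add]
    rw [this]
    exact h.smooth.comp (contDiff_id.add contDiff_const)
  · exact h.hasCompactSupport.comp_homeomorph (Homeomorph.addRight (cylCover n w))
  · intro x hx
    refine hV x ?_
    have := tsupport_comp_subset_preimage φ (f := fun x : Cyl n => x + cylCover n w)
      (continuous_id.add continuous_const)
    exact this hx

theorem pderiv_comp_add (i : Fin (n + 1)) (b x : Cyl n) :
    pderiv (cylCover n) i (fun x => φ (x + b)) x = pderiv (cylCover n) i φ (x + b) := by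
  unfold pderiv
  simp only [add_right_comm]

/-- A smooth periodic bump around `0`. -/
def circleBump (δ : ℝ) : UnitAddCircle → ℝ :=
  Function.Periodic.lift (f := fun t : ℝ =>
    Real.smoothTransition (Real.cos (2 * Real.pi * t) - Real.cos (2 * Real.pi * δ)))
    (c := 1) (fun t => by simp [mul_add])

theorem circleBump_coe (δ t : ℝ) : circleBump δ (t : UnitAddCircle) =
    Real.smoothTransition (Real.cos (2 * Real.pi * t) - Real.cos (2 * Real.pi * δ)) := rfl

theorem circleBump_nonneg (δ : ℝ) (x : UnitAddCircle) : 0 ≤ circleBump δ x := by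
  induction x using QuotientAddGroup.induction_on with
  | H t => exact Real.smoothTransition.nonneg _

theorem circleBump_zero_pos {δ : ℝ} (h0 : 0 < δ) (h1 : δ < 1 / 2) : 0 < circleBump δ 0 := by
  have := circleBump_coe δ 0
  rw [QuotientAddGroup.mk_zero] at this
  rw [this]
  apply Real.smoothTransition.pos_of_pos
  have := Real.pi_pos
  have : Real.cos (2 * Real.pi * δ) < Real.cos 0 :=
    Real.cos_lt_cos_of_nonneg_of_le_pi le_rfl (by nlinarith) (by positivity)
  simpa using this

/-- `cos (2πt)` depends only on the distance of `t` to the nearest integer and decreases in that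
distance on `[0, 1/2]`, so the bump vanishes once the distance reaches `δ`. -/
theorem norm_lt_of_circleBump_ne_zero {δ : ℝ} (h0 : 0 < δ) (h1 : δ < 1 / 2) {x : UnitAddCircle}
    (hx : circleBump δ x ≠ 0) : ‖x‖ < δ := by
  induction x using QuotientAddGroup.induction_on with
  | H t =>
    by_contra hcon
    push Not at hcon
    refine hx (Real.smoothTransition.zero_of_nonpos ?_)
    rw [UnitAddCircle.norm_eq] at hcon
    have h2 : Real.cos (2 * Real.pi * t) = Real.cos (2 * Real.pi * |t - round t|) := by
      rw [← Real.cos_abs (2 * Real.pi * |t - round t|), abs_mul, abs_abs, ← abs_mul, Real.cos_abs,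
        mul_sub]
      rw [show 2 * Real.pi * t - 2 * Real.pi * (round t : ℝ) =
        2 * Real.pi * t - (round t : ℤ) * (2 * Real.pi) by ring, Real.cos_sub_int_mul_two_pi]
    have h3 : |t - round t| ≤ 1 / 2 := abs_sub_round t
    have := Real.pi_pos
    rw [h2, sub_nonpos]
    exact Real.cos_le_cos_of_nonneg_of_le_pi (by positivity) (by nlinarith) (by nlinarith)

/-- A product of periodic bumps in the torus directions and an ordinary bump in `y` works at the
origin; translation by `-x` moves it, because the cylinder is a group and the covering a
homomorphism. -/
theorem exists_isTestFunction_pos (hU : IsOpen U) {x : Cyl n} (hx : x ∈ U) :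
    ∃ φ : Cyl n → ℝ, IsTestFunction (cylCover n) U φ ∧ (∀ y, 0 ≤ φ y) ∧ 0 < φ x := by
  obtain ⟨δ, δ0, hδ⟩ := Metric.isOpen_iff.1 hU x hx
  obtain ⟨r, r0, r1, r2⟩ : ∃ r : ℝ, 0 < r ∧ r < 1 / 2 ∧ r < δ :=
    ⟨min (1 / 4) (δ / 2), by positivity, (min_le_left _ _).trans_lt (by norm_num),
      (min_le_right _ _).trans_lt (by linarith)⟩
  let b : ContDiffBump (0 : ℝ) := ⟨r / 2, r, by positivity, by linarith⟩
  let ψ : Cyl n → ℝ := fun y => (∏ i, circleBump r (y.1 i)) * b y.2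
  have hψs : ContDiff ℝ ∞ (ψ ∘ cylCover n) := by
    have : ψ ∘ cylCover n = fun v => (∏ i : Fin n, Real.smoothTransition
      (Real.cos (2 * Real.pi * v i.castSucc) - Real.cos (2 * Real.pi * r))) *
        b (v (Fin.last n)) := rfl
    rw [this]
    refine ContDiff.mul (contDiff_prod fun i _ => ?_) (b.contDiff.comp (contDiff_apply _ _ _))
    refine Real.smoothTransition.contDiff.comp ?_
    refine ContDiff.sub (Real.contDiff_cos.comp ?_) contDiff_const
    exact contDiff_const.mul (contDiff_apply _ _ _)
  have hsupp : ∀ y, ψ y ≠ 0 → ‖y‖ ≤ r := by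
    intro y hy
    have h1 := left_ne_zero_of_mul hy
    have h2 := right_ne_zero_of_mul hy
    rw [Prod.norm_def, sup_le_iff]
    refine ⟨(pi_norm_le_iff_of_nonneg r0.le).2 fun i => ?_, ?_⟩
    · exact (norm_lt_of_circleBump_ne_zero r0 r1 (Finset.prod_ne_zero_iff.1 h1 i
        (Finset.mem_univ _))).le
    · have : y.2 ∈ Function.support b := h2
      rw [b.support_eq, mem_ball_zero_iff] at this
      exact this.le
  have hts : tsupport ψ ⊆ Metric.closedBall 0 r := by
    refine closure_minimal (fun y hy => ?_) Metric.isClosed_closedBall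
    simpa using hsupp y hy
  have hψ : IsTestFunction (cylCover n) univ ψ :=
    ⟨hψs, HasCompactSupport.of_support_subset_isCompact (isCompact_closedBall (0 : Cyl n) r)
      (subset_closure.trans hts), subset_univ _⟩
  refine ⟨fun y => ψ (y + -x), hψ.comp_add (-x) fun y hy => hδ ?_, fun y => ?_, ?_⟩
  · have := hts hy
    rw [mem_closedBall_zero_iff] at this
    rw [Metric.mem_ball, dist_eq_norm, sub_eq_add_neg]
    exact this.trans_lt r2
  · exact mul_nonneg (Finset.prod_nonneg fun i _ => circleBump_nonneg _ _) b.nonneg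
  · simp only [add_neg_cancel, ψ]
    refine mul_pos (Finset.prod_pos fun i _ => circleBump_zero_pos r0 r1) ?_
    exact b.pos_of_mem_ball (by simpa [b] using r0)

theorem IsTestFunction.add {ψ : Cyl n → ℝ} (h : IsTestFunction (cylCover n) U φ)
    (h' : IsTestFunction (cylCover n) U ψ) :
    IsTestFunction (cylCover n) U (fun x => φ x + ψ x) := by
  refine ⟨h.smooth.add h'.smooth, h.hasCompactSupport.add h'.hasCompactSupport, ?_⟩
  exact (tsupport_add φ ψ).trans (union_subset h.3 h'.3)

theorem isTestFunction_zero : IsTestFunction (cylCover n) U (fun _ => 0) := by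
  refine ⟨contDiff_const, HasCompactSupport.zero, ?_⟩
  have : tsupport (fun _ : Cyl n => (0 : ℝ)) = ∅ := by
    rw [tsupport_eq_empty_iff]; rfl
  rw [this]; exact empty_subset _

/-- A finite sum of local bumps is bounded below on `K` by some `c > 0`. Dividing by `c` and
composing with a smooth step flattens it to `1` on `K` without enlarging the support. -/
theorem exists_isTestFunction_eq_one {K : Set (Cyl n)} (hK : IsCompact K) (hU : IsOpen U)
    (hKU : K ⊆ U) : ∃ φ : Cyl n → ℝ, IsTestFunction (cylCover n) U φ ∧
      (∀ y, φ y ∈ Icc (0 : ℝ) 1) ∧ ∀ y ∈ K, φ y = 1 := by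
  obtain ⟨s, hs, hs0, hsK⟩ : ∃ s : Cyl n → ℝ, IsTestFunction (cylCover n) U s ∧
      (∀ y, 0 ≤ s y) ∧ ∀ y ∈ K, 0 < s y := by
    refine hK.induction_on (p := fun K => ∃ s : Cyl n → ℝ, IsTestFunction (cylCover n) U s ∧
      (∀ y, 0 ≤ s y) ∧ ∀ y ∈ K, 0 < s y) ⟨fun _ => 0, isTestFunction_zero, by simp, by simp⟩ ?_ ?_ ?_
    · rintro A B hAB ⟨s, h1, h2, h3⟩
      exact ⟨s, h1, h2, fun y hy => h3 y (hAB hy)⟩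
    · rintro A B ⟨s, h1, h2, h3⟩ ⟨s', h1', h2', h3'⟩
      refine ⟨_, h1.add h1', fun y => add_nonneg (h2 y) (h2' y), ?_⟩
      rintro y (hy | hy)
      · exact add_pos_of_pos_of_nonneg (h3 y hy) (h2' y)
      · exact add_pos_of_nonneg_of_pos (h2 y) (h3' y hy)
    · intro x hx
      obtain ⟨s, h1, h2, h3⟩ := exists_isTestFunction_pos hU (hKU hx)
      exact ⟨{y | 0 < s y}, mem_nhdsWithin_of_mem_nhds
        ((isOpen_lt continuous_const h1.continuous).mem_nhds h3), s, h1, h2, fun y hy => hy⟩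
  obtain ⟨c, c0, hc⟩ : ∃ c : ℝ, 0 < c ∧ ∀ y ∈ K, c ≤ s y := by
    rcases K.eq_empty_or_nonempty with rfl | hne
    · exact ⟨1, one_pos, by simp⟩
    · obtain ⟨y, hy, hmin⟩ := hK.exists_isMinOn hne hs.continuous.continuousOn
      exact ⟨s y, hsK y hy, fun z hz => hmin hz⟩
  have hsub : Function.support (fun y => Real.smoothTransition (s y / c)) ⊆
      Function.support s := by
    intro y hy h0
    refine hy ?_
    simp only [h0, zero_div]
    exact Real.smoothTransition.zero
  refine ⟨fun y => Real.smoothTransition (s y / c), ⟨?_, ?_, ?_⟩, fun y =>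
    ⟨Real.smoothTransition.nonneg _, Real.smoothTransition.le_one _⟩, fun y hy => ?_⟩
  · exact Real.smoothTransition.contDiff.comp (hs.smooth.div_const c)
  · exact hs.hasCompactSupport.mono hsub
  · exact (closure_mono hsub).trans hs.3
  · exact Real.smoothTransition.one_of_one_le ((one_le_div c0).2 (hc y hy))

end TestFunctions

/-! ### The fundamental lemma of the calculus of variations on the cylinder -/

section Fundamental

variable {U V : Set (Cyl n)} {φ : Cyl n → ℝ}

/-- The indicator of a compact `K` is the pointwise limit of cutoffs supported in shrinking
thickenings of `K`, and all of them are dominated by `1` on one fixed compact neighbourhood `L`. -/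
theorem setIntegral_eq_zero_of_forall_test (hV : IsOpen V) {f : Cyl n → ℝ}
    (hf : ∀ K, IsCompact K → K ⊆ V → IntegrableOn f K)
    (h : ∀ φ, IsTestFunction (cylCover n) V φ → ∫ x in V, f x * φ x = 0)
    {K : Set (Cyl n)} (hK : IsCompact K) (hKV : K ⊆ V) : ∫ x in K, f x = 0 := by
  obtain ⟨δ, δ0, hδ⟩ := hK.exists_cthickening_subset_open hV hKV
  set δ' := min δ 1
  have δ'0 : 0 < δ' := lt_min δ0 one_pos
  set L := Metric.cthickening δ' K
  have hLV : L ⊆ V := (Metric.cthickening_mono (min_le_left _ _) K).trans hδ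
  have hL : IsCompact L := hK.cthickening
  let r : ℕ → ℝ := fun m => δ' * (1 / (m + 1))
  have r0 : ∀ m, 0 < r m := fun m => by positivity
  have rle : ∀ m, r m ≤ δ' := fun m => by
    have : (1 : ℝ) / (m + 1) ≤ 1 := by
      rw [div_le_one (by positivity)]; linarith [(Nat.cast_nonneg m : (0 : ℝ) ≤ m)]
    exact mul_le_of_le_one_right δ'0.le this
  have rlim : Tendsto r atTop (𝓝 0) := by
    have := (tendsto_one_div_add_atTop_nhds_zero_nat (𝕜 := ℝ)).const_mul δ'
    rwa [mul_zero] at this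
  have hth : ∀ m, Metric.thickening (r m) K ⊆ L := fun m =>
    (Metric.thickening_subset_cthickening_of_le (rle m) K)
  have := fun m => exists_isTestFunction_eq_one hK Metric.isOpen_thickening
    (Metric.self_subset_thickening (r0 m) K)
  choose φ hφ hφI hφ1 using this
  have hzero : ∀ m x, x ∉ Metric.thickening (r m) K → φ m x = 0 := fun m x hx =>
    image_eq_zero_of_notMem_tsupport fun h => hx ((hφ m).3 h)
  have hfL := hf L hL hLV
  have key : Tendsto (fun m => ∫ x in L, f x * φ m x) atTop (𝓝 (∫ x in L, K.indicator f x)) := by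
    refine tendsto_integral_of_dominated_convergence (fun x => |f x|)
      (fun m => hfL.aestronglyMeasurable.mul (hφ m).continuous.aestronglyMeasurable)
      hfL.norm (fun m => ae_of_all _ fun x => ?_) (ae_of_all _ fun x => ?_)
    · rw [norm_mul, Real.norm_eq_abs, Real.norm_of_nonneg (hφI m x).1]
      exact mul_le_of_le_one_right (abs_nonneg _) (hφI m x).2
    · by_cases hx : x ∈ K
      · simp [hφ1 _ x hx, hx]
      · rw [indicator_of_notMem hx]
        refine tendsto_const_nhds.congr' ?_
        have hx' := hx
        rw [← hK.isClosed.closure_eq, Metric.closure_eq_iInter_thickening K] at hx'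
        simp only [mem_iInter, not_forall] at hx'
        obtain ⟨η, η0, hη⟩ := hx'
        filter_upwards [rlim.eventually (gt_mem_nhds η0)] with m hm
        rw [hzero m x fun h => hη (Metric.thickening_mono hm.le K h), mul_zero]
  have hz : ∀ m, ∫ x in L, f x * φ m x = 0 := fun m => by
    rw [← h (φ m) ((hφ m).mono ((hth m).trans hLV))]
    refine (setIntegral_eq_of_subset_of_forall_sdiff_eq_zero hV.measurableSet hLV ?_).symm
    intro x hx
    rw [hzero m x fun h => hx.2 (hth m h), mul_zero]
  simp only [hz] at key
  have := tendsto_nhds_unique key tendsto_const_nhds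
  rwa [setIntegral_indicator hK.measurableSet,
    inter_eq_self_of_subset_right (Metric.self_subset_cthickening K)] at this

theorem ae_eq_zero_of_forall_test (hV : IsOpen V) {f : Cyl n → ℝ}
    (hf : ∀ K, IsCompact K → K ⊆ V → IntegrableOn f K)
    (h : ∀ φ, IsTestFunction (cylCover n) V φ → ∫ x in V, f x * φ x = 0) :
    ∀ᵐ x ∂volume.restrict V, f x = 0 := by
  have : LocallyCompactSpace V := hV.locallyCompactSpace
  obtain ⟨K, hK, hKV⟩ : IsSigmaCompact V :=
    isSigmaCompact_iff_sigmaCompactSpace.2 inferInstance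
  rw [← hKV, ae_restrict_iUnion_iff]
  intro m
  have hsub : K m ⊆ V := hKV ▸ subset_iUnion K m
  have hi : Integrable ((K m).indicator f) volume :=
    (integrable_indicator_iff (hK m).measurableSet).2 (hf _ (hK m) hsub)
  have h0 : (K m).indicator f =ᵐ[volume] 0 := by
    refine ae_eq_zero_of_forall_setIntegral_isCompact_eq_zero' hi.locallyIntegrable fun s hs => ?_
    rw [setIntegral_indicator (hK m).measurableSet]
    exact setIntegral_eq_zero_of_forall_test hV hf h (hs.inter (hK m)) (inter_subset_right.trans hsub)
  rw [ae_restrict_iff' (hK m).measurableSet]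
  filter_upwards [h0] with x hx hxK
  simpa [indicator_of_mem hxK] using hx

end Fundamental

/-! ### Weak derivatives and translations -/

section Translations

variable {U V : Set (Cyl n)} {φ : Cyl n → ℝ}

/-- The shear `(s, p) ↦ (s, p + s eᵢ)` preserves the product measure. This is what justifies every
Fubini exchange between the translation parameter and the point. -/
theorem integrable_comp_add_dirVec {F : Cyl n → ℝ} (hF : Integrable F) (i : Fin (n + 1))
    (ν : Measure ℝ) [IsFiniteMeasure ν] :
    Integrable (fun q : ℝ × Cyl n => F (q.2 + dirVec i q.1)) (ν.prod volume) := by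
  have h : MeasurePreserving (fun q : ℝ × Cyl n => (q.1, q.2 + dirVec i q.1))
      (ν.prod volume) (ν.prod volume) := by
    refine (MeasurePreserving.id ν).skew_product
      (g := fun s (p : Cyl n) => p + dirVec i s) ?_ (ae_of_all _ fun s => ?_)
    · exact (continuous_snd.add ((continuous_dirVec i).comp continuous_fst)).measurable
    · exact (measurePreserving_add_const _).map_eq
  exact h.integrable_comp_of_integrable (hF.comp_snd ν)

/-- Moving the translation onto `φ`, the function `s ↦ ∫ u φ(· - s eᵢ)` has derivative `-∫ u ∂ᵢφ(· -
s eᵢ) = ∫ F φ(· - s eᵢ)`. The fundamental theorem of calculus and Fubini then give the integrated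
form. Only translates of `φ` with `s ∈ [0, t]` are tested, so the hypothesis can be local. -/
theorem integral_translate_sub_mul {u F : Cyl n → ℝ} (hu : Integrable u) (hF : Integrable F)
    (hφ : IsTestFunction (cylCover n) univ φ) (i : Fin (n + 1)) {t : ℝ} (ht : 0 ≤ t)
    (hw : ∀ s ∈ Icc 0 t, ∫ p, u p * pderiv (cylCover n) i φ (p + dirVec i (-s)) =
      - ∫ p, F p * φ (p + dirVec i (-s))) :
    ∫ p, (u (p + dirVec i t) - u p) * φ p =
      ∫ p, (∫ s in (0 : ℝ)..t, F (p + dirVec i s)) * φ p := by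
  obtain ⟨C, C0, hC⟩ := hφ.exists_bound_pderiv i
  obtain ⟨D, D0, hD⟩ := hφ.exists_bound
  have hcd : Continuous fun q : ℝ × Cyl n => q.2 + dirVec i (-q.1) :=
    continuous_snd.add ((continuous_dirVec i).comp continuous_fst.neg)
  have hint : ∀ s, Integrable (fun p => u p * φ (p + dirVec i (-s))) := fun s =>
    hu.mul_bdd (hφ.continuous.comp (continuous_add_const _)).aestronglyMeasurable
      (ae_of_all _ fun p => hD _)
  have hder : ∀ s, HasDerivAt (fun s => ∫ p, u p * φ (p + dirVec i (-s)))
      (∫ p, u p * -pderiv (cylCover n) i φ (p + dirVec i (-s))) s := by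
    intro s
    refine (hasDerivAt_integral_of_dominated_loc_of_deriv_le (s := univ)
      (F := fun s p => u p * φ (p + dirVec i (-s)))
      (F' := fun s p => u p * -pderiv (cylCover n) i φ (p + dirVec i (-s)))
      (bound := fun p => ‖u p‖ * C) univ_mem
      (Eventually.of_forall fun s => (hint s).aestronglyMeasurable) (hint s) ?_ ?_ ?_ ?_).2
    · exact hu.aestronglyMeasurable.mul
        ((hφ.continuous_pderiv i).comp (continuous_add_const _)).neg.aestronglyMeasurable
    · refine ae_of_all _ fun p r _ => ?_
      rw [norm_mul, norm_neg]
      exact mul_le_mul_of_nonneg_left (hC _) (norm_nonneg _)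
    · exact hu.norm.mul_const C
    · refine ae_of_all _ fun p r _ => ?_
      have := (hφ.hasDerivAt i p (-r)).scomp r (hasDerivAt_neg r)
      simpa using this.const_mul (u p)
  have hcont : Continuous fun s => ∫ p, u p * -pderiv (cylCover n) i φ (p + dirVec i (-s)) := by
    refine continuous_of_dominated (bound := fun p => ‖u p‖ * C) (fun s => ?_) (fun s => ?_)
      (hu.norm.mul_const C) (ae_of_all _ fun p => ?_)
    · exact hu.aestronglyMeasurable.mul
        ((hφ.continuous_pderiv i).comp (continuous_add_const _)).neg.aestronglyMeasurable
    · refine ae_of_all _ fun p => ?_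
      rw [norm_mul, norm_neg]
      exact mul_le_mul_of_nonneg_left (hC _) (norm_nonneg _)
    · exact continuous_const.mul ((hφ.continuous_pderiv i).comp
        (hcd.comp (Continuous.prodMk_left p))).neg
  have hftc := intervalIntegral.integral_eq_sub_of_hasDerivAt (fun s _ => hder s)
    (hcont.intervalIntegrable 0 t)
  have hshift : ∀ (f : Cyl n → ℝ) s, ∫ p, f p * φ (p + dirVec i (-s)) =
      ∫ p, f (p + dirVec i s) * φ p := by
    intro f s
    rw [← integral_add_right_eq_self _ (dirVec i s)]
    congr 1; ext p
    rw [add_assoc p, ← dirVec_add, add_neg_cancel, dirVec_zero, add_zero]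
  have hl : ∫ p, (u (p + dirVec i t) - u p) * φ p =
      (∫ p, u p * φ (p + dirVec i (-t))) - ∫ p, u p * φ (p + dirVec i (-0)) := by
    have h0 := hshift u 0
    simp only [dirVec_zero, add_zero] at h0
    rw [h0, hshift]
    have h1 : Integrable (fun p => u (p + dirVec i t) * φ p) :=
      ((measurePreserving_add_const _).integrable_comp_of_integrable hu).mul_bdd
        hφ.continuous.aestronglyMeasurable (ae_of_all _ hD)
    have h2 : Integrable (fun p => u p * φ p) :=
      hu.mul_bdd hφ.continuous.aestronglyMeasurable (ae_of_all _ hD)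
    rw [← integral_sub h1 h2]
    congr 1; ext p; ring
  rw [hl, ← hftc]
  have h3 : ∀ s ∈ uIcc 0 t, ∫ p, u p * -pderiv (cylCover n) i φ (p + dirVec i (-s)) =
      ∫ p, F (p + dirVec i s) * φ p := by
    intro s hs
    rw [uIcc_of_le ht] at hs
    rw [← hshift F s, ← neg_neg (∫ p, F p * _), ← hw s hs, ← integral_neg]
    congr 1; ext p; ring
  rw [intervalIntegral.integral_congr h3, intervalIntegral.integral_of_le ht,
    integral_integral_swap]
  · congr 1; ext p
    rw [integral_mul_const, intervalIntegral.integral_of_le ht]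
  · refine (integrable_comp_add_dirVec hF i (volume.restrict (Ioc 0 t))).mul_bdd ?_
      (ae_of_all _ fun q => hD q.2)
    exact (hφ.continuous.comp continuous_snd).aestronglyMeasurable

/-- `F` is the weak `i`-th derivative of `u` on `U`. -/
def IsWeakPDeriv (i : Fin (n + 1)) (U : Set (Cyl n)) (u F : Cyl n → ℝ) : Prop :=
  ∀ φ : Cyl n → ℝ, IsTestFunction (cylCover n) U φ →
    ∫ x in U, u x * pderiv (cylCover n) i φ x = - ∫ x in U, F x * φ x

/-- The compact set swept out by `K` under translations by `s ∈ [0, t]`. -/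
def sweep (i : Fin (n + 1)) (t : ℝ) (K : Set (Cyl n)) : Set (Cyl n) :=
  (fun q : ℝ × Cyl n => q.2 + dirVec i q.1) '' (Icc 0 t ×ˢ K)

theorem isCompact_sweep (i : Fin (n + 1)) (t : ℝ) {K : Set (Cyl n)} (hK : IsCompact K) :
    IsCompact (sweep i t K) :=
  (isCompact_Icc.prod hK).image (continuous_snd.add ((continuous_dirVec i).comp continuous_fst))

theorem mem_sweep {i : Fin (n + 1)} {t s : ℝ} {K : Set (Cyl n)} {p : Cyl n} (hp : p ∈ K)
    (hs : s ∈ Icc 0 t) : p + dirVec i s ∈ sweep i t K := ⟨(s, p), ⟨hs, hp⟩, rfl⟩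

theorem integrable_intervalIntegral_translate {F : Cyl n → ℝ} (hF : Integrable F)
    (i : Fin (n + 1)) {t : ℝ} (ht : 0 ≤ t) :
    Integrable (fun p => ∫ s in (0 : ℝ)..t, F (p + dirVec i s)) := by
  simp only [intervalIntegral.integral_of_le ht]
  exact (integrable_comp_add_dirVec hF i (volume.restrict (Ioc 0 t))).integral_prod_right

/-- The integrated identity against every test function, followed by the fundamental lemma. Cutting
`u` and `F` off to the compact set swept out by the support of `φ` makes them globally integrable
without changing the values that `φ` sees. -/
theorem translate_ae (hV : IsOpen V) (i : Fin (n + 1)) {t : ℝ}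
    (ht : 0 ≤ t) (hVU : ∀ p ∈ V, ∀ s ∈ Icc 0 t, p + dirVec i s ∈ U)
    {u F : Cyl n → ℝ}
    (hu : ∀ K, IsCompact K → K ⊆ U → IntegrableOn u K)
    (hF : ∀ K, IsCompact K → K ⊆ U → IntegrableOn F K)
    (hw : IsWeakPDeriv i U u F) :
    ∀ᵐ p ∂volume.restrict V,
      u (p + dirVec i t) - u p = ∫ s in (0 : ℝ)..t, F (p + dirVec i s) := by
  have hsw : ∀ K ⊆ V, sweep i t K ⊆ U := by
    rintro K hK _ ⟨⟨s, p⟩, ⟨hs, hp⟩, rfl⟩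
    exact hVU p (hK hp) s hs
  have hloc : ∀ (f : Cyl n → ℝ) (K : Set (Cyl n)) (p : Cyl n) (s : ℝ), p ∈ K → s ∈ Icc 0 t →
      (sweep i t K).indicator f (p + dirVec i s) = f (p + dirVec i s) := fun f K p s hp hs =>
    indicator_of_mem (mem_sweep hp hs) f
  have hloc' : ∀ (K : Set (Cyl n)) (p : Cyl n), p ∈ K →
      (sweep i t K).indicator u (p + dirVec i t) - (sweep i t K).indicator u p -
        ∫ s in (0 : ℝ)..t, (sweep i t K).indicator F (p + dirVec i s) =
      u (p + dirVec i t) - u p - ∫ s in (0 : ℝ)..t, F (p + dirVec i s) := by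
    intro K p hp
    have h0 := hloc u K p 0 hp ⟨le_rfl, ht⟩
    rw [dirVec_zero, add_zero] at h0
    rw [h0, hloc u K p t hp ⟨ht, le_rfl⟩, intervalIntegral.integral_congr]
    intro s hs
    rw [uIcc_of_le ht] at hs
    exact hloc F K p s hp hs
  have hint : ∀ K, IsCompact K → K ⊆ V → Integrable ((sweep i t K).indicator u) ∧
      Integrable ((sweep i t K).indicator F) := fun K hK hKV =>
    ⟨(integrable_indicator_iff (isCompact_sweep i t hK).measurableSet).2
      (hu _ (isCompact_sweep i t hK) (hsw K hKV)),
     (integrable_indicator_iff (isCompact_sweep i t hK).measurableSet).2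
      (hF _ (isCompact_sweep i t hK) (hsw K hKV))⟩
  have hmain := ae_eq_zero_of_forall_test hV
    (f := fun p => u (p + dirVec i t) - u p - ∫ s in (0 : ℝ)..t, F (p + dirVec i s)) ?_ ?_
  · filter_upwards [hmain] with p hp
    linarith
  · intro K hK hKV
    obtain ⟨h1, h2⟩ := hint K hK hKV
    have h3 := (((measurePreserving_add_const (dirVec i t)).integrable_comp_of_integrable h1).sub
      h1).sub (integrable_intervalIntegral_translate h2 i ht)
    exact h3.integrableOn.congr_fun (fun p hp => hloc' K p hp) hK.measurableSet
  · intro φ hφ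
    obtain ⟨h1, h2⟩ := hint _ hφ.hasCompactSupport hφ.3
    obtain ⟨D, D0, hD⟩ := hφ.exists_bound
    set K := tsupport φ
    have h0 : ∀ p ∉ K, φ p = 0 := fun p hp => image_eq_zero_of_notMem_tsupport hp
    have hK := hφ.hasCompactSupport
    have := integral_translate_sub_mul (t := t) h1 h2 (hφ.mono (subset_univ _)) i ht ?_
    · rw [setIntegral_eq_integral_of_forall_compl_eq_zero fun p hp => by
        rw [h0 p fun h => hp (hφ.3 h), mul_zero]]
      have h5 : ∀ p, (u (p + dirVec i t) - u p - ∫ s in (0 : ℝ)..t, F (p + dirVec i s)) * φ p =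
          ((sweep i t K).indicator u (p + dirVec i t) - (sweep i t K).indicator u p) * φ p -
          (∫ s in (0 : ℝ)..t, (sweep i t K).indicator F (p + dirVec i s)) * φ p := by
        intro p
        by_cases hp : p ∈ K
        · rw [← hloc' K p hp]; ring
        · simp [h0 p hp]
      simp only [h5]
      rw [integral_sub, this, sub_self]
      · exact (((measurePreserving_add_const (dirVec i t)).integrable_comp_of_integrable h1).sub
          h1).mul_bdd hφ.continuous.aestronglyMeasurable (ae_of_all _ hD)
      · exact (integrable_intervalIntegral_translate h2 i ht).mul_bdd
          hφ.continuous.aestronglyMeasurable (ae_of_all _ hD)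
    · intro s hs
      have hsupp : ∀ x, x + dirVec i (-s) ∈ tsupport φ → x ∈ sweep i t K := by
        intro x hx
        have := mem_sweep (i := i) hx hs
        rwa [add_assoc, ← dirVec_add, neg_add_cancel, dirVec_zero, add_zero] at this
      have htest := hφ.comp_add (V := U) (dirVec i (-s)) fun x hx => hsw K hφ.3 (hsupp x hx)
      have := hw _ htest
      simp only [pderiv_comp_add] at this
      rw [setIntegral_eq_integral_of_forall_compl_eq_zero,
        setIntegral_eq_integral_of_forall_compl_eq_zero] at this
      · convert this using 2
        · ext p
          by_cases hp : p ∈ sweep i t K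
          · rw [indicator_of_mem hp]
          · rw [pderiv_eq_zero_of_notMem_tsupport i fun h => hp (hsupp p h)]; simp
        · congr 1; ext p
          by_cases hp : p ∈ sweep i t K
          · rw [indicator_of_mem hp]
          · rw [h0 _ fun h => hp (hsupp p h)]; simp
      · intro p hp
        rw [h0 _ fun h => hp (hsw K hφ.3 (hsupp p h)), mul_zero]
      · intro p hp
        rw [pderiv_eq_zero_of_notMem_tsupport i fun h => hp (hsw K hφ.3 (hsupp p h)), mul_zero]

theorem IsTestFunction.abs_sub_le (hφ : IsTestFunction (cylCover n) U φ) (i : Fin (n + 1))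
    {C : ℝ} (hC : ∀ x, |pderiv (cylCover n) i φ x| ≤ C) (p : Cyl n) (t : ℝ) :
    |φ (p + dirVec i t) - φ p| ≤ C * |t| := by
  have := convex_univ.norm_image_sub_le_of_norm_hasDerivWithin_le (𝕜 := ℝ)
    (f := fun t => φ (p + dirVec i t)) (f' := fun t => pderiv (cylCover n) i φ (p + dirVec i t))
    (x := 0) (y := t) (C := C) (fun x _ => (hφ.hasDerivAt i p x).hasDerivWithinAt)
    (fun x _ => hC _) (mem_univ _) (mem_univ _)
  simpa using this

/-- Shifting the difference quotient onto `φ` turns it into one that converges boundedly to `-∂ᵢφ`.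
Only `t ↓ 0` is needed, which matters later at the kink of `min`. -/
theorem isWeakPDeriv_of_tendsto (i : Fin (n + 1)) {u F : Cyl n → ℝ}
    (hu : ∀ K, IsCompact K → IntegrableOn u K)
    (h : ∀ φ, IsTestFunction (cylCover n) univ φ →
      Tendsto (fun t => ∫ p, t⁻¹ * (u (p + dirVec i t) - u p) * φ p) (𝓝[>] 0)
        (𝓝 (∫ p, F p * φ p))) : IsWeakPDeriv i univ u F := by
  intro φ hφ
  rw [Measure.restrict_univ, ← neg_eq_iff_eq_neg, ← integral_neg, eq_comm]
  obtain ⟨C, C0, hC⟩ := hφ.exists_bound_pderiv i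
  obtain ⟨D, D0, hD⟩ := hφ.exists_bound
  set K := tsupport φ
  have hK := hφ.hasCompactSupport
  have h0 : ∀ p ∉ K, φ p = 0 := fun p hp => image_eq_zero_of_notMem_tsupport hp
  set S := sweep i 1 K
  have hSc : IsCompact S := isCompact_sweep i 1 hK
  have huS : Integrable (S.indicator u) :=
    (integrable_indicator_iff hSc.measurableSet).2 (hu S hSc)
  have hKS : ∀ p, ∀ t ∈ Icc (0 : ℝ) 1, p + dirVec i (-t) ∈ K → p ∈ S := by
    intro p t ht hp
    have := mem_sweep (i := i) hp ht
    rwa [add_assoc, ← dirVec_add, neg_add_cancel, dirVec_zero, add_zero] at this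
  have hKS0 : ∀ p ∈ K, p ∈ S := fun p hp => hKS p 0 (by simp) (by simpa using hp)
  refine tendsto_nhds_unique (h φ hφ) ?_
  have heq : ∀ᶠ t in 𝓝[>] (0 : ℝ), ∫ p, t⁻¹ * (u (p + dirVec i t) - u p) * φ p =
      ∫ p, S.indicator u p * (t⁻¹ * (φ (p + dirVec i (-t)) - φ p)) := by
    filter_upwards [Ioc_mem_nhdsGT one_pos] with t ht
    have ht' : t ∈ Icc (0 : ℝ) 1 := ⟨ht.1.le, ht.2⟩
    have e1 : ∀ p, t⁻¹ * (u (p + dirVec i t) - u p) * φ p =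
        t⁻¹ * (S.indicator u (p + dirVec i t) * φ p) - t⁻¹ * (S.indicator u p * φ p) := by
      intro p
      by_cases hp : p ∈ K
      · rw [indicator_of_mem (mem_sweep hp ht'), indicator_of_mem (hKS0 p hp)]; ring
      · simp [h0 p hp]
    have i1 : Integrable (fun p => S.indicator u (p + dirVec i t) * φ p) :=
      ((measurePreserving_add_const _).integrable_comp_of_integrable huS).mul_bdd
        hφ.continuous.aestronglyMeasurable (ae_of_all _ hD)
    have i2 : Integrable (fun p => S.indicator u p * φ p) :=
      huS.mul_bdd hφ.continuous.aestronglyMeasurable (ae_of_all _ hD)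
    have i3 : Integrable (fun p => S.indicator u p * φ (p + dirVec i (-t))) :=
      huS.mul_bdd (hφ.continuous.comp (continuous_add_const _)).aestronglyMeasurable
        (ae_of_all _ fun _ => hD _)
    simp only [e1]
    rw [integral_sub (i1.const_mul _) (i2.const_mul _), integral_const_mul, integral_const_mul]
    have e2 : ∫ p, S.indicator u (p + dirVec i t) * φ p =
        ∫ p, S.indicator u p * φ (p + dirVec i (-t)) := by
      rw [← integral_add_right_eq_self (fun p => S.indicator u p * φ (p + dirVec i (-t)))
        (dirVec i t)]
      congr 1; ext p
      rw [add_assoc p, ← dirVec_add, add_neg_cancel, dirVec_zero, add_zero]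
    rw [e2, ← integral_const_mul, ← integral_const_mul,
      ← integral_sub (i3.const_mul _) (i2.const_mul _)]
    congr 1; ext p; ring
  refine Tendsto.congr' (heq.mono fun _ h => h.symm) ?_
  have e3 : ∀ p, -(u p * pderiv (cylCover n) i φ p) =
      S.indicator u p * -pderiv (cylCover n) i φ p := by
    intro p
    by_cases hp : p ∈ K
    · rw [indicator_of_mem (hKS0 p hp)]; ring
    · rw [pderiv_eq_zero_of_notMem_tsupport i hp]; simp
  simp only [e3]
  refine tendsto_integral_filter_of_dominated_convergence (fun p => ‖S.indicator u p‖ * C) ?_ ?_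
    (huS.norm.mul_const C) (ae_of_all _ fun p => ?_)
  · refine Eventually.of_forall fun t => huS.aestronglyMeasurable.mul ?_
    exact (((hφ.continuous.comp (continuous_add_const _)).sub
      hφ.continuous).const_mul _).aestronglyMeasurable
  · filter_upwards [self_mem_nhdsWithin] with t ht
    refine ae_of_all _ fun p => ?_
    rw [norm_mul]
    refine mul_le_mul_of_nonneg_left ?_ (norm_nonneg _)
    have := hφ.abs_sub_le i hC p (-t)
    have ht : 0 < t := ht
    rw [norm_mul, norm_inv, Real.norm_eq_abs, Real.norm_eq_abs, inv_mul_le_iff₀ (abs_pos.2 ht.ne')]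
    rwa [abs_neg, mul_comm] at this
  · refine Tendsto.const_mul _ ?_
    have h1 : HasDerivAt (fun t : ℝ => φ (p + dirVec i (-t))) (-pderiv (cylCover n) i φ p) 0 := by
      have := (hφ.hasDerivAt i p (-0)).scomp 0 (hasDerivAt_neg 0)
      simpa [Function.comp_def] using this
    have := h1.tendsto_slope_zero_right
    simpa using this

/-- Tested against `φ`, the difference quotient becomes the mean over `[0, t]` of the continuous
function `J s = ∫ F(· + s eᵢ) φ`, and such means tend to `J 0`. -/
theorem isWeakPDeriv_of_translate (i : Fin (n + 1)) {u F : Cyl n → ℝ}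
    (hu : ∀ K, IsCompact K → IntegrableOn u K) (hF : ∀ K, IsCompact K → IntegrableOn F K)
    (h : ∀ t, 0 < t → ∀ᵐ p, u (p + dirVec i t) - u p = ∫ s in (0 : ℝ)..t, F (p + dirVec i s)) :
    IsWeakPDeriv i univ u F := by
  refine isWeakPDeriv_of_tendsto i hu fun φ hφ => ?_
  obtain ⟨D, D0, hD⟩ := hφ.exists_bound
  set K := tsupport φ
  have hK := hφ.hasCompactSupport
  have h0 : ∀ p ∉ K, φ p = 0 := fun p hp => image_eq_zero_of_notMem_tsupport hp
  set S := sweep i 1 K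
  have hSc : IsCompact S := isCompact_sweep i 1 hK
  have hFS : Integrable (S.indicator F) :=
    (integrable_indicator_iff hSc.measurableSet).2 (hF S hSc)
  let J : ℝ → ℝ := fun s => ∫ p, S.indicator F p * φ (p + dirVec i (-s))
  have hJ : Continuous J := by
    refine continuous_of_dominated (bound := fun p => ‖S.indicator F p‖ * D) (fun s => ?_)
      (fun s => ?_) (hFS.norm.mul_const D) (ae_of_all _ fun p => ?_)
    · exact hFS.aestronglyMeasurable.mul
        (hφ.continuous.comp (continuous_add_const _)).aestronglyMeasurable
    · refine ae_of_all _ fun p => ?_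
      rw [norm_mul]
      exact mul_le_mul_of_nonneg_left (hD _) (norm_nonneg _)
    · exact continuous_const.mul (hφ.continuous.comp
        (continuous_const.add ((continuous_dirVec i).comp continuous_neg)))
  have hJ0 : J 0 = ∫ p, F p * φ p := by
    simp only [J]
    congr 1; ext p
    rw [neg_zero, dirVec_zero, add_zero]
    by_cases hp : p ∈ K
    · have := mem_sweep (i := i) (t := 1) hp (s := 0) (by simp)
      rw [dirVec_zero, add_zero] at this
      rw [indicator_of_mem this]
    · rw [h0 p hp]; simp
  have hJs : ∀ s, J s = ∫ p, S.indicator F (p + dirVec i s) * φ p := by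
    intro s
    simp only [J]
    rw [← integral_add_right_eq_self _ (dirVec i s)]
    congr 1; ext p
    rw [add_assoc p, ← dirVec_add, add_neg_cancel, dirVec_zero, add_zero]
  have hd : HasDerivAt (fun t => ∫ s in (0 : ℝ)..t, J s) (J 0) 0 :=
    intervalIntegral.integral_hasDerivAt_right (hJ.intervalIntegrable _ _)
      (hJ.stronglyMeasurableAtFilter _ _) hJ.continuousAt
  have hlim := hd.tendsto_slope_zero_right
  rw [hJ0] at hlim
  refine hlim.congr' ?_
  filter_upwards [Ioc_mem_nhdsGT one_pos] with t ht
  have ht0 : 0 ≤ t := ht.1.le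
  simp only [zero_add, intervalIntegral.integral_same, sub_zero, smul_eq_mul, hJs]
  rw [intervalIntegral.integral_of_le ht0, integral_integral_swap, ← integral_const_mul]
  · refine integral_congr_ae ?_
    filter_upwards [h t ht.1] with p hp
    rw [integral_mul_const, hp, mul_assoc]
    by_cases hpK : p ∈ K
    · rw [intervalIntegral.integral_of_le ht0]
      congr 2
      refine setIntegral_congr_fun measurableSet_Ioc fun s hs => ?_
      exact indicator_of_mem (mem_sweep hpK ⟨hs.1.le, hs.2.trans ht.2⟩) F
    · simp [h0 p hpK]
  · refine (integrable_comp_add_dirVec hFS i (volume.restrict (Ioc 0 t))).mul_bdd ?_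
      (ae_of_all _ fun q => hD q.2)
    exact (hφ.continuous.comp continuous_snd).aestronglyMeasurable

end Translations

/-! ### `L²` bounds for translates -/

section LTwo

variable {α : Type*} [MeasurableSpace α] {μ : Measure α}

theorem eLpNorm_two_sq {E : Type*} [NormedAddCommGroup E] (f : α → E) :
    eLpNorm f 2 μ ^ 2 = ∫⁻ x, ‖f x‖ₑ ^ 2 ∂μ := by
  rw [eLpNorm_eq_lintegral_rpow_enorm_toReal (by simp) (by simp), ← ENNReal.rpow_natCast,
    ← ENNReal.rpow_mul]
  simp

theorem eLpNorm_two_le_iff {E : Type*} [NormedAddCommGroup E] {f : α → E} {c : ℝ≥0∞} :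
    eLpNorm f 2 μ ≤ c ↔ ∫⁻ x, ‖f x‖ₑ ^ 2 ∂μ ≤ c ^ 2 := by
  rw [← eLpNorm_two_sq]
  exact (ENNReal.pow_le_pow_left_iff (by simp)).symm

theorem lintegral_sq_le {f : α → ℝ≥0∞} (hf : AEMeasurable f μ) :
    (∫⁻ x, f x ∂μ) ^ 2 ≤ μ univ * ∫⁻ x, f x ^ 2 ∂μ := by
  have h := ENNReal.lintegral_mul_le_Lp_mul_Lq μ Real.HolderConjugate.two_two
    (aemeasurable_const (b := (1 : ℝ≥0∞))) hf
  have h2 : ∫⁻ x, f x ∂μ ≤ (μ univ) ^ (1 / (2 : ℝ)) * (∫⁻ x, f x ^ 2 ∂μ) ^ (1 / (2 : ℝ)) := by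
    simpa using h
  calc (∫⁻ x, f x ∂μ) ^ 2
      ≤ ((μ univ) ^ (1 / (2 : ℝ)) * (∫⁻ x, f x ^ 2 ∂μ) ^ (1 / (2 : ℝ))) ^ 2 := by gcongr
    _ = μ univ * ∫⁻ x, f x ^ 2 ∂μ := by
      rw [mul_pow, ← ENNReal.rpow_natCast, ← ENNReal.rpow_natCast, ← ENNReal.rpow_mul,
        ← ENNReal.rpow_mul]
      simp

theorem lintegral_enorm_sq_le {E : Type*} [NormedAddCommGroup E] {f : α → E}
    (hf : AEStronglyMeasurable f μ) :
    (∫⁻ x, ‖f x‖ₑ ∂μ) ^ 2 ≤ μ univ * ∫⁻ x, ‖f x‖ₑ ^ 2 ∂μ :=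
  lintegral_sq_le hf.enorm

end LTwo

/-! ### Passing from compact subsets to open sets -/

section Compacts

variable {U : Set (Cyl n)}

theorem ae_restrict_of_forall_isCompact (hU : IsOpen U) {p : Cyl n → Prop}
    (h : ∀ K, IsCompact K → K ⊆ U → ∀ᵐ x ∂volume.restrict K, p x) :
    ∀ᵐ x ∂volume.restrict U, p x := by
  have : LocallyCompactSpace U := hU.locallyCompactSpace
  obtain ⟨K, hK, hKV⟩ : IsSigmaCompact U :=
    isSigmaCompact_iff_sigmaCompactSpace.2 inferInstance
  rw [← hKV, ae_restrict_iUnion_iff]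
  exact fun m => h _ (hK m) (hKV ▸ subset_iUnion K m)

theorem aestronglyMeasurable_of_forall_isCompact (hU : IsOpen U) {E : Type*}
    [NormedAddCommGroup E] {f : Cyl n → E}
    (h : ∀ K, IsCompact K → K ⊆ U → AEStronglyMeasurable f (volume.restrict K)) :
    AEStronglyMeasurable f (volume.restrict U) := by
  have : LocallyCompactSpace U := hU.locallyCompactSpace
  obtain ⟨K, hK, hKV⟩ : IsSigmaCompact U :=
    isSigmaCompact_iff_sigmaCompactSpace.2 inferInstance
  rw [← hKV, aestronglyMeasurable_iUnion_iff]
  exact fun m => h _ (hK m) (hKV ▸ subset_iUnion K m)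

theorem integrableOn_of_memLp_two {E : Type*} [NormedAddCommGroup E] {f : Cyl n → E}
    {K : Set (Cyl n)} (hK : IsCompact K) (hf : MemLp f 2 (volume.restrict K)) :
    IntegrableOn f K := by
  have : IsFiniteMeasure ((volume : Measure (Cyl n)).restrict K) :=
    ⟨by simpa using hK.measure_lt_top⟩
  exact hf.integrable (by norm_num)

variable {u : Cyl n → ℝ} {G : Cyl n → EuclideanSpace ℝ (Fin (n + 1))}

theorem _root_.MeasureTheory.MemLp.euclidean_apply {α : Type*} [MeasurableSpace α]
    {μ : Measure α} {k : ℕ} {G : α → EuclideanSpace ℝ (Fin k)} {p : ℝ≥0∞} (h : MemLp G p μ)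
    (i : Fin k) : MemLp (fun x => G x i) p μ :=
  (EuclideanSpace.proj i : EuclideanSpace ℝ (Fin k) →L[ℝ] ℝ).comp_memLp' h

theorem IsH1LocGrad.integrableOn_fun (h : IsH1LocGrad (cylCover n) U u G) (K : Set (Cyl n))
    (hK : IsCompact K) (hKU : K ⊆ U) : IntegrableOn u K :=
  integrableOn_of_memLp_two hK (h.memLp_fun K hK hKU)

theorem IsH1LocGrad.memLp_grad_apply (h : IsH1LocGrad (cylCover n) U u G) (i : Fin (n + 1))
    (K : Set (Cyl n)) (hK : IsCompact K) (hKU : K ⊆ U) :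
    MemLp (fun p => G p i) 2 (volume.restrict K) :=
  (h.memLp_grad K hK hKU).euclidean_apply i

theorem IsH1LocGrad.integrableOn_grad (h : IsH1LocGrad (cylCover n) U u G) (i : Fin (n + 1))
    (K : Set (Cyl n)) (hK : IsCompact K) (hKU : K ⊆ U) : IntegrableOn (fun p => G p i) K :=
  integrableOn_of_memLp_two hK (h.memLp_grad_apply i K hK hKU)

theorem IsH1LocGrad.isWeakPDeriv (h : IsH1LocGrad (cylCover n) U u G) (i : Fin (n + 1)) :
    IsWeakPDeriv i U u (fun p => G p i) := fun φ hφ => h.weakGrad φ hφ i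

theorem IsH1LocGrad.aestronglyMeasurable_fun (h : IsH1LocGrad (cylCover n) U u G)
    (hU : IsOpen U) : AEStronglyMeasurable u (volume.restrict U) :=
  aestronglyMeasurable_of_forall_isCompact hU fun K hK hKU => (h.memLp_fun K hK hKU).1

theorem IsH1LocGrad.aestronglyMeasurable_grad (h : IsH1LocGrad (cylCover n) U u G)
    (hU : IsOpen U) : AEStronglyMeasurable G (volume.restrict U) :=
  aestronglyMeasurable_of_forall_isCompact hU fun K hK hKU => (h.memLp_grad K hK hKU).1

end Compacts

/-! ### Translation estimates on the half cylinder -/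

section TranslationBounds

variable {V W : Set (Cyl n)}

/-- Cauchy–Schwarz on a segment of length `t` costs one factor `t`; integrating the translated
density over `s ∈ (0, t]` gives the other, by translation invariance. -/
theorem lintegral_translate_sq_le (hV : MeasurableSet V) (hW : MeasurableSet W)
    (i : Fin (n + 1)) {t : ℝ} (ht : 0 ≤ t) (hVW : ∀ p ∈ V, ∀ s ∈ Icc 0 t, p + dirVec i s ∈ W)
    {u F : Cyl n → ℝ} (hF : AEStronglyMeasurable F (volume.restrict W))
    (h : ∀ᵐ p ∂volume.restrict V,
      u (p + dirVec i t) - u p = ∫ s in (0 : ℝ)..t, F (p + dirVec i s)) :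
    ∫⁻ p in V, ‖u (p + dirVec i t) - u p‖ₑ ^ 2 ≤
      ENNReal.ofReal t ^ 2 * ∫⁻ p in W, ‖F p‖ₑ ^ 2 := by
  set F' := W.indicator F
  have hF' : AEStronglyMeasurable F' volume := (aestronglyMeasurable_indicator_iff hW).2 hF
  have hmp : MeasurePreserving (fun q : Cyl n × ℝ => (q.1 + dirVec i q.2, q.2))
      ((volume : Measure (Cyl n)).prod (volume.restrict (Ioc 0 t)))
      ((volume : Measure (Cyl n)).prod (volume.restrict (Ioc 0 t))) := by
    have h1 : MeasurePreserving (fun q : ℝ × Cyl n => (q.1, q.2 + dirVec i q.1))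
        ((volume.restrict (Ioc 0 t)).prod volume) ((volume.restrict (Ioc 0 t)).prod volume) := by
      refine (MeasurePreserving.id _).skew_product
        (g := fun s (p : Cyl n) => p + dirVec i s) ?_ (ae_of_all _ fun s => ?_)
      · exact (continuous_snd.add ((continuous_dirVec i).comp continuous_fst)).measurable
      · exact (measurePreserving_add_const _).map_eq
    exact (Measure.measurePreserving_swap.comp h1).comp Measure.measurePreserving_swap
  have hm : AEStronglyMeasurable (fun q : Cyl n × ℝ => F' (q.1 + dirVec i q.2))
      ((volume : Measure (Cyl n)).prod (volume.restrict (Ioc 0 t))) :=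
    (hF'.comp_fst).comp_measurePreserving hmp
  have hsl : ∀ᵐ p : Cyl n, AEStronglyMeasurable (fun s => F' (p + dirVec i s))
    (volume.restrict (Ioc 0 t)) := hm.prodMk_left
  have hpt : ∀ᵐ p ∂volume.restrict V, ‖u (p + dirVec i t) - u p‖ₑ ^ 2 ≤
      ENNReal.ofReal t * ∫⁻ s in Ioc 0 t, ‖F' (p + dirVec i s)‖ₑ ^ 2 := by
    filter_upwards [h, ae_restrict_of_ae hsl, ae_restrict_mem hV] with p hp hs hpV
    have e : ∫ s in (0 : ℝ)..t, F (p + dirVec i s) = ∫ s in Ioc 0 t, F' (p + dirVec i s) := by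
      rw [intervalIntegral.integral_of_le ht]
      refine setIntegral_congr_fun measurableSet_Ioc fun s hs => ?_
      exact (indicator_of_mem (hVW p hpV s ⟨hs.1.le, hs.2⟩) F).symm
    rw [hp, e]
    calc ‖∫ s in Ioc 0 t, F' (p + dirVec i s)‖ₑ ^ 2
        ≤ (∫⁻ s in Ioc 0 t, ‖F' (p + dirVec i s)‖ₑ) ^ 2 := by
          gcongr; exact enorm_integral_le_lintegral_enorm _
      _ ≤ _ := by simpa using lintegral_enorm_sq_le hs
  calc ∫⁻ p in V, ‖u (p + dirVec i t) - u p‖ₑ ^ 2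
      ≤ ∫⁻ p in V, ENNReal.ofReal t * ∫⁻ s in Ioc 0 t, ‖F' (p + dirVec i s)‖ₑ ^ 2 :=
        lintegral_mono_ae hpt
    _ ≤ ∫⁻ p, ENNReal.ofReal t * ∫⁻ s in Ioc 0 t, ‖F' (p + dirVec i s)‖ₑ ^ 2 :=
        lintegral_mono' Measure.restrict_le_self le_rfl
    _ = ENNReal.ofReal t * ∫⁻ s in Ioc 0 t, ∫⁻ p, ‖F' (p + dirVec i s)‖ₑ ^ 2 := by
        rw [lintegral_const_mul' _ _ ENNReal.ofReal_ne_top, lintegral_lintegral_swap]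
        exact hm.enorm.pow_const 2
    _ = ENNReal.ofReal t * ∫⁻ s in Ioc 0 t, ∫⁻ p, ‖F' p‖ₑ ^ 2 := by
        congr 2; ext s
        exact lintegral_add_right_eq_self (fun p => ‖F' p‖ₑ ^ 2) (dirVec i s)
    _ = ENNReal.ofReal t ^ 2 * ∫⁻ p in W, ‖F p‖ₑ ^ 2 := by
        have : ∀ p, ‖F' p‖ₑ ^ 2 = W.indicator (fun p => ‖F p‖ₑ ^ 2) p := fun p => by
          by_cases hp : p ∈ W <;> simp [F', hp]
        simp only [this, lintegral_indicator hW]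
        simp only [lintegral_const, MeasurableSet.univ, Measure.restrict_apply, univ_inter,
          Real.volume_Ioc, sub_zero]
        ring

theorem isOpen_upperHalf : IsOpen (upperHalf n) := isOpen_lt continuous_const continuous_snd

theorem measurableSet_upperHalf : MeasurableSet (upperHalf n) := isOpen_upperHalf.measurableSet

theorem add_mem_upperHalf {p b : Cyl n} (hp : p ∈ upperHalf n) (hb : 0 ≤ b.2) :
    p + b ∈ upperHalf n := add_pos_of_pos_of_nonneg hp hb

theorem dirVec_snd_nonneg (i : Fin (n + 1)) {t : ℝ} (ht : 0 ≤ t) :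
    0 ≤ (dirVec i t : Cyl n).2 := by
  refine Fin.lastCases ?_ (fun k => ?_) i <;> simp [ht]

/-- Only an inequality: an upward translation leaves the bottom strip of height `b.2` uncovered. -/
theorem map_add_restrict_upperHalf_le {b : Cyl n} (hb : 0 ≤ b.2) :
    Measure.map (fun p => p + b) (volume.restrict (upperHalf n)) ≤
      volume.restrict (upperHalf n) := by
  have h1 := ((measurePreserving_add_const b).restrict_preimage
    (measurableSet_upperHalf (n := n))).map_eq
  conv_rhs => rw [← h1]
  refine Measure.map_mono ?_ (measurable_add_const b)
  exact Measure.restrict_mono (fun p hp => add_mem_upperHalf hp hb) le_rfl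

theorem quasiMeasurePreserving_add_upperHalf {b : Cyl n} (hb : 0 ≤ b.2) :
    Measure.QuasiMeasurePreserving (fun p => p + b) (volume.restrict (upperHalf n))
      (volume.restrict (upperHalf n)) :=
  ⟨measurable_add_const b, (map_add_restrict_upperHalf_le hb).absolutelyContinuous⟩

theorem eLpNorm_comp_add_upperHalf_le {E : Type*} [NormedAddCommGroup E] {f : Cyl n → E}
    (hf : AEStronglyMeasurable f (volume.restrict (upperHalf n))) {b : Cyl n} (hb : 0 ≤ b.2)
    (p : ℝ≥0∞) : eLpNorm (fun x => f (x + b)) p (volume.restrict (upperHalf n)) ≤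
      eLpNorm f p (volume.restrict (upperHalf n)) := by
  have := eLpNorm_map_measure (p := p)
    (hf.mono_measure (map_add_restrict_upperHalf_le hb)) (measurable_add_const b).aemeasurable
  exact this.symm.le.trans (eLpNorm_mono_measure f (map_add_restrict_upperHalf_le hb))

theorem IsH1LocGrad.eLpNorm_translate_dirVec_le {u : Cyl n → ℝ}
    {G : Cyl n → EuclideanSpace ℝ (Fin (n + 1))}
    (h : IsH1LocGrad (cylCover n) (upperHalf n) u G) (i : Fin (n + 1)) {t : ℝ} (ht : 0 ≤ t) :
    eLpNorm (fun p => u (p + dirVec i t) - u p) 2 (volume.restrict (upperHalf n)) ≤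
      ENNReal.ofReal t * eLpNorm G 2 (volume.restrict (upperHalf n)) := by
  have hVV : ∀ p ∈ upperHalf n, ∀ s ∈ Icc 0 t, p + dirVec i s ∈ upperHalf n := fun p hp s hs =>
    add_mem_upperHalf hp (dirVec_snd_nonneg i hs.1)
  have h1 := translate_ae isOpen_upperHalf i ht hVV h.integrableOn_fun (h.integrableOn_grad i)
    (h.isWeakPDeriv i)
  have hm : AEStronglyMeasurable (fun p => G p i) (volume.restrict (upperHalf n)) :=
    (EuclideanSpace.proj i : EuclideanSpace ℝ (Fin (n + 1)) →L[ℝ] ℝ).continuous.comp_aestronglyMeasurable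
      (h.aestronglyMeasurable_grad isOpen_upperHalf)
  have h2 := lintegral_translate_sq_le measurableSet_upperHalf measurableSet_upperHalf i ht hVV
    hm h1
  rw [eLpNorm_two_le_iff, mul_pow]
  refine h2.trans ?_
  rw [eLpNorm_two_sq]
  gcongr with p
  exact enorm_le_iff_norm_le.2 (PiLp.norm_apply_le (G p) i)

/-- One coordinate at a time, by the triangle inequality. Nonnegative coordinates keep every
intermediate translate in the half cylinder; horizontally this loses nothing, as torus translations
have representatives in `[0, 1)`. -/
theorem IsH1LocGrad.eLpNorm_translate_le {u : Cyl n → ℝ}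
    {G : Cyl n → EuclideanSpace ℝ (Fin (n + 1))}
    (h : IsH1LocGrad (cylCover n) (upperHalf n) u G) {v : Fin (n + 1) → ℝ} (hv : ∀ i, 0 ≤ v i) :
    eLpNorm (fun p => u (p + cylCover n v) - u p) 2 (volume.restrict (upperHalf n)) ≤
      ENNReal.ofReal (∑ i, v i) * eLpNorm G 2 (volume.restrict (upperHalf n)) := by
  have hu := h.aestronglyMeasurable_fun isOpen_upperHalf
  have key : ∀ s : Finset (Fin (n + 1)),
      0 ≤ (cylCover n (∑ i ∈ s, Pi.single i (v i))).2 ∧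
      eLpNorm (fun p => u (p + cylCover n (∑ i ∈ s, Pi.single i (v i))) - u p) 2
        (volume.restrict (upperHalf n)) ≤
      ENNReal.ofReal (∑ i ∈ s, v i) * eLpNorm G 2 (volume.restrict (upperHalf n)) := by
    intro s
    induction s using Finset.induction_on with
    | empty => simp [cylCover_zero]
    | insert a s ha ih =>
      rw [Finset.sum_insert ha, Finset.sum_insert ha, cylCover_add]
      set b := cylCover n (∑ i ∈ s, Pi.single i (v i))
      change 0 ≤ (dirVec a (v a) + b : Cyl n).2 ∧
        eLpNorm (fun p => u (p + (dirVec a (v a) + b)) - u p) 2 _ ≤ _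
      refine ⟨add_nonneg (dirVec_snd_nonneg a (hv a)) ih.1, ?_⟩
      have e : (fun p => u (p + (dirVec a (v a) + b)) - u p) =
          (fun p => u (p + dirVec a (v a) + b) - u (p + dirVec a (v a))) +
          fun p => u (p + dirVec a (v a)) - u p := by
        ext p; simp [add_assoc]
      have m1 : ∀ b : Cyl n, 0 ≤ b.2 →
          AEStronglyMeasurable (fun p => u (p + b) - u p) (volume.restrict (upperHalf n)) :=
        fun b hb => (hu.comp_quasiMeasurePreserving (quasiMeasurePreserving_add_upperHalf hb)).sub hu
      have hd := dirVec_snd_nonneg (n := n) a (hv a)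
      rw [e, ENNReal.ofReal_add (hv a) (Finset.sum_nonneg fun i _ => hv i), add_mul, add_comm]
      refine (eLpNorm_add_le (m1 _ hd) ?_ (by norm_num)).trans ?_
      · exact (m1 b ih.1).comp_quasiMeasurePreserving (quasiMeasurePreserving_add_upperHalf hd)
      · exact add_le_add (h.eLpNorm_translate_dirVec_le a (hv a))
          ((eLpNorm_comp_add_upperHalf_le (m1 b ih.1) hd 2).trans ih.2)
  have := (key Finset.univ).2
  rwa [Finset.univ_sum_single] at this

end TranslationBounds

/-! ### Vertical primitives -/

/-- The slab `T^n × [a, b]`. -/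
def slab (n : ℕ) (a b : ℝ) : Set (Cyl n) := univ ×ˢ Icc a b

theorem mem_slab {a b : ℝ} {p : Cyl n} : p ∈ slab n a b ↔ a ≤ p.2 ∧ p.2 ≤ b := by
  simp [slab]

theorem isCompact_slab (a b : ℝ) : IsCompact (slab n a b) := isCompact_univ.prod isCompact_Icc

theorem measurableSet_slab (a b : ℝ) : MeasurableSet (slab n a b) :=
  (isCompact_slab a b).measurableSet

theorem restrict_univ_prod (s : Set ℝ) :
    (volume : Measure (Cyl n)).restrict (univ ×ˢ s) =
      (volume : Measure (Torus n)).prod (volume.restrict s) := by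
  rw [Measure.volume_eq_prod, ← Measure.prod_restrict, Measure.restrict_univ]

theorem volume_univ_prod (s : Set ℝ) :
    (volume : Measure (Cyl n)) ((univ : Set (Torus n)) ×ˢ s) = volume s := by
  rw [Measure.volume_eq_prod, Measure.prod_prod, measure_univ, one_mul]

theorem volume_slab (a b : ℝ) : volume (slab n a b) = ENNReal.ofReal (b - a) := by
  rw [slab, volume_univ_prod, Real.volume_Icc]

theorem exists_subset_slab {K : Set (Cyl n)} (hK : IsCompact K) :
    ∃ R : ℝ, 0 < R ∧ K ⊆ slab n (-R) R := by
  obtain ⟨R, R0, hR⟩ := hK.isBounded.subset_closedBall_lt 0 (0 : Cyl n)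
  refine ⟨R, R0, fun p hp => mem_slab.2 ?_⟩
  have := hR hp
  rw [mem_closedBall_zero_iff, Prod.norm_def, sup_le_iff] at this
  exact abs_le.1 this.2

theorem exists_subset_slab_of_upperHalf {K : Set (Cyl n)} (hK : IsCompact K)
    (hKU : K ⊆ upperHalf n) : ∃ a R : ℝ, 0 < a ∧ a < R ∧ K ⊆ slab n a R := by
  obtain ⟨R, R0, hR⟩ := exists_subset_slab hK
  rcases K.eq_empty_or_nonempty with rfl | hne
  · exact ⟨1, 2, one_pos, one_lt_two, empty_subset _⟩
  obtain ⟨q, hq, hmin⟩ := hK.exists_isMinOn hne continuous_snd.continuousOn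
  refine ⟨q.2, max R q.2 + 1, hKU hq, (le_max_right _ _).trans_lt (lt_add_one _), fun p hp =>
    mem_slab.2 ⟨hmin hp, ?_⟩⟩
  exact (mem_slab.1 (hR hp)).2.trans ((le_max_left _ _).trans (lt_add_one _).le)

theorem slab_subset_upperHalf {a : ℝ} (ha : 0 < a) (b : ℝ) : slab n a b ⊆ upperHalf n :=
  fun _ hp => ha.trans_le (mem_slab.1 hp).1

/-- The primitive `∫_{y₀}^y F(x, s) ds` in the vertical direction. -/
def vprim (F : Cyl n → ℝ) (y₀ : ℝ) (p : Cyl n) : ℝ := ∫ s in y₀..p.2, F (p.1, s)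

section VPrim

variable {F : Cyl n → ℝ}

/-- The exceptional null set of `x` must not depend on `a, b`; it is the union over the countably
many slabs `[-N, N]`. -/
theorem ae_intervalIntegrable (hF : ∀ K, IsCompact K → IntegrableOn F K) :
    ∀ᵐ x : Torus n, ∀ a b, IntervalIntegrable (fun s => F (x, s)) volume a b := by
  have h : ∀ᵐ x : Torus n, ∀ N : ℕ, IntegrableOn (fun s => F (x, s)) (Icc (-N : ℝ) N) := by
    rw [ae_all_iff]
    intro N
    have := hF (slab n (-N) N) (isCompact_slab _ _)
    rw [slab, IntegrableOn, restrict_univ_prod] at this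
    exact this.prod_right_ae
  filter_upwards [h] with x hx a b
  obtain ⟨N, hN⟩ := exists_nat_ge (max |a| |b|)
  rw [intervalIntegrable_iff]
  refine (hx N).mono_set fun s hs => ?_
  have h1 := uIoc_subset_uIcc hs
  have ha := abs_le.1 ((le_max_left |a| |b|).trans hN)
  have hb := abs_le.1 ((le_max_right |a| |b|).trans hN)
  exact uIcc_subset_Icc ha hb h1

theorem aestronglyMeasurable_of_forall_integrableOn (hF : ∀ K, IsCompact K → IntegrableOn F K) :
    AEStronglyMeasurable F volume := by
  have := aestronglyMeasurable_of_forall_isCompact (f := F) isOpen_univ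
    fun K hK _ => (hF K hK).aestronglyMeasurable
  rwa [Measure.restrict_univ] at this

theorem ae_vprim_congr {F' : Cyl n → ℝ} (h : F =ᵐ[volume] F') (y₀ : ℝ) :
    ∀ᵐ x : Torus n, ∀ y, vprim F y₀ (x, y) = vprim F' y₀ (x, y) := by
  have : ∀ᵐ x : Torus n, ∀ᵐ s : ℝ, F (x, s) = F' (x, s) := Measure.ae_ae_of_ae_prod h
  filter_upwards [this] with x hx y
  exact intervalIntegral.integral_congr_ae (hx.mono fun s hs _ => hs)

theorem ae_of_ae_fst {P : Torus n → Prop} (h : ∀ᵐ x, P x) : ∀ᵐ p : Cyl n, P p.1 :=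
  Measure.quasiMeasurePreserving_fst.ae h

/-- The moving endpoint is put into the integrand as an indicator, so that measurability of
parametric integrals over all of `ℝ` applies. -/
theorem stronglyMeasurable_vprim (hF : StronglyMeasurable F) (y₀ : ℝ) :
    StronglyMeasurable (vprim F y₀) := by
  have h : ∀ p : Cyl n, vprim F y₀ p =
      (∫ s, if y₀ < s ∧ s ≤ p.2 then F (p.1, s) else 0) -
        ∫ s, if p.2 < s ∧ s ≤ y₀ then F (p.1, s) else 0 := by
    intro p
    rw [vprim, intervalIntegral, ← integral_indicator measurableSet_Ioc,
      ← integral_indicator measurableSet_Ioc]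
    simp [indicator_apply]
  have hF' : StronglyMeasurable fun q : Cyl n × ℝ => F (q.1.1, q.2) :=
    hF.comp_measurable (by fun_prop)
  rw [show vprim F y₀ = _ from funext h]
  refine StronglyMeasurable.sub ?_ ?_
  · refine StronglyMeasurable.integral_prod_right' (f := fun q : Cyl n × ℝ =>
      if y₀ < q.2 ∧ q.2 ≤ q.1.2 then F (q.1.1, q.2) else 0) ?_
    refine StronglyMeasurable.ite ?_ hF' stronglyMeasurable_const
    exact (measurableSet_lt (f := fun _ : Cyl n × ℝ => y₀) (g := fun q => q.2) (by fun_prop)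
      (by fun_prop)).inter (measurableSet_le (f := fun q : Cyl n × ℝ => q.2) (g := fun q => q.1.2)
        (by fun_prop) (by fun_prop))
  · refine StronglyMeasurable.integral_prod_right' (f := fun q : Cyl n × ℝ =>
      if q.1.2 < q.2 ∧ q.2 ≤ y₀ then F (q.1.1, q.2) else 0) ?_
    refine StronglyMeasurable.ite ?_ hF' stronglyMeasurable_const
    exact (measurableSet_lt (f := fun q : Cyl n × ℝ => q.1.2) (g := fun q => q.2) (by fun_prop)
      (by fun_prop)).inter (measurableSet_le (f := fun q : Cyl n × ℝ => q.2) (g := fun _ => y₀)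
        (by fun_prop) (by fun_prop))

theorem aestronglyMeasurable_vprim (hF : AEStronglyMeasurable F volume) (y₀ : ℝ) :
    AEStronglyMeasurable (vprim F y₀) volume :=
  ⟨vprim (hF.mk F) y₀, stronglyMeasurable_vprim hF.stronglyMeasurable_mk y₀,
    (ae_of_ae_fst (ae_vprim_congr hF.ae_eq_mk y₀)).mono fun p hp => hp p.2⟩

theorem integrableOn_vprim (hF : ∀ K, IsCompact K → IntegrableOn F K) (y₀ : ℝ)
    {K : Set (Cyl n)} (hK : IsCompact K) : IntegrableOn (vprim F y₀) K := by
  obtain ⟨R, R0, hR⟩ := exists_subset_slab hK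
  set N := max R |y₀|
  have hKN : K ⊆ slab n (-N) N := fun p hp => by
    have := mem_slab.1 (hR hp)
    have h2 : R ≤ N := le_max_left _ _
    exact mem_slab.2 ⟨by linarith, by linarith⟩
  refine IntegrableOn.mono_set ?_ hKN
  have h1 := hF (slab n (-N) N) (isCompact_slab _ _)
  rw [slab, IntegrableOn, restrict_univ_prod] at h1 ⊢
  have h2 := h1.norm.integral_prod_left.comp_fst (volume.restrict (Icc (-N) N))
  refine h2.mono' ?_ ?_
  · rw [← restrict_univ_prod]
    exact (aestronglyMeasurable_vprim (aestronglyMeasurable_of_forall_integrableOn hF) y₀).restrict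
  · have hsl : ∀ᵐ p ∂(volume : Measure (Torus n)).prod (volume.restrict (Icc (-N) N)),
        Integrable (fun y => F (p.1, y)) (volume.restrict (Icc (-N) N)) :=
      Measure.quasiMeasurePreserving_fst.ae h1.prod_right_ae
    rw [← restrict_univ_prod] at hsl ⊢
    filter_upwards [hsl, ae_restrict_mem (measurableSet_slab (-N) N)] with p hp hpN
    have hp2 := mem_slab.1 hpN
    have hy : |y₀| ≤ N := le_max_right _ _
    rw [vprim]
    refine (intervalIntegral.norm_integral_le_integral_norm_uIoc).trans ?_
    refine setIntegral_mono_set hp.norm (ae_of_all _ fun _ => norm_nonneg _) ?_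
    refine LE.le.eventuallyLE fun s hs => ?_
    exact uIcc_subset_Icc (abs_le.1 hy) hp2 (uIoc_subset_uIcc hs)

theorem vprim_add_dirVec_sub {x : Torus n}
    (hx : ∀ a b, IntervalIntegrable (fun s => F (x, s)) volume a b) (y₀ y t : ℝ) :
    vprim F y₀ ((x, y) + dirVec (Fin.last n) t) - vprim F y₀ (x, y) =
      ∫ s in (0 : ℝ)..t, F ((x, y) + dirVec (Fin.last n) s) := by
  simp only [dirVec_last, vprim, Prod.mk_add_mk, add_zero]
  rw [intervalIntegral.integral_interval_sub_left (hx _ _) (hx _ _)]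
  simp [intervalIntegral.integral_comp_add_left fun s => F (x, s)]

/-- A function which is invariant under vertical translations does not depend on `y`. -/
theorem exists_eq_fst_of_translate {I : Set ℝ} (hI : IsOpen I) {c d : ℝ} (hcd : c < d)
    (hIcd : Icc c d ⊆ I) {w : Cyl n → ℝ} (hw : ∀ K, IsCompact K → K ⊆ {p | p.2 ∈ I} →
      IntegrableOn w K)
    (h : ∀ t, 0 < t → ∀ᵐ p : Cyl n, p.2 ∈ I → p.2 + t ∈ I → w (p.1, p.2 + t) = w p) :
    ∃ τ : Torus n → ℝ, StronglyMeasurable τ ∧ Integrable τ ∧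
      ∀ᵐ p ∂volume.restrict {p : Cyl n | p.2 ∈ I}, w p = τ p.1 := by
  have hUo : IsOpen {p : Cyl n | p.2 ∈ I} := hI.preimage continuous_snd
  have hm : AEStronglyMeasurable w (volume.restrict {p : Cyl n | p.2 ∈ I}) :=
    aestronglyMeasurable_of_forall_isCompact hUo fun K hK hKU =>
      (hw K hK hKU).aestronglyMeasurable
  set w₀ := hm.mk w
  have hw₀ : StronglyMeasurable w₀ := hm.stronglyMeasurable_mk
  have hww : ∀ᵐ p : Cyl n, p.2 ∈ I → w p = w₀ p :=
    (ae_restrict_iff' hUo.measurableSet).1 hm.ae_eq_mk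
  have hshift : ∀ (t : ℝ) {P : Cyl n → Prop}, (∀ᵐ p, P p) → ∀ᵐ p : Cyl n, P (p.1, p.2 + t) := by
    intro t P hP
    have := (measurePreserving_add_const (dirVec (Fin.last n) t)).quasiMeasurePreserving.ae hP
    filter_upwards [this] with p hp
    simpa [dirVec_last, Prod.add_def] using hp
  have h0 : ∀ t, 0 < t → ∀ᵐ p : Cyl n, p.2 ∈ I → p.2 + t ∈ I → w₀ (p.1, p.2 + t) = w₀ p := by
    intro t ht
    filter_upwards [h t ht, hww, hshift t hww] with p h1 h2 h3 hp hpt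
    rw [← h2 hp, ← h3 hpt, h1 hp hpt]
  -- Negative `t` follows from positive `-t` by translating the base point.
  have h1 : ∀ t, ∀ᵐ p : Cyl n, p.2 ∈ I → p.2 + t ∈ I → w₀ (p.1, p.2 + t) = w₀ p := by
    intro t
    rcases lt_trichotomy t 0 with ht | rfl | ht
    · filter_upwards [hshift t (h0 (-t) (by linarith))] with p hp hpI hpt
      have := hp hpt (by simpa using hpI)
      simpa using this.symm
    · simp
    · exact h0 t ht
  have hmeas : MeasurableSet {q : Cyl n × ℝ |
      q.1.2 ∈ I → q.1.2 + q.2 ∈ I → w₀ (q.1.1, q.1.2 + q.2) = w₀ q.1} := by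
    have e : {q : Cyl n × ℝ |
      q.1.2 ∈ I → q.1.2 + q.2 ∈ I → w₀ (q.1.1, q.1.2 + q.2) = w₀ q.1} =
        {q | q.1.2 ∈ I}ᶜ ∪ ({q | q.1.2 + q.2 ∈ I}ᶜ ∪
          {q | w₀ (q.1.1, q.1.2 + q.2) = w₀ q.1}) := by
      ext q
      simp only [mem_ofPred_eq, mem_union, mem_compl_iff]
      tauto
    rw [e]
    refine MeasurableSet.union ?_ (MeasurableSet.union ?_ ?_)
    · exact (hI.preimage (by fun_prop : Continuous fun q : Cyl n × ℝ => q.1.2)).measurableSet.compl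
    · exact (hI.preimage
        (by fun_prop : Continuous fun q : Cyl n × ℝ => q.1.2 + q.2)).measurableSet.compl
    · exact measurableSet_eq_fun (hw₀.measurable.comp (by fun_prop))
        (hw₀.measurable.comp (by fun_prop))
  -- Swapping the quantifiers needs a measurable relation, which is why `w` was replaced by the
  -- measurable version `w₀`. After substituting `y = p.2 + t`, a second swap produces one good
  -- height `y`, and `τ` is the slice of `w₀` there.
  have h2 : ∀ᵐ p : Cyl n, ∀ᵐ t : ℝ, p.2 ∈ I → p.2 + t ∈ I → w₀ (p.1, p.2 + t) = w₀ p :=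
    (Measure.ae_ae_comm (p := fun (p : Cyl n) (t : ℝ) => p.2 ∈ I → p.2 + t ∈ I →
      w₀ (p.1, p.2 + t) = w₀ p) hmeas).2 (ae_of_all _ h1)
  have h3 : ∀ᵐ p : Cyl n, ∀ᵐ y : ℝ, p.2 ∈ I → y ∈ I → w₀ (p.1, y) = w₀ p := by
    filter_upwards [h2] with p hp
    have := (measurePreserving_sub_right volume p.2).quasiMeasurePreserving.ae hp
    filter_upwards [this] with y hy
    simpa using hy
  have hmeas' : MeasurableSet {q : Cyl n × ℝ | q.1.2 ∈ I → q.2 ∈ I → w₀ (q.1.1, q.2) = w₀ q.1} := by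
    have e : {q : Cyl n × ℝ | q.1.2 ∈ I → q.2 ∈ I → w₀ (q.1.1, q.2) = w₀ q.1} =
        {q | q.1.2 ∈ I}ᶜ ∪ ({q | q.2 ∈ I}ᶜ ∪ {q | w₀ (q.1.1, q.2) = w₀ q.1}) := by
      ext q
      simp only [mem_ofPred_eq, mem_union, mem_compl_iff]
      tauto
    rw [e]
    refine MeasurableSet.union ?_ (MeasurableSet.union ?_ ?_)
    · exact (hI.preimage (by fun_prop : Continuous fun q : Cyl n × ℝ => q.1.2)).measurableSet.compl
    · exact (hI.preimage (by fun_prop : Continuous fun q : Cyl n × ℝ => q.2)).measurableSet.compl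
    · exact measurableSet_eq_fun (hw₀.measurable.comp (by fun_prop))
        (hw₀.measurable.comp (by fun_prop))
  have h4 := (Measure.ae_ae_comm (p := fun (p : Cyl n) (y : ℝ) => p.2 ∈ I → y ∈ I →
      w₀ (p.1, y) = w₀ p) hmeas').1 h3
  have hint : IntegrableOn w₀ (slab n c d) := by
    refine (hw _ (isCompact_slab c d) fun p hp => hIcd (mem_slab.1 hp)).congr_fun_ae ?_
    rw [EventuallyEq, ae_restrict_iff' (measurableSet_slab c d)]
    filter_upwards [hww] with p hp hps using hp (hIcd (mem_slab.1 hps))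
  rw [slab, IntegrableOn, restrict_univ_prod] at hint
  have h5 := hint.prod_left_ae
  have : NeZero ((volume : Measure ℝ).restrict (Icc c d)) := ⟨by
    rw [Ne, Measure.restrict_eq_zero, Real.volume_Icc]; simpa using hcd⟩
  obtain ⟨y, ⟨hy1, hy2⟩, hy3⟩ :=
    ((h5.and (ae_restrict_of_ae h4)).and (ae_restrict_mem measurableSet_Icc)).exists
  refine ⟨fun x => w₀ (x, y), hw₀.comp_measurable (by fun_prop), hy1, ?_⟩
  rw [ae_restrict_iff' hUo.measurableSet]
  filter_upwards [hy2, hww] with p hp hp' hpI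
  rw [hp' hpI, hp hpI (hIcd hy3)]

/-- After subtracting the vertical primitive, `u` is invariant under vertical translations and hence
a function of `x`. `I` must be an interval so that vertical segments stay inside. `F` is integrable
on compacts of the whole cylinder, so `y₀` may be an endpoint of `I`; with `I = (0, ∞)` and `y₀ =
0`, `τ` becomes the trace. -/
theorem exists_eq_add_vprim {I : Set ℝ} (hI : IsOpen I) (hIc : I.OrdConnected) {c d : ℝ}
    (hcd : c < d) (hIcd : Icc c d ⊆ I) {u : Cyl n → ℝ}
    (hu : ∀ K, IsCompact K → K ⊆ {p | p.2 ∈ I} → IntegrableOn u K)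
    (hF : ∀ K, IsCompact K → IntegrableOn F K)
    (hw : IsWeakPDeriv (Fin.last n) {p | p.2 ∈ I} u F) (y₀ : ℝ) :
    ∃ τ : Torus n → ℝ, StronglyMeasurable τ ∧ Integrable τ ∧
      ∀ᵐ p ∂volume.restrict {p : Cyl n | p.2 ∈ I}, u p = τ p.1 + vprim F y₀ p := by
  have htr : ∀ t, 0 < t → ∀ᵐ p : Cyl n, p.2 ∈ I → p.2 + t ∈ I →
      u (p.1, p.2 + t) - vprim F y₀ (p.1, p.2 + t) = u p - vprim F y₀ p := by
    intro t ht
    have hV : IsOpen {p : Cyl n | p.2 ∈ I ∧ p.2 + t ∈ I} :=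
      (hI.preimage continuous_snd).inter
        (hI.preimage (by fun_prop : Continuous fun p : Cyl n => p.2 + t))
    have h1 := translate_ae hV (Fin.last n) ht.le (U := {p | p.2 ∈ I}) (fun p hp s hs => ?_)
      hu (fun K hK _ => hF K hK) hw
    · rw [ae_restrict_iff' hV.measurableSet] at h1
      filter_upwards [h1, ae_of_ae_fst (ae_intervalIntegrable hF)] with p hp hpi hpI hpt
      have e := hp ⟨hpI, hpt⟩
      rw [← vprim_add_dirVec_sub hpi y₀ p.2 t] at e
      have e2 : p + dirVec (Fin.last n) t = (p.1, p.2 + t) := by simp [dirVec_last, Prod.add_def]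
      rw [e2] at e
      change _ = _ - vprim F y₀ p at e
      linarith
    · exact hIc.out hp.1 hp.2 ⟨by simpa using hs.1, by simpa using hs.2⟩
  obtain ⟨τ, h1, h2, h3⟩ := exists_eq_fst_of_translate (w := fun p => u p - vprim F y₀ p) hI hcd
    hIcd (fun K hK hKU => (hu K hK hKU).sub (integrableOn_vprim hF y₀ hK)) htr
  refine ⟨τ, h1, h2, h3.mono fun p hp => ?_⟩
  rw [← hp]; ring

end VPrim

/-! ### Operations on `H¹_loc` functions -/

section Operations

variable {U V : Set (Cyl n)} {u v φ : Cyl n → ℝ}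
  {G H : Cyl n → EuclideanSpace ℝ (Fin (n + 1))}

theorem IsTestFunction.eq_zero_of_notMem (hφ : IsTestFunction (cylCover n) U φ) {x : Cyl n}
    (hx : x ∉ U) : φ x = 0 :=
  image_eq_zero_of_notMem_tsupport fun h => hx (hφ.3 h)

theorem IsTestFunction.pderiv_eq_zero_of_notMem (hφ : IsTestFunction (cylCover n) U φ)
    (i : Fin (n + 1)) {x : Cyl n} (hx : x ∉ U) : pderiv (cylCover n) i φ x = 0 :=
  pderiv_eq_zero_of_notMem_tsupport i fun h => hx (hφ.3 h)

theorem IsTestFunction.setIntegral_mul (hφ : IsTestFunction (cylCover n) U φ) (f : Cyl n → ℝ) :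
    ∫ x in U, f x * φ x = ∫ x, f x * φ x :=
  setIntegral_eq_integral_of_forall_compl_eq_zero fun x hx => by
    rw [hφ.eq_zero_of_notMem hx, mul_zero]

theorem IsTestFunction.setIntegral_mul_pderiv (hφ : IsTestFunction (cylCover n) U φ)
    (f : Cyl n → ℝ) (i : Fin (n + 1)) :
    ∫ x in U, f x * pderiv (cylCover n) i φ x = ∫ x, f x * pderiv (cylCover n) i φ x :=
  setIntegral_eq_integral_of_forall_compl_eq_zero fun x hx => by
    rw [hφ.pderiv_eq_zero_of_notMem i hx, mul_zero]

theorem IsTestFunction.integrable_mul (hφ : IsTestFunction (cylCover n) U φ) {f : Cyl n → ℝ}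
    (hf : ∀ K, IsCompact K → K ⊆ U → IntegrableOn f K) : Integrable (fun x => f x * φ x) := by
  obtain ⟨D, D0, hD⟩ := hφ.exists_bound
  have hK := hφ.hasCompactSupport
  have h1 : Integrable ((tsupport φ).indicator f) :=
    (integrable_indicator_iff (IsCompact.measurableSet hK)).2 (hf _ hK hφ.3)
  refine (h1.mul_bdd hφ.continuous.aestronglyMeasurable (ae_of_all _ hD)).congr
    (ae_of_all _ fun x => ?_)
  by_cases hx : x ∈ tsupport φ
  · simp [hx]
  · simp [image_eq_zero_of_notMem_tsupport hx]

theorem IsTestFunction.integrable_mul_pderiv (hφ : IsTestFunction (cylCover n) U φ)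
    (i : Fin (n + 1)) {f : Cyl n → ℝ}
    (hf : ∀ K, IsCompact K → K ⊆ U → IntegrableOn f K) :
    Integrable (fun x => f x * pderiv (cylCover n) i φ x) := by
  obtain ⟨D, D0, hD⟩ := hφ.exists_bound_pderiv i
  have hK := hφ.hasCompactSupport
  have h1 : Integrable ((tsupport φ).indicator f) :=
    (integrable_indicator_iff (IsCompact.measurableSet hK)).2 (hf _ hK hφ.3)
  refine (h1.mul_bdd (hφ.continuous_pderiv i).aestronglyMeasurable (ae_of_all _ hD)).congr
    (ae_of_all _ fun x => ?_)
  by_cases hx : x ∈ tsupport φ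
  · simp [hx]
  · simp [pderiv_eq_zero_of_notMem_tsupport i hx]

theorem IsH1LocGrad.mono (h : IsH1LocGrad (cylCover n) U u G) (hVU : V ⊆ U) :
    IsH1LocGrad (cylCover n) V u G := by
  refine ⟨fun K hK hKV => h.memLp_fun K hK (hKV.trans hVU),
    fun K hK hKV => h.memLp_grad K hK (hKV.trans hVU), fun φ hφ i => ?_⟩
  have := h.weakGrad φ (hφ.mono hVU) i
  rwa [(hφ.mono hVU).setIntegral_mul_pderiv, (hφ.mono hVU).setIntegral_mul,
    ← hφ.setIntegral_mul_pderiv, ← hφ.setIntegral_mul] at this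

theorem IsH1LocGrad.congr_ae (h : IsH1LocGrad (cylCover n) U u G)
    (huv : ∀ᵐ p ∂volume.restrict U, u p = v p) (hGH : ∀ᵐ p ∂volume.restrict U, G p = H p) :
    IsH1LocGrad (cylCover n) U v H := by
  refine ⟨fun K hK hKU => (h.memLp_fun K hK hKU).ae_eq (ae_restrict_of_ae_restrict_of_subset hKU huv),
    fun K hK hKU => (h.memLp_grad K hK hKU).ae_eq (ae_restrict_of_ae_restrict_of_subset hKU hGH),
    fun φ hφ i => ?_⟩
  have := h.weakGrad φ hφ i
  rwa [integral_congr_ae (g := fun p => v p * pderiv (cylCover n) i φ p)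
    (huv.mono fun p hp => by simp only [hp]), integral_congr_ae (f := fun p => G p i * φ p)
    (g := fun p => H p i * φ p) (hGH.mono fun p hp => by simp only [hp])] at this

theorem IsH1LocGrad.add (h : IsH1LocGrad (cylCover n) U u G)
    (h' : IsH1LocGrad (cylCover n) U v H) :
    IsH1LocGrad (cylCover n) U (fun p => u p + v p) (fun p => G p + H p) := by
  refine ⟨fun K hK hKU => (h.memLp_fun K hK hKU).add (h'.memLp_fun K hK hKU),
    fun K hK hKU => (h.memLp_grad K hK hKU).add (h'.memLp_grad K hK hKU), fun φ hφ i => ?_⟩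
  simp only [add_mul, PiLp.add_apply]
  rw [integral_add (hφ.integrable_mul_pderiv i h.integrableOn_fun).integrableOn
    (hφ.integrable_mul_pderiv i h'.integrableOn_fun).integrableOn,
    integral_add (hφ.integrable_mul (h.integrableOn_grad i)).integrableOn
    (hφ.integrable_mul (h'.integrableOn_grad i)).integrableOn, h.weakGrad φ hφ i,
    h'.weakGrad φ hφ i]
  ring

theorem IsH1LocGrad.neg (h : IsH1LocGrad (cylCover n) U u G) :
    IsH1LocGrad (cylCover n) U (fun p => -u p) (fun p => -G p) := by
  refine ⟨fun K hK hKU => (h.memLp_fun K hK hKU).neg,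
    fun K hK hKU => (h.memLp_grad K hK hKU).neg, fun φ hφ i => ?_⟩
  simp only [neg_mul, PiLp.neg_apply, integral_neg, h.weakGrad φ hφ i]

theorem IsH1LocGrad.sub (h : IsH1LocGrad (cylCover n) U u G)
    (h' : IsH1LocGrad (cylCover n) U v H) :
    IsH1LocGrad (cylCover n) U (fun p => u p - v p) (fun p => G p - H p) := by
  simpa only [sub_eq_add_neg] using h.add h'.neg

theorem isH1LocGrad_const (U : Set (Cyl n)) (c : ℝ) :
    IsH1LocGrad (cylCover n) U (fun _ => c) (fun _ => 0) := by
  have hfin : ∀ K : Set (Cyl n), IsCompact K →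
      IsFiniteMeasure ((volume : Measure (Cyl n)).restrict K) := fun K hK =>
    ⟨by simpa using hK.measure_lt_top⟩
  have : IsH1LocGrad (cylCover n) univ (fun _ => c) (fun _ => 0) := by
    refine ⟨fun K hK _ => ?_, fun K hK _ => MemLp.zero', fun φ hφ i => ?_⟩
    · have := hfin K hK
      exact memLp_const c
    · refine isWeakPDeriv_of_translate i (u := fun _ => c) (F := fun _ => 0) (fun K hK => ?_)
        (fun K hK => integrableOn_zero) (fun t _ => ae_of_all _ fun p => by simp) φ hφ
      have := hfin K hK
      exact integrable_const c
  exact this.mono (subset_univ U)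

/-- The affine map `(x, y) ↦ (x, σ y + δ)`. -/
def yAff (σ δ : ℝ) (p : Cyl n) : Cyl n := (p.1, σ * p.2 + δ)

theorem continuous_yAff (σ δ : ℝ) : Continuous (yAff σ δ : Cyl n → Cyl n) := by
  unfold yAff; fun_prop

theorem yAff_yAff {σ : ℝ} (hσ : σ * σ = 1) (δ : ℝ) (p : Cyl n) :
    yAff σ δ (yAff σ (-(σ * δ)) p) = p := by
  ext
  · rfl
  · simp only [yAff]; linear_combination (p.2 - δ) * hσ

theorem yAff_yAff' {σ : ℝ} (hσ : σ * σ = 1) (δ : ℝ) (p : Cyl n) :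
    yAff σ (-(σ * δ)) (yAff σ δ p) = p := by
  ext
  · rfl
  · simp only [yAff]; linear_combination p.2 * hσ

/-- `yAff` as a homeomorphism. -/
def yAffHomeo {σ : ℝ} (hσ : σ * σ = 1) (δ : ℝ) : Cyl n ≃ₜ Cyl n where
  toFun := yAff σ δ
  invFun := yAff σ (-(σ * δ))
  left_inv := yAff_yAff' hσ δ
  right_inv := yAff_yAff hσ δ
  continuous_toFun := continuous_yAff _ _
  continuous_invFun := continuous_yAff _ _

theorem measurePreserving_yAff {σ : ℝ} (hσ : σ * σ = 1) (δ : ℝ) :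
    MeasurePreserving (yAff σ δ : Cyl n → Cyl n) volume volume := by
  have h1 : MeasurePreserving (fun y : ℝ => σ * y + δ) volume volume := by
    rcases mul_self_eq_one_iff.1 hσ with rfl | rfl
    · simpa using measurePreserving_add_right (volume : Measure ℝ) δ
    · have := (measurePreserving_add_right (volume : Measure ℝ) δ).comp
        (Measure.measurePreserving_neg (volume : Measure ℝ))
      simpa [Function.comp_def] using this
  exact (MeasurePreserving.id (volume : Measure (Torus n))).prod h1

theorem yAff_dirVec (σ δ : ℝ) (i : Fin (n + 1)) (p : Cyl n) (t : ℝ) :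
    yAff σ δ (p + dirVec i t) = yAff σ δ p + dirVec i ((if i = Fin.last n then σ else 1) * t) := by
  refine Fin.lastCases ?_ (fun k => ?_) i
  · rw [if_pos rfl, dirVec_last, dirVec_last]
    simp only [yAff, Prod.fst_add, Prod.snd_add, Prod.mk_add_mk, add_zero]
    congr 1; ring
  · rw [if_neg (Fin.castSucc_ne_last k), one_mul, dirVec_castSucc]
    simp only [yAff, Prod.fst_add, Prod.snd_add, Prod.mk_add_mk, add_zero]

/-- Multiplication of the last coordinate by `σ`. -/
def scaleLast (σ : ℝ) (w : EuclideanSpace ℝ (Fin (n + 1))) : EuclideanSpace ℝ (Fin (n + 1)) :=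
  WithLp.toLp 2 fun i => (if i = Fin.last n then σ else 1) * w i

theorem scaleLast_apply (σ : ℝ) (w : EuclideanSpace ℝ (Fin (n + 1))) (i : Fin (n + 1)) :
    scaleLast σ w i = (if i = Fin.last n then σ else 1) * w i := rfl

theorem norm_scaleLast {σ : ℝ} (hσ : σ * σ = 1) (w : EuclideanSpace ℝ (Fin (n + 1))) :
    ‖scaleLast σ w‖ = ‖w‖ := by
  rw [EuclideanSpace.norm_eq, EuclideanSpace.norm_eq]
  congr 1
  refine Finset.sum_congr rfl fun i _ => ?_
  rw [scaleLast_apply, Real.norm_eq_abs, Real.norm_eq_abs, sq_abs, sq_abs]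
  split_ifs
  · linear_combination (w i) ^ 2 * hσ
  · ring

theorem continuous_scaleLast (σ : ℝ) :
    Continuous (scaleLast σ : EuclideanSpace ℝ (Fin (n + 1)) → _) := by
  unfold scaleLast
  fun_prop

theorem IsTestFunction.comp_yAff (hφ : IsTestFunction (cylCover n) U φ) {σ : ℝ} (hσ : σ * σ = 1)
    (δ : ℝ) (hV : ∀ p, yAff σ δ p ∈ U → p ∈ V) :
    IsTestFunction (cylCover n) V (fun p => φ (yAff σ δ p)) := by
  refine ⟨?_, hφ.hasCompactSupport.comp_homeomorph (yAffHomeo hσ δ), fun p hp => hV p ?_⟩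
  · have : (fun p => φ (yAff σ δ p)) ∘ cylCover n = (φ ∘ cylCover n) ∘
        fun w => fun i => (if i = Fin.last n then σ else 1) * w i +
          if i = Fin.last n then δ else 0 := by
      ext w
      simp [cylCover, yAff, (Fin.castSucc_lt_last _).ne]
    rw [this]
    refine hφ.smooth.comp (contDiff_pi.2 fun i => ?_)
    exact (contDiff_const.mul (contDiff_apply _ _ _)).add contDiff_const
  · exact hφ.3 (tsupport_comp_subset_preimage φ (continuous_yAff σ δ) hp)

theorem IsTestFunction.pderiv_comp_yAff (hφ : IsTestFunction (cylCover n) U φ) (σ δ : ℝ)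
    (i : Fin (n + 1)) (p : Cyl n) : pderiv (cylCover n) i (fun p => φ (yAff σ δ p)) p =
      (if i = Fin.last n then σ else 1) * pderiv (cylCover n) i φ (yAff σ δ p) := by
  set c := (if i = Fin.last n then σ else 1)
  have h1 := hφ.hasDerivAt i (yAff σ δ p) (c * 0)
  have h2 : HasDerivAt (fun t : ℝ => c * t) c 0 := by simpa using (hasDerivAt_id (0 : ℝ)).const_mul c
  have h3 := h1.scomp 0 h2
  simp only [mul_zero, dirVec_zero, add_zero, smul_eq_mul] at h3
  rw [← h3.deriv]
  unfold pderiv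
  congr 1; ext t
  exact congrArg φ (yAff_dirVec σ δ i p t)

/-- The condition `σ² = 1` treats vertical shifts and reflections together: the map preserves
volume, and its inverse pulls test functions back to test functions, with a factor `σ` on the last
derivative only. -/
theorem IsH1LocGrad.comp_yAff (h : IsH1LocGrad (cylCover n) U u G) {σ : ℝ} (hσ : σ * σ = 1)
    (δ : ℝ) (hV : ∀ p ∈ V, yAff σ δ p ∈ U) :
    IsH1LocGrad (cylCover n) V (fun p => u (yAff σ δ p))
      (fun p => scaleLast σ (G (yAff σ δ p))) := by
  have hK : ∀ K : Set (Cyl n), IsCompact K → K ⊆ V →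
      ∃ L, IsCompact L ∧ L ⊆ U ∧ MeasurePreserving (yAff σ δ) (volume.restrict K)
        (volume.restrict L) := by
    intro K hK hKV
    have hL := hK.image (continuous_yAff (n := n) σ δ)
    refine ⟨_, hL, ?_, ?_⟩
    · rintro _ ⟨p, hp, rfl⟩
      exact hV p (hKV hp)
    · have := (measurePreserving_yAff (n := n) hσ δ).restrict_preimage hL.measurableSet
      rwa [preimage_image_eq _ (show Function.Injective (yAff σ δ : Cyl n → Cyl n) from (yAffHomeo hσ δ).injective)] at this
  refine ⟨fun K hKc hKV => ?_, fun K hKc hKV => ?_, fun φ hφ i => ?_⟩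
  · obtain ⟨L, hL, hLU, hmp⟩ := hK K hKc hKV
    exact (h.memLp_fun L hL hLU).comp_measurePreserving hmp
  · obtain ⟨L, hL, hLU, hmp⟩ := hK K hKc hKV
    have h1 := (h.memLp_grad L hL hLU).comp_measurePreserving hmp
    refine h1.of_le ((continuous_scaleLast σ).comp_aestronglyMeasurable h1.1)
      (ae_of_all _ fun p => (norm_scaleLast hσ _).le)
  · have ht : IsTestFunction (cylCover n) U (fun p => φ (yAff σ (-(σ * δ)) p)) :=
      hφ.comp_yAff hσ _ fun p hp => by
        have := hV _ hp
        rwa [yAff_yAff hσ] at this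
    have hw := h.weakGrad _ ht i
    simp only [hφ.pderiv_comp_yAff] at hw
    have e1 : ∀ p, pderiv (cylCover n) i φ p =
        (if i = Fin.last n then σ else 1) * pderiv (cylCover n) i
          (fun p => φ (yAff σ (-(σ * δ)) p)) (yAff σ δ p) := by
      intro p
      rw [hφ.pderiv_comp_yAff, yAff_yAff' hσ, ← mul_assoc]
      split_ifs <;> simp [hσ]
    rw [hφ.setIntegral_mul_pderiv, hφ.setIntegral_mul]
    have hmp := measurePreserving_yAff (n := n) hσ δ
    have hme := (yAffHomeo (n := n) hσ δ).measurableEmbedding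
    have hcomp : ∀ f : Cyl n → ℝ, ∫ p, f (yAff σ δ p) = ∫ p, f p := hmp.integral_comp hme
    have e2 : ∫ p, u (yAff σ δ p) * pderiv (cylCover n) i φ p =
        (if i = Fin.last n then σ else 1) * ∫ p, u p * pderiv (cylCover n) i
          (fun p => φ (yAff σ (-(σ * δ)) p)) p := by
      rw [← hcomp fun p => u p * pderiv (cylCover n) i (fun p => φ (yAff σ (-(σ * δ)) p)) p,
        ← integral_const_mul]
      congr 1; ext p
      rw [e1]; ring
    have e3 : ∫ p, scaleLast σ (G (yAff σ δ p)) i * φ p =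
        (if i = Fin.last n then σ else 1) * ∫ p, G p i * φ (yAff σ (-(σ * δ)) p) := by
      rw [← hcomp fun p => G p i * φ (yAff σ (-(σ * δ)) p), ← integral_const_mul]
      congr 1; ext p
      rw [yAff_yAff' hσ, scaleLast_apply]; ring
    have hw := h.weakGrad _ ht i
    rw [ht.setIntegral_mul_pderiv, ht.setIntegral_mul] at hw
    rw [e2, e3, hw]; ring

theorem IsH1LocGrad.shiftUp (h : IsH1LocGrad (cylCover n) univ u G) (δ : ℝ) :
    IsH1LocGrad (cylCover n) (upperHalf n) (shiftUp δ u) (fun p => G (p.1, p.2 + δ)) := by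
  have := h.comp_yAff (V := upperHalf n) (σ := 1) (by norm_num) δ (fun _ _ => mem_univ _)
  refine this.congr_ae (ae_of_all _ fun p => ?_) (ae_of_all _ fun p => ?_)
  · simp [yAff, InterfaceEnergy.shiftUp]
  · ext i; simp [scaleLast_apply, yAff]

theorem IsH1LocGrad.shiftDown (h : IsH1LocGrad (cylCover n) univ u G) (δ : ℝ) :
    IsH1LocGrad (cylCover n) (upperHalf n) (shiftDown δ u)
      (fun p => scaleLast (-1) (G (p.1, -p.2 - δ))) := by
  have := h.comp_yAff (V := upperHalf n) (σ := -1) (by norm_num) (-δ) (fun _ _ => mem_univ _)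
  refine this.congr_ae (ae_of_all _ fun p => ?_) (ae_of_all _ fun p => ?_)
  · simp [yAff, InterfaceEnergy.shiftDown, sub_eq_add_neg]
  · simp [yAff, sub_eq_add_neg]

/-- The support of `φ` lies in two disjoint open sets, so each point of it has a neighbourhood in
just one of them, and cutting off creates no discontinuity. -/
theorem IsTestFunction.indicator (hφ : IsTestFunction (cylCover n) (U ∪ V) φ) (hU : IsOpen U)
    (hV : IsOpen V) (hUV : Disjoint U V) : IsTestFunction (cylCover n) U (U.indicator φ) := by
  have hts : tsupport (U.indicator φ) ⊆ tsupport φ :=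
    closure_mono (by rw [support_indicator]; exact inter_subset_right)
  have hV0 : ∀ p ∈ V, U.indicator φ =ᶠ[𝓝 p] 0 := fun p hp => by
    filter_upwards [hV.mem_nhds hp] with q hq
    exact indicator_of_notMem (fun h => hUV.le_bot ⟨h, hq⟩) _
  have hsub : tsupport (U.indicator φ) ⊆ U := by
    intro p hp
    rcases hφ.3 (hts hp) with h | h
    · exact h
    · exact absurd hp (notMem_tsupport_iff_eventuallyEq.2 (hV0 p h))
  refine ⟨?_, hφ.hasCompactSupport.mono' (subset_closure.trans hts), hsub⟩
  rw [contDiff_iff_contDiffAt]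
  intro w
  have hc := continuous_cylCover (n := n) |>.continuousAt (x := w)
  by_cases hw : cylCover n w ∈ U
  · refine hφ.smooth.contDiffAt.congr_of_eventuallyEq ?_
    filter_upwards [hc (hU.mem_nhds hw)] with q hq
    exact indicator_of_mem (a := cylCover n q) hq φ
  · have h0 := notMem_tsupport_iff_eventuallyEq.1 fun h => hw (hsub h)
    refine (contDiffAt_const (c := (0 : ℝ))).congr_of_eventuallyEq ?_
    exact hc.eventually h0

theorem memLp_two_add_measure {α E : Type*} [MeasurableSpace α] [NormedAddCommGroup E]
    {μ ν : Measure α} {f : α → E} (hμ : MemLp f 2 μ) (hν : MemLp f 2 ν) : MemLp f 2 (μ + ν) := by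
  have hm := hμ.1.add_measure hν.1
  rw [memLp_two_iff_integrable_sq_norm hm]
  exact ((memLp_two_iff_integrable_sq_norm hμ.1).1 hμ).add_measure
    ((memLp_two_iff_integrable_sq_norm hν.1).1 hν)

theorem IsH1LocGrad.union (hU : IsOpen U) (hV : IsOpen V) (hUV : Disjoint U V)
    (h : IsH1LocGrad (cylCover n) U u G) (h' : IsH1LocGrad (cylCover n) V u G) :
    IsH1LocGrad (cylCover n) (U ∪ V) u G := by
  have hK : ∀ K : Set (Cyl n), IsCompact K → K ⊆ U ∪ V →
      ∃ A B, IsCompact A ∧ IsCompact B ∧ A ⊆ U ∧ B ⊆ V ∧ K = A ∪ B := by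
    intro K hK hKUV
    refine ⟨K \ V, K \ U, hK.diff hV, hK.diff hU, fun p hp => (hKUV hp.1).resolve_right hp.2,
      fun p hp => (hKUV hp.1).resolve_left hp.2, ?_⟩
    ext p
    constructor
    · intro hp
      rcases hKUV hp with h | h
      · exact Or.inl ⟨hp, fun h' => hUV.le_bot ⟨h, h'⟩⟩
      · exact Or.inr ⟨hp, fun h' => hUV.le_bot ⟨h', h⟩⟩
    · rintro (hp | hp) <;> exact hp.1
  refine ⟨fun K hKc hKUV => ?_, fun K hKc hKUV => ?_, fun φ hφ i => ?_⟩
  · obtain ⟨A, B, hA, hB, hAU, hBV, rfl⟩ := hK K hKc hKUV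
    rw [Measure.restrict_union (hUV.mono hAU hBV) hB.measurableSet]
    exact memLp_two_add_measure (h.memLp_fun A hA hAU) (h'.memLp_fun B hB hBV)
  · obtain ⟨A, B, hA, hB, hAU, hBV, rfl⟩ := hK K hKc hKUV
    rw [Measure.restrict_union (hUV.mono hAU hBV) hB.measurableSet]
    exact memLp_two_add_measure (h.memLp_grad A hA hAU) (h'.memLp_grad B hB hBV)
  · have t1 := hφ.indicator hU hV hUV
    have t2 := (union_comm U V ▸ hφ).indicator hV hU hUV.symm
    have d : ∀ (W : Set (Cyl n)), IsOpen W → ∀ p ∈ W,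
        pderiv (cylCover n) i φ p = pderiv (cylCover n) i (W.indicator φ) p := by
      intro W hW p hp
      have hc : Tendsto (fun t : ℝ => p + cylCover n (Pi.single i t)) (𝓝 0) (𝓝 p) := by
        have : Continuous fun t : ℝ => p + dirVec i t := continuous_const.add (continuous_dirVec i)
        have h0 := this.tendsto 0
        rwa [dirVec_zero, add_zero] at h0
      refine EventuallyEq.deriv_eq ?_
      filter_upwards [hc (hW.mem_nhds hp)] with t ht
      exact (indicator_of_mem (a := p + cylCover n (Pi.single i t)) ht φ).symm
    have w1 := h.weakGrad _ t1 i
    have w2 := h'.weakGrad _ t2 i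
    have e1 : ∀ W : Set (Cyl n), IsOpen W →
        ∫ p in W, u p * pderiv (cylCover n) i (W.indicator φ) p =
        ∫ p in W, u p * pderiv (cylCover n) i φ p := fun W hW =>
      setIntegral_congr_fun hW.measurableSet fun p hp => by simp only [d W hW p hp]
    have e2 : ∀ W : Set (Cyl n), IsOpen W →
        ∫ p in W, G p i * W.indicator φ p = ∫ p in W, G p i * φ p := fun W hW =>
      setIntegral_congr_fun hW.measurableSet fun p hp => by simp only [indicator_of_mem hp]
    have i1 : ∀ W, IsOpen W → ∀ {f : Cyl n → ℝ}, IsTestFunction (cylCover n) W (W.indicator φ) →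
        (∀ K, IsCompact K → K ⊆ W → IntegrableOn f K) →
        IntegrableOn (fun p => f p * pderiv (cylCover n) i φ p) W ∧
        IntegrableOn (fun p => f p * φ p) W := by
      intro W hW f ht hf
      refine ⟨(ht.integrable_mul_pderiv i hf).integrableOn.congr_fun (fun p hp => ?_)
        hW.measurableSet, (ht.integrable_mul hf).integrableOn.congr_fun (fun p hp => ?_)
        hW.measurableSet⟩
      · simp only [d W hW p hp]
      · simp only [indicator_of_mem hp]
    rw [e1 U hU, e2 U hU] at w1
    rw [e1 V hV, e2 V hV] at w2
    rw [setIntegral_union hUV hV.measurableSet (i1 U hU t1 h.integrableOn_fun).1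
      (i1 V hV t2 h'.integrableOn_fun).1, setIntegral_union hUV hV.measurableSet
      (i1 U hU t1 (h.integrableOn_grad i)).2 (i1 V hV t2 (h'.integrableOn_grad i)).2, w1, w2]
    ring

/-- `T^n × (-∞, 0)`. -/
def lowerHalf (n : ℕ) : Set (Cyl n) := {p | p.2 < 0}

theorem isOpen_lowerHalf : IsOpen (lowerHalf n) := isOpen_lt continuous_snd continuous_const

theorem slitCyl_eq_union : slitCyl n = upperHalf n ∪ lowerHalf n := by
  ext p
  simp only [slitCyl, upperHalf, lowerHalf, mem_union, mem_ofPred_eq, ne_eq]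
  rw [← ne_eq, ne_iff_lt_or_gt, or_comm]

theorem disjoint_upperHalf_lowerHalf : Disjoint (upperHalf n) (lowerHalf n) :=
  Set.disjoint_left.2 fun p (hp : 0 < p.2) (hp' : p.2 < 0) => lt_asymm hp hp'

theorem isOpen_slitCyl : IsOpen (slitCyl n) :=
  slitCyl_eq_union ▸ isOpen_upperHalf.union isOpen_lowerHalf

/-- The gradient of `glue up um`. -/
def glueGrad (Hp Hm : Cyl n → EuclideanSpace ℝ (Fin (n + 1))) :
    Cyl n → EuclideanSpace ℝ (Fin (n + 1)) :=
  fun p => if 0 < p.2 then Hp p else scaleLast (-1) (Hm (p.1, -p.2))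

theorem IsH1LocGrad.glue {up um : Cyl n → ℝ} {Hp Hm : Cyl n → EuclideanSpace ℝ (Fin (n + 1))}
    (hp : IsH1LocGrad (cylCover n) (upperHalf n) up Hp)
    (hm : IsH1LocGrad (cylCover n) (upperHalf n) um Hm) :
    IsH1LocGrad (cylCover n) (slitCyl n) (glue up um) (glueGrad Hp Hm) := by
  rw [slitCyl_eq_union]
  refine IsH1LocGrad.union isOpen_upperHalf isOpen_lowerHalf disjoint_upperHalf_lowerHalf ?_ ?_
  · refine hp.congr_ae ?_ ?_ <;>
    · filter_upwards [ae_restrict_mem measurableSet_upperHalf] with p hp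
      have : 0 < p.2 := hp
      simp [InterfaceEnergy.glue, glueGrad, this]
  · have := hm.comp_yAff (V := lowerHalf n) (σ := -1) (by norm_num) 0 fun p hp => by
      have : p.2 < 0 := hp
      simpa [yAff, upperHalf] using this
    refine this.congr_ae ?_ ?_ <;>
    · filter_upwards [ae_restrict_mem isOpen_lowerHalf.measurableSet] with p hp
      have : ¬ 0 < p.2 := not_lt.2 (le_of_lt hp)
      simp [InterfaceEnergy.glue, glueGrad, this, yAff]

end Operations

/-! ### Functions depending on `x` only -/

section LiftTorus

/-- Fubini in `y`: each horizontal slice of a test function on the cylinder is a test function on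
the torus. -/
theorem isWeakPDeriv_fst {g : Torus n → ℝ} {D : Torus n → EuclideanSpace ℝ (Fin n)}
    (hg : Integrable g) (hD : ∀ k, Integrable (fun x => D x k))
    (h : IsWeakGrad (torusCover n) univ g D) (k : Fin n) :
    IsWeakPDeriv k.castSucc univ (fun p : Cyl n => g p.1) (fun p => D p.1 k) := by
  intro φ hφ
  have hcomp : ∀ f : Torus n → ℝ, Integrable f → ∀ K : Set (Cyl n), IsCompact K →
      K ⊆ univ → IntegrableOn (fun p : Cyl n => f p.1) K := by
    intro f hf K hK _
    obtain ⟨R, R0, hR⟩ := exists_subset_slab hK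
    refine IntegrableOn.mono_set ?_ hR
    rw [slab, IntegrableOn, restrict_univ_prod]
    exact hf.comp_fst _
  have i1 := hφ.integrable_mul_pderiv k.castSucc (hcomp g hg)
  have i2 := hφ.integrable_mul (hcomp _ (hD k))
  rw [Measure.restrict_univ, Measure.volume_eq_prod, integral_prod_symm _ i1,
    integral_prod_symm _ i2, ← integral_neg]
  congr 1; ext y
  have ht : IsTestFunction (torusCover n) univ (fun x => φ (x, y)) := by
    refine ⟨?_, HasCompactSupport.of_compactSpace _, subset_univ _⟩
    have : (fun x => φ (x, y)) ∘ torusCover n =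
        (φ ∘ cylCover n) ∘ fun w => (Fin.snoc w y : Fin (n + 1) → ℝ) := by
      ext w
      simp only [Function.comp_apply, cylCover, Fin.snoc_castSucc, Fin.snoc_last]
      rfl
    rw [this]
    refine hφ.smooth.comp (contDiff_pi.2 fun i => ?_)
    refine Fin.lastCases ?_ (fun k => ?_) i
    · simpa using contDiff_const
    · simpa using contDiff_apply ℝ ℝ k
  have := h _ ht k
  rw [Measure.restrict_univ] at this
  convert this using 4 with x
  unfold pderiv
  congr 1; ext t
  have e : (x, y) + cylCover n (Pi.single k.castSucc t) = (x + torusCover n (Pi.single k t), y) := by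
    have := dirVec_castSucc k t
    rw [dirVec] at this
    rw [this]; simp
  rw [e]

end LiftTorus

/-! ### Bounds for vertical primitives on the upper half cylinder -/

section HalfCylinder

theorem upperHalf_eq_prod : upperHalf n = (univ : Set (Torus n)) ×ˢ Ioi (0 : ℝ) := by
  ext p; simp [upperHalf]

theorem restrict_upperHalf : (volume : Measure (Cyl n)).restrict (upperHalf n) =
    (volume : Measure (Torus n)).prod (volume.restrict (Ioi 0)) := by
  rw [upperHalf_eq_prod, restrict_univ_prod]

/-- The strip `T^n × (0, h)`. -/
def strip (n : ℕ) (h : ℝ) : Set (Cyl n) := univ ×ˢ Ioo 0 h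

theorem mem_strip {h : ℝ} {p : Cyl n} : p ∈ strip n h ↔ 0 < p.2 ∧ p.2 < h := by simp [strip]

theorem measurableSet_strip (h : ℝ) : MeasurableSet (strip n h) :=
  MeasurableSet.univ.prod measurableSet_Ioo

theorem strip_subset_upperHalf (h : ℝ) : strip n h ⊆ upperHalf n := fun _ hp => (mem_strip.1 hp).1

theorem volume_strip (h : ℝ) : volume (strip n h) = ENNReal.ofReal h := by
  rw [strip, volume_univ_prod, Real.volume_Ioo, sub_zero]

variable {F : Cyl n → ℝ}

theorem enorm_vprim_sq_le {p : Cyl n} (hp : 0 < p.2)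
    (hF : AEStronglyMeasurable (fun s => F (p.1, s)) (volume.restrict (Ioi 0))) :
    ‖vprim F 0 p‖ₑ ^ 2 ≤ ENNReal.ofReal p.2 * ∫⁻ s in Ioi (0 : ℝ), ‖F (p.1, s)‖ₑ ^ 2 := by
  rw [vprim, intervalIntegral.integral_of_le hp.le]
  have hsub : Ioc (0 : ℝ) p.2 ⊆ Ioi 0 := fun s hs => hs.1
  calc ‖∫ s in Ioc 0 p.2, F (p.1, s)‖ₑ ^ 2 ≤ (∫⁻ s in Ioc 0 p.2, ‖F (p.1, s)‖ₑ) ^ 2 := by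
        gcongr; exact enorm_integral_le_lintegral_enorm _
    _ ≤ ENNReal.ofReal p.2 * ∫⁻ s in Ioc 0 p.2, ‖F (p.1, s)‖ₑ ^ 2 := by
        simpa using lintegral_enorm_sq_le (hF.mono_set hsub)
    _ ≤ _ := by gcongr

theorem ae_enorm_vprim_sq_le
    (hF : AEStronglyMeasurable F (volume.restrict (upperHalf n))) :
    ∀ᵐ p ∂volume.restrict (upperHalf n), ‖vprim F 0 p‖ₑ ^ 2 ≤
      ENNReal.ofReal p.2 * ∫⁻ s in Ioi (0 : ℝ), ‖F (p.1, s)‖ₑ ^ 2 := by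
  rw [restrict_upperHalf] at hF
  have h1 : ∀ᵐ p : Cyl n, AEStronglyMeasurable (fun s => F (p.1, s)) (volume.restrict (Ioi 0)) :=
    ae_of_ae_fst hF.prodMk_left
  filter_upwards [ae_restrict_of_ae h1, ae_restrict_mem measurableSet_upperHalf] with p hp hp'
  exact enorm_vprim_sq_le hp' hp

theorem lintegral_upperHalf_eq (hF : AEStronglyMeasurable F (volume.restrict (upperHalf n))) :
    ∫⁻ p in upperHalf n, ‖F p‖ₑ ^ 2 = ∫⁻ x, ∫⁻ s in Ioi (0 : ℝ), ‖F (x, s)‖ₑ ^ 2 := by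
  rw [restrict_upperHalf] at hF ⊢
  exact lintegral_prod _ (hF.enorm.pow_const 2)

theorem aemeasurable_lintegral_slice
    (hF : AEStronglyMeasurable F (volume.restrict (upperHalf n))) :
    AEMeasurable (fun x : Torus n => ∫⁻ s in Ioi (0 : ℝ), ‖F (x, s)‖ₑ ^ 2) := by
  rw [restrict_upperHalf] at hF
  exact (hF.enorm.pow_const 2).lintegral_prod_right'

theorem aestronglyMeasurable_vprim_upperHalf
    (hF : AEStronglyMeasurable F (volume.restrict (upperHalf n))) :
    AEStronglyMeasurable (vprim F 0) (volume.restrict (upperHalf n)) := by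
  have h1 := (aestronglyMeasurable_vprim
    ((aestronglyMeasurable_indicator_iff measurableSet_upperHalf).2 hF) 0).restrict
    (s := upperHalf n)
  refine h1.congr ?_
  filter_upwards [ae_restrict_mem measurableSet_upperHalf] with p hp
  have hp' : 0 < p.2 := hp
  rw [vprim, vprim, intervalIntegral.integral_of_le hp'.le, intervalIntegral.integral_of_le hp'.le]
  refine setIntegral_congr_fun measurableSet_Ioc fun s hs => ?_
  exact indicator_of_mem (show (p.1, s) ∈ upperHalf n from hs.1) F

/-- Weighted `L²` bound for primitives, for a weight depending on `y` only. -/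
theorem lintegral_vprim_sq_mul_le
    (hF : AEStronglyMeasurable F (volume.restrict (upperHalf n))) {κ : ℝ → ℝ≥0∞}
    (hκ : Measurable κ) :
    ∫⁻ p in upperHalf n, ‖vprim F 0 p‖ₑ ^ 2 * κ p.2 ≤
      (∫⁻ y in Ioi (0 : ℝ), ENNReal.ofReal y * κ y) * ∫⁻ p in upperHalf n, ‖F p‖ₑ ^ 2 := by
  calc ∫⁻ p in upperHalf n, ‖vprim F 0 p‖ₑ ^ 2 * κ p.2
      ≤ ∫⁻ p in upperHalf n, (∫⁻ s in Ioi (0 : ℝ), ‖F (p.1, s)‖ₑ ^ 2) *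
          (ENNReal.ofReal p.2 * κ p.2) := by
        refine lintegral_mono_ae ?_
        filter_upwards [ae_enorm_vprim_sq_le hF] with p hp
        calc _ ≤ (ENNReal.ofReal p.2 * ∫⁻ s in Ioi (0 : ℝ), ‖F (p.1, s)‖ₑ ^ 2) * κ p.2 := by
              gcongr
          _ = _ := by ring
    _ = _ := by
        rw [lintegral_upperHalf_eq hF, restrict_upperHalf,
          lintegral_prod_mul (g := fun y => ENNReal.ofReal y * κ y) (aemeasurable_lintegral_slice hF)
            (ENNReal.measurable_ofReal.mul hκ).aemeasurable, mul_comm]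

theorem lintegral_strip_vprim_sq_le
    (hF : AEStronglyMeasurable F (volume.restrict (upperHalf n))) {h : ℝ} :
    ∫⁻ p in strip n h, ‖vprim F 0 p‖ₑ ^ 2 ≤
      ENNReal.ofReal h ^ 2 * ∫⁻ p in upperHalf n, ‖F p‖ₑ ^ 2 := by
  have h1 := lintegral_vprim_sq_mul_le hF (κ := (Ioo 0 h).indicator 1)
    (measurable_one.indicator measurableSet_Ioo)
  have e1 : ∀ p : Cyl n, ‖vprim F 0 p‖ₑ ^ 2 * (Ioo 0 h).indicator 1 p.2 =
      (strip n h).indicator (fun p => ‖vprim F 0 p‖ₑ ^ 2) p := by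
    intro p
    by_cases hp : p ∈ strip n h
    · have : p.2 ∈ Ioo 0 h := mem_strip.1 hp
      simp [hp, this]
    · have : p.2 ∉ Ioo 0 h := fun h => hp (mem_strip.2 h)
      simp [hp, this]
  simp only [e1] at h1
  rw [lintegral_indicator (measurableSet_strip h), Measure.restrict_restrict (measurableSet_strip h),
    inter_eq_self_of_subset_left (strip_subset_upperHalf h)] at h1
  refine h1.trans ?_
  gcongr
  calc ∫⁻ y in Ioi (0 : ℝ), ENNReal.ofReal y * (Ioo 0 h).indicator 1 y
      ≤ ∫⁻ y in Ioi (0 : ℝ), (Ioo 0 h).indicator (fun _ => ENNReal.ofReal h) y := by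
        refine lintegral_mono fun y => ?_
        by_cases hy : y ∈ Ioo 0 h
        · simp only [indicator_of_mem hy, Pi.one_apply, mul_one]
          exact ENNReal.ofReal_le_ofReal hy.2.le
        · simp [hy]
    _ ≤ ∫⁻ y, (Ioo 0 h).indicator (fun _ => ENNReal.ofReal h) y :=
        lintegral_mono' Measure.restrict_le_self le_rfl
    _ = ENNReal.ofReal h ^ 2 := by
        rw [lintegral_indicator measurableSet_Ioo]
        simp [sq]

theorem eLpNorm_strip_vprim_le
    (hF : AEStronglyMeasurable F (volume.restrict (upperHalf n))) {h : ℝ} :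
    eLpNorm (vprim F 0) 2 (volume.restrict (strip n h)) ≤
      ENNReal.ofReal h * eLpNorm F 2 (volume.restrict (upperHalf n)) := by
  rw [eLpNorm_two_le_iff, mul_pow, eLpNorm_two_sq]
  exact lintegral_strip_vprim_sq_le hF

theorem eLpNorm_strip_fst {ρ : Torus n → ℝ} (hρ : AEStronglyMeasurable ρ volume) {h : ℝ} :
    eLpNorm (fun p : Cyl n => ρ p.1) 2 (volume.restrict (strip n h)) =
      ENNReal.ofReal h ^ (1 / 2 : ℝ) * eLpNorm ρ 2 volume := by
  have h1 : eLpNorm (fun p : Cyl n => ρ p.1) 2 (volume.restrict (strip n h)) ^ 2 =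
      (ENNReal.ofReal h ^ (1 / 2 : ℝ) * eLpNorm ρ 2 volume) ^ 2 := by
    rw [eLpNorm_two_sq, mul_pow, eLpNorm_two_sq, strip, restrict_univ_prod]
    have := lintegral_prod_mul (μ := (volume : Measure (Torus n))) (ν := volume.restrict (Ioo 0 h))
      (f := fun x => ‖ρ x‖ₑ ^ 2) (g := fun _ => 1) (hρ.enorm.pow_const 2) aemeasurable_const
    simp only [mul_one] at this
    rw [this, ← ENNReal.rpow_natCast, ← ENNReal.rpow_mul]
    simp [mul_comm]
  exact (ENNReal.pow_right_strictMono (by norm_num : (2 : ℕ) ≠ 0)).injective h1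

/-- Every torus element is reached by nonnegative coordinates of total length at most `n`, so all
horizontal translates obey one uniform bound. -/
theorem exists_cover_eq (b : Torus n) :
    ∃ w : Fin (n + 1) → ℝ, (∀ i, 0 ≤ w i) ∧ ∑ i, w i ≤ n ∧ cylCover n w = (b, 0) := by
  have h : ∀ i : Fin n, ∃ t : ℝ, 0 ≤ t ∧ t ≤ 1 ∧ (t : UnitAddCircle) = b i := by
    intro i
    have hmem := (AddCircle.equivIco (1 : ℝ) 0 (b i)).2
    refine ⟨AddCircle.equivIco (1 : ℝ) 0 (b i), hmem.1, ?_, AddCircle.coe_equivIco⟩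
    have := hmem.2
    simp only [zero_add] at this
    exact this.le
  choose t t0 t1 ht using h
  refine ⟨Fin.snoc t 0, fun i => ?_, ?_, ?_⟩
  · refine Fin.lastCases ?_ (fun k => ?_) i
    · simp
    · simpa using t0 k
  · rw [Fin.sum_univ_castSucc]
    simp only [Fin.snoc_castSucc, Fin.snoc_last, add_zero]
    calc ∑ i, t i ≤ ∑ _i : Fin n, (1 : ℝ) := Finset.sum_le_sum fun i _ => t1 i
      _ = n := by simp
  · ext i
    · simp [cylCover, ht]
    · simp [cylCover]

/-- Poincaré inequality for the trace on `{y = 0}`. -/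
theorem exists_trace_sub_const_le {v : Cyl n → ℝ} {G : Cyl n → EuclideanSpace ℝ (Fin (n + 1))}
    (hv : IsH1LocGrad (cylCover n) (upperHalf n) v G) {σ : Torus n → ℝ} (hσ : StronglyMeasurable σ)
    (h : ∀ᵐ p ∂volume.restrict (upperHalf n),
      v p = σ p.1 + vprim (fun q => G q (Fin.last n)) 0 p) :
    ∃ c : ℝ, eLpNorm (fun x => σ x - c) 2 volume ≤
      (n + 2) * eLpNorm G 2 (volume.restrict (upperHalf n)) := by
  set A := eLpNorm G 2 (volume.restrict (upperHalf n))
  have hGm := hv.aestronglyMeasurable_grad isOpen_upperHalf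
  have hFm : AEStronglyMeasurable (fun q => G q (Fin.last n)) (volume.restrict (upperHalf n)) :=
    (EuclideanSpace.proj (Fin.last n) : EuclideanSpace ℝ (Fin (n + 1)) →L[ℝ] ℝ).continuous.comp_aestronglyMeasurable hGm
  have hFA : eLpNorm (fun q => G q (Fin.last n)) 2 (volume.restrict (upperHalf n)) ≤ A :=
    eLpNorm_mono fun p => PiLp.norm_apply_le (G p) _
  set P := vprim (fun q => G q (Fin.last n)) 0
  have hPm : AEStronglyMeasurable P (volume.restrict (upperHalf n)) :=
    aestronglyMeasurable_vprim_upperHalf hFm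
  have hP : eLpNorm P 2 (volume.restrict (strip n 1)) ≤ A := by
    refine (eLpNorm_strip_vprim_le hFm (h := 1)).trans ?_
    simpa using hFA
  have hle : (volume : Measure (Cyl n)).restrict (strip n 1) ≤ volume.restrict (upperHalf n) :=
    Measure.restrict_mono (strip_subset_upperHalf 1) le_rfl
  have hvm := hv.aestronglyMeasurable_fun isOpen_upperHalf
  -- On the unit strip, `σ(x + b) - σ(x)` is the horizontal increment of `v`, costing `n A`, plus
  -- two copies of the vertical primitive, costing `A` each.
  have key : ∀ b : Torus n, eLpNorm (fun x => σ (x + b) - σ x) 2 volume ≤ (n + 2) * A := by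
    intro b
    obtain ⟨w, w0, wn, hw⟩ := exists_cover_eq b
    have h1 := hv.eLpNorm_translate_le w0
    rw [hw] at h1
    have h2 : eLpNorm (fun p : Cyl n => v (p + (b, 0)) - v p) 2 (volume.restrict (strip n 1)) ≤
        n * A := by
      refine (eLpNorm_mono_measure _ hle).trans (h1.trans ?_)
      gcongr
      exact (ENNReal.ofReal_le_ofReal wn).trans (by simp)
    have hb : (0 : ℝ) ≤ ((b, 0) : Cyl n).2 := le_rfl
    have hmp : MeasurePreserving (fun p : Cyl n => p + (b, 0)) (volume.restrict (strip n 1))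
        (volume.restrict (strip n 1)) := by
      have := (measurePreserving_add_const ((b, 0) : Cyl n)).restrict_preimage
        (measurableSet_strip 1)
      have e : (fun p : Cyl n => p + (b, 0)) ⁻¹' strip n 1 = strip n 1 := by
        ext p; simp [mem_strip]
      rwa [e] at this
    have h' := ae_mono hle h
    have h'' := hmp.quasiMeasurePreserving.ae h'
    have e1 : (fun p : Cyl n => σ (p.1 + b) - σ p.1) =ᵐ[volume.restrict (strip n 1)]
        (fun p : Cyl n => v (p + (b, 0)) - v p) + (P - fun p : Cyl n => P (p + (b, 0))) := by
      filter_upwards [h', h''] with p h1 h2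
      simp only [Pi.add_apply, Pi.sub_apply, h1, h2, Prod.fst_add]
      ring
    have m1 : AEStronglyMeasurable P (volume.restrict (strip n 1)) := hPm.mono_measure hle
    have m2 : AEStronglyMeasurable (fun p : Cyl n => P (p + (b, 0))) (volume.restrict (strip n 1)) :=
      m1.comp_measurePreserving hmp
    have m3 : AEStronglyMeasurable v (volume.restrict (strip n 1)) := hvm.mono_measure hle
    have e2 := eLpNorm_strip_fst (ρ := fun x => σ (x + b) - σ x) (h := 1)
      ((hσ.comp_measurable (measurable_add_const b)).sub hσ).aestronglyMeasurable
    simp only [ENNReal.ofReal_one, ENNReal.one_rpow, one_mul] at e2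
    rw [← e2, eLpNorm_congr_ae e1]
    refine (eLpNorm_add_le ((m3.comp_measurePreserving hmp).sub m3) (m1.sub m2)
      (by norm_num)).trans ?_
    have h3 : eLpNorm (P - fun p : Cyl n => P (p + (b, 0))) 2 (volume.restrict (strip n 1)) ≤
        A + A := by
      refine (eLpNorm_sub_le m1 m2 (by norm_num)).trans (add_le_add hP ?_)
      exact (eLpNorm_comp_measurePreserving m1 hmp).le.trans hP
    calc _ ≤ n * A + (A + A) := add_le_add h2 h3
      _ = (n + 2) * A := by ring
  have hmeas : Measurable (Function.uncurry fun (x b : Torus n) => ‖σ b - σ x‖ₑ ^ 2) :=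
    ((hσ.measurable.comp measurable_snd).sub (hσ.measurable.comp measurable_fst)).enorm.pow_const 2
  have hmeas' : Measurable (Function.uncurry fun (b x : Torus n) => ‖σ (x + b) - σ x‖ₑ ^ 2) :=
    ((hσ.measurable.comp (measurable_snd.add measurable_fst)).sub
      (hσ.measurable.comp measurable_snd)).enorm.pow_const 2
  -- Averaging the translation bound over all `b` replaces `x + b` by an independent point.
  have h5 : ∫⁻ x, ∫⁻ b, ‖σ b - σ x‖ₑ ^ 2 ≤ ((n + 2) * A) ^ 2 := by
    calc ∫⁻ x, ∫⁻ b, ‖σ b - σ x‖ₑ ^ 2 = ∫⁻ x, ∫⁻ b, ‖σ (x + b) - σ x‖ₑ ^ 2 := by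
          congr 1; ext x
          exact (lintegral_add_left_eq_self (fun b => ‖σ b - σ x‖ₑ ^ 2) x).symm
      _ = ∫⁻ b, ∫⁻ x, ‖σ (x + b) - σ x‖ₑ ^ 2 :=
          (lintegral_lintegral_swap hmeas'.aemeasurable).symm
      _ ≤ ∫⁻ _b : Torus n, ((n + 2) * A) ^ 2 :=
          lintegral_mono fun b => eLpNorm_two_le_iff.1 (key b)
      _ = _ := by simp
  -- The constant is a value `σ x₀` at a point no worse than average; a mean value would require `σ`
  -- to be integrable.
  obtain ⟨x₀, hx₀⟩ := exists_le_lintegral (μ := (volume : Measure (Torus n)))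
    (f := fun x => ∫⁻ b, ‖σ b - σ x‖ₑ ^ 2) hmeas.lintegral_prod_right.aemeasurable
  exact ⟨σ x₀, eLpNorm_two_le_iff.2 (hx₀.trans h5)⟩

end HalfCylinder

/-! ### The transformation strain -/

section Strain

variable {g : Torus n → ℝ} {M ε : ℝ}

theorem strainLast_eq (g : Torus n → ℝ) (p : Cyl n) : strainLast g p =
    (Ioc 0 (g p.1)).indicator 1 p.2 - (Ioc (g p.1) 0).indicator 1 p.2 := by
  unfold strainLast
  simp only [indicator_apply, mem_Ioc, Pi.one_apply]
  split_ifs <;> grind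

/-- The signed height of the interface: the sign convention of the strain makes this hold for both
signs of `g`. Applied to `ε g` and divided by `ε`, it is the source of the jump `g`. -/
theorem integral_strainLast {L : ℝ} {x : Torus n} (hx : |g x| ≤ L) :
    ∫ s in (-L)..L, strainLast g (x, s) = g x := by
  have hL : 0 ≤ L := (abs_nonneg _).trans hx
  have hx' := abs_le.1 hx
  have hi : ∀ a b : ℝ, IntervalIntegrable ((Ioc a b).indicator (1 : ℝ → ℝ)) volume (-L) L := by
    intro a b
    refine Integrable.intervalIntegrable ?_
    rw [integrable_indicator_iff measurableSet_Ioc]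
    exact integrableOn_const (by simp) (by simp)
  have hv : ∀ a b : ℝ, -L ≤ a → b ≤ L →
      ∫ s in (-L)..L, (Ioc a b).indicator (1 : ℝ → ℝ) s = max (b - a) 0 := by
    intro a b ha hb
    rw [intervalIntegral.integral_of_le (by linarith), setIntegral_indicator measurableSet_Ioc,
      inter_eq_self_of_subset_right (Ioc_subset_Ioc ha hb)]
    simp [Measure.real, ENNReal.toReal_ofReal']
  simp only [strainLast_eq]
  rw [intervalIntegral.integral_sub (hi _ _) (hi _ _), hv _ _ (by linarith) hx'.2,
    hv _ _ hx'.1 hL]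
  rcases le_total 0 (g x) with h | h
  · rw [max_eq_left (by linarith), max_eq_right (by linarith)]; ring
  · rw [max_eq_right (by linarith), max_eq_left (by linarith)]; ring

theorem intervalIntegrable_strainLast (g : Torus n → ℝ) (x : Torus n) (a b : ℝ) :
    IntervalIntegrable (fun s => strainLast g (x, s)) volume a b := by
  simp only [strainLast_eq]
  refine (Integrable.sub ?_ ?_).intervalIntegrable <;>
  · rw [integrable_indicator_iff measurableSet_Ioc]
    exact integrableOn_const (by simp) (by simp)

theorem strainLast_eq_zero {p : Cyl n} (h : |g p.1| < |p.2|) : strainLast g p = 0 := by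
  rw [strainLast_eq]
  have h1 : p.2 ∉ Ioc 0 (g p.1) := fun h2 => by
    rw [abs_of_pos h2.1] at h
    linarith [le_abs_self (g p.1), h2.2]
  have h2 : p.2 ∉ Ioc (g p.1) 0 := fun h2 => by
    rw [abs_of_nonpos h2.2] at h
    linarith [neg_abs_le (g p.1), h2.1]
  simp [h1, h2]

theorem measurable_strainLast (hg : Measurable g) : Measurable (strainLast g) := by
  unfold strainLast
  refine Measurable.ite (measurableSet_le (by fun_prop) (by fun_prop)) ?_ ?_ <;>
  · refine Measurable.ite (measurableSet_le (by fun_prop) (by fun_prop)) ?_ ?_ <;> fun_prop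

theorem aestronglyMeasurable_strain (hg : AEStronglyMeasurable g volume) :
    AEStronglyMeasurable (strain g) volume := by
  have h1 : AEStronglyMeasurable (strainLast g) volume := by
    refine ⟨strainLast (hg.mk g), (measurable_strainLast
      hg.stronglyMeasurable_mk.measurable).stronglyMeasurable, ?_⟩
    filter_upwards [ae_of_ae_fst hg.ae_eq_mk] with p hp
    rw [strainLast_eq, strainLast_eq, hp]
  have h2 : Continuous fun t : ℝ => EuclideanSpace.single (Fin.last n) t :=
    LipschitzWith.continuous (K := 1) (LipschitzWith.of_dist_le_mul fun s t => by simp)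
  exact h2.comp_aestronglyMeasurable h1

end Strain

/-! ### Estimates for one function of finite energy -/

section SingleEnergy

/-- The gradient of `shiftUp δ u`. -/
def gradUp (δ : ℝ) (G : Cyl n → EuclideanSpace ℝ (Fin (n + 1))) :
    Cyl n → EuclideanSpace ℝ (Fin (n + 1)) := fun p => G (p.1, p.2 + δ)

/-- The gradient of `shiftDown δ u`. -/
def gradDown (δ : ℝ) (G : Cyl n → EuclideanSpace ℝ (Fin (n + 1))) :
    Cyl n → EuclideanSpace ℝ (Fin (n + 1)) := fun p => scaleLast (-1) (G (p.1, -p.2 - δ))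

/-- Twice the energy, for a given gradient. -/
def strainDefect (g : Torus n → ℝ) (ε : ℝ) (G : Cyl n → EuclideanSpace ℝ (Fin (n + 1))) : ℝ≥0∞ :=
  ∫⁻ p, ‖G p - ε⁻¹ • strain (fun x => ε * g x) p‖ₑ ^ 2

variable {g : Torus n → ℝ} {M ε : ℝ} {u : Cyl n → ℝ} {G : Cyl n → EuclideanSpace ℝ (Fin (n + 1))}

theorem ae_strain_eq_zero (hM : ∀ᵐ x, |g x| ≤ M) (hε : 0 < ε) :
    ∀ᵐ x : Torus n, ∀ y, M * ε < |y| → strain (fun x => ε * g x) (x, y) = 0 := by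
  filter_upwards [hM] with x hx y hy
  rw [strain, strainLast_eq_zero]
  · simp
  · refine lt_of_le_of_lt ?_ hy
    rw [abs_mul, abs_of_pos hε, mul_comm]
    exact mul_le_mul_of_nonneg_right hx hε.le

/-- The shifted half cylinders come from the disjoint regions `y > M ε` and `y < -M ε`, where the
strain is zero. The two terms are bounded as a sum, without a factor `2`, because the liminf
inequality needs the sharp constant. -/
theorem lintegral_gradUp_add_gradDown_le (hM : ∀ᵐ x, |g x| ≤ M) (hM0 : 0 ≤ M) (hε : 0 < ε) :
    (∫⁻ p in upperHalf n, ‖gradUp (M * ε) G p‖ₑ ^ 2) +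
      ∫⁻ p in upperHalf n, ‖gradDown (M * ε) G p‖ₑ ^ 2 ≤ strainDefect g ε G := by
  set L := M * ε
  have hL : 0 ≤ L := mul_nonneg hM0 hε.le
  set f : Cyl n → ℝ≥0∞ := fun p => ‖G p - ε⁻¹ • strain (fun x => ε * g x) p‖ₑ ^ 2
  have hz := ae_of_ae_fst (ae_strain_eq_zero hM hε)
  have h1 : ∫⁻ p in upperHalf n, ‖gradUp L G p‖ₑ ^ 2 = ∫⁻ p in {p : Cyl n | L < p.2}, f p := by
    have hmp := measurePreserving_yAff (n := n) (σ := 1) (by norm_num) L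
    have hc := hmp.setLIntegral_comp_preimage_emb
      (yAffHomeo (n := n) (σ := 1) (by norm_num) L).measurableEmbedding f {p : Cyl n | L < p.2}
    have e : yAff 1 L ⁻¹' {p : Cyl n | L < p.2} = upperHalf n := by
      ext p; simp [yAff, upperHalf]
    rw [← hc, e]
    refine lintegral_congr_ae ?_
    filter_upwards [ae_restrict_of_ae hz, ae_restrict_mem measurableSet_upperHalf] with p hp hp'
    have hp' : 0 < p.2 := hp'
    have : yAff 1 L p = (p.1, p.2 + L) := by simp [yAff]
    simp only [f, this, gradUp]
    rw [hp (p.2 + L) (by rw [abs_of_pos (by linarith)]; linarith), smul_zero, sub_zero]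
  have h2 : ∫⁻ p in upperHalf n, ‖gradDown L G p‖ₑ ^ 2 =
      ∫⁻ p in {p : Cyl n | p.2 < -L}, f p := by
    have hmp := measurePreserving_yAff (n := n) (σ := -1) (by norm_num) (-L)
    have hc := hmp.setLIntegral_comp_preimage_emb
      (yAffHomeo (n := n) (σ := -1) (by norm_num) (-L)).measurableEmbedding f {p : Cyl n | p.2 < -L}
    have e : yAff (-1) (-L) ⁻¹' {p : Cyl n | p.2 < -L} = upperHalf n := by
      ext p; simp [yAff, upperHalf]
    rw [← hc, e]
    refine lintegral_congr_ae ?_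
    filter_upwards [ae_restrict_of_ae hz, ae_restrict_mem measurableSet_upperHalf] with p hp hp'
    have hp' : 0 < p.2 := hp'
    have : yAff (-1) (-L) p = (p.1, -p.2 - L) := by simp [yAff, sub_eq_add_neg]
    simp only [f, this, gradDown]
    rw [hp (-p.2 - L) (by rw [abs_of_neg (by linarith)]; linarith), smul_zero, sub_zero]
    rw [enorm_eq_iff_norm_eq.2 (norm_scaleLast (by norm_num) _)]
  rw [h1, h2, ← lintegral_union (measurableSet_lt measurable_snd measurable_const)]
  · exact setLIntegral_le_lintegral _ _
  · refine Set.disjoint_left.2 fun p (hp : L < p.2) (hp' : p.2 < -L) => ?_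
    linarith

/-- Here `σ` is the trace of `u` at the top of the layer. The trace at the bottom is `σ` minus the
increment across the layer, and that increment is `g + r`, with `r` the vertical integral of the
last component of the defect. Cauchy–Schwarz over the thickness `2 M ε` makes `r` small. -/
theorem exists_trace_repr (hg : AEStronglyMeasurable g volume) (hM : ∀ᵐ x, |g x| ≤ M)
    (hM0 : 0 ≤ M) (hε : 0 < ε) (hu : IsH1LocGrad (cylCover n) univ u G) :
    ∃ σ r : Torus n → ℝ, StronglyMeasurable σ ∧ AEStronglyMeasurable r volume ∧
      ∫⁻ x, ‖r x‖ₑ ^ 2 ≤ ENNReal.ofReal (2 * (M * ε)) * strainDefect g ε G ∧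
      (∀ᵐ p : Cyl n, shiftUp (M * ε) u p =
        σ p.1 + vprim (fun q => gradUp (M * ε) G q (Fin.last n)) 0 p) ∧
      (∀ᵐ p : Cyl n, shiftDown (M * ε) u p =
        σ p.1 - g p.1 - r p.1 + vprim (fun q => gradDown (M * ε) G q (Fin.last n)) 0 p) := by
  set L := M * ε
  have hL : 0 ≤ L := mul_nonneg hM0 hε.le
  set F : Cyl n → ℝ := fun q => G q (Fin.last n)
  -- The primitive of `F` below is based at height `L`, so that `σ` belongs to the top of the layer.
  have hF : ∀ K, IsCompact K → IntegrableOn F K := fun K hK =>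
    hu.integrableOn_grad (Fin.last n) K hK (subset_univ _)
  have hGm : AEStronglyMeasurable G volume := by
    simpa using hu.aestronglyMeasurable_grad isOpen_univ
  obtain ⟨σ, hσm, -, hσ⟩ := exists_eq_add_vprim (F := F) (I := univ) isOpen_univ ordConnected_univ
    zero_lt_one (subset_univ _) (fun K hK _ => hu.integrableOn_fun K hK (subset_univ _)) hF
    (hu.isWeakPDeriv (Fin.last n)) L
  simp only [mem_univ] at hσ
  rw [show {p : Cyl n | True} = univ from rfl, Measure.restrict_univ] at hσ
  set D : Cyl n → EuclideanSpace ℝ (Fin (n + 1)) :=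
    fun p => G p - ε⁻¹ • strain (fun x => ε * g x) p
  have hDm : AEStronglyMeasurable D volume :=
    hGm.sub ((aestronglyMeasurable_strain (hg.const_mul ε)).const_smul ε⁻¹)
  set d : Cyl n → ℝ := fun p => D p (Fin.last n)
  have hdm : AEStronglyMeasurable d volume :=
    (EuclideanSpace.proj (Fin.last n) : EuclideanSpace ℝ (Fin (n + 1)) →L[ℝ] ℝ).continuous.comp_aestronglyMeasurable hDm
  have hdm' : AEStronglyMeasurable d
      ((volume : Measure (Torus n)).prod (volume.restrict (Ioc (-L) L))) := by
    rw [← restrict_univ_prod]; exact hdm.restrict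
  have hd : ∀ p, d p = F p - ε⁻¹ * strainLast (fun x => ε * g x) p := by
    intro p; simp [d, D, F, strain]
  set r : Torus n → ℝ := fun x => ∫ s in Ioc (-L) L, d (x, s)
  have hslice := ae_intervalIntegrable hF
  have hr : ∀ᵐ x : Torus n, ∫ s in (-L)..L, F (x, s) = g x + r x := by
    filter_upwards [hslice, hM] with x hx hxM
    have e1 : r x = ∫ s in (-L)..L, d (x, s) :=
      (intervalIntegral.integral_of_le (by linarith)).symm
    rw [e1]
    simp only [hd]
    rw [intervalIntegral.integral_sub (hx _ _)
      ((intervalIntegrable_strainLast _ x _ _).const_mul _), intervalIntegral.integral_const_mul,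
      integral_strainLast]
    · field_simp; ring
    · rw [abs_mul, abs_of_pos hε, mul_comm]
      exact mul_le_mul_of_nonneg_right hxM hε.le
  refine ⟨σ, r, hσm, hdm'.integral_prod_right', ?_, ?_, ?_⟩
  · calc ∫⁻ x, ‖r x‖ₑ ^ 2
        ≤ ∫⁻ x, ENNReal.ofReal (2 * L) * ∫⁻ s in Ioc (-L) L, ‖d (x, s)‖ₑ ^ 2 := by
          refine lintegral_mono_ae ?_
          filter_upwards [hdm'.prodMk_left] with x hx
          calc ‖r x‖ₑ ^ 2 ≤ (∫⁻ s in Ioc (-L) L, ‖d (x, s)‖ₑ) ^ 2 := by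
                gcongr; exact enorm_integral_le_lintegral_enorm _
            _ ≤ _ := by
                refine (lintegral_enorm_sq_le hx).trans_eq ?_
                simp only [Measure.restrict_apply MeasurableSet.univ, univ_inter, Real.volume_Ioc]
                ring_nf
      _ = ENNReal.ofReal (2 * L) * ∫⁻ p in univ ×ˢ Ioc (-L) L, ‖d p‖ₑ ^ 2 := by
          rw [lintegral_const_mul' _ _ ENNReal.ofReal_ne_top, restrict_univ_prod,
            lintegral_prod _ (hdm'.enorm.pow_const 2)]
      _ ≤ _ := by
          gcongr
          refine (setLIntegral_le_lintegral _ _).trans (lintegral_mono fun p => ?_)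
          gcongr
          exact enorm_le_iff_norm_le.2 (PiLp.norm_apply_le (D p) _)
  · have h1 := (measurePreserving_yAff (n := n) (σ := 1) (by norm_num) L).quasiMeasurePreserving.ae hσ
    filter_upwards [h1] with p hp
    have : yAff 1 L p = (p.1, p.2 + L) := by simp [yAff]
    rw [this] at hp
    rw [shiftUp, hp]
    simp only [vprim, gradUp, F]
    have := intervalIntegral.integral_comp_add_right (a := 0) (b := p.2)
      (fun s => G (p.1, s) (Fin.last n)) L
    rw [zero_add] at this
    rw [this]
  · have h1 := (measurePreserving_yAff (n := n) (σ := -1) (by norm_num)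
      (-L)).quasiMeasurePreserving.ae hσ
    filter_upwards [h1, ae_of_ae_fst hr, ae_of_ae_fst hslice] with p hp hpr hps
    have : yAff (-1) (-L) p = (p.1, -p.2 - L) := by simp [yAff, sub_eq_add_neg]
    rw [this] at hp
    rw [shiftDown, hp]
    -- The path from height `L` down to `-y - L` is split at `-L`: crossing the layer gives `-(g +
    -- r)`, and the remainder is the primitive of the reflected gradient.
    have e1 : vprim F L (p.1, -p.2 - L) =
        -(∫ s in (-L)..L, F (p.1, s)) + ∫ s in (-L)..(-p.2 - L), F (p.1, s) := by
      rw [vprim, ← intervalIntegral.integral_symm,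
        intervalIntegral.integral_add_adjacent_intervals (hps _ _) (hps _ _)]
    have e2 : vprim (fun q => gradDown L G q (Fin.last n)) 0 p =
        ∫ s in (-L)..(-p.2 - L), F (p.1, s) := by
      have e3 : ∀ s, gradDown L G (p.1, s) (Fin.last n) = -F (p.1, -L - s) := by
        intro s
        simp only [gradDown, scaleLast_apply, F]
        rw [if_pos trivial, show -s - L = -L - s by ring]; ring
      simp only [vprim, e3]
      rw [intervalIntegral.integral_neg, intervalIntegral.integral_comp_sub_left
        (fun s => F (p.1, s)) (-L), ← intervalIntegral.integral_symm, sub_zero]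
      congr 1; ring
    rw [e1, e2, hpr]; ring

end SingleEnergy

/-! ### Weak sequential compactness in `L²` -/

section WeakCompactness

/-- Sequential Banach–Alaoglu in the dual of a separable space, transported by the Riesz
isomorphism. -/
theorem exists_weakly_convergent_subseq {H : Type*} [NormedAddCommGroup H] [InnerProductSpace ℝ H]
    [CompleteSpace H] [TopologicalSpace.SeparableSpace H] {x : ℕ → H} {C : ℝ}
    (hx : ∀ j, ‖x j‖ ≤ C) :
    ∃ (k : ℕ → ℕ) (a : H), StrictMono k ∧
      ∀ y, Tendsto (fun j => inner ℝ (x (k j)) y) atTop (𝓝 (inner ℝ a y)) := by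
  have hc := WeakDual.isSeqCompact_closedBall ℝ H 0 C
  have hmem : ∀ j, StrongDual.toWeakDual (InnerProductSpace.toDual ℝ H (x j)) ∈
      WeakDual.toStrongDual ⁻¹' Metric.closedBall (0 : StrongDual ℝ H) C := by
    intro j
    rw [mem_preimage, mem_closedBall_zero_iff]
    exact ((InnerProductSpace.toDual ℝ H).norm_map (x j)).le.trans (hx j)
  obtain ⟨a, -, k, hk, hlim⟩ := hc hmem
  refine ⟨k, (InnerProductSpace.toDual ℝ H).symm (WeakDual.toStrongDual a), hk, fun y => ?_⟩
  have := (WeakDual.eval_continuous (𝕜 := ℝ) (E := H) y).continuousAt.tendsto.comp hlim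
  rw [InnerProductSpace.toDual_symm_apply]
  exact this

instance fact_two_ne_top : Fact ((2 : ℝ≥0∞) ≠ ⊤) := ⟨by simp⟩

theorem exists_weakly_convergent_subseq_memLp {α E : Type*} [MeasurableSpace α]
    [NormedAddCommGroup E] [InnerProductSpace ℝ E] [CompleteSpace E] {μ : Measure α}
    [TopologicalSpace.SeparableSpace (Lp E 2 μ)]
    {f : ℕ → α → E} (hf : ∀ j, AEStronglyMeasurable (f j) μ) {C : ℝ≥0∞} (hC : C ≠ ⊤)
    (hfC : ∀ j, eLpNorm (f j) 2 μ ≤ C) :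
    ∃ (k : ℕ → ℕ) (a : α → E), StrictMono k ∧ MemLp a 2 μ ∧
      ∀ ψ, MemLp ψ 2 μ →
        Tendsto (fun j => ∫ x, inner ℝ (f (k j) x) (ψ x) ∂μ) atTop
          (𝓝 (∫ x, inner ℝ (a x) (ψ x) ∂μ)) := by
  have hm : ∀ j, MemLp (f j) 2 μ := fun j => ⟨hf j, (hfC j).trans_lt hC.lt_top⟩
  obtain ⟨k, a, hk, h⟩ := exists_weakly_convergent_subseq (x := fun j => (hm j).toLp (f j))
    (C := C.toReal) fun j => by
      rw [Lp.norm_toLp]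
      exact ENNReal.toReal_mono hC (hfC j)
  refine ⟨k, a, hk, Lp.memLp a, fun ψ hψ => ?_⟩
  have h1 := h (hψ.toLp ψ)
  simp only [L2.inner_def] at h1
  have e1 : ∀ j, ∫ x, inner ℝ ((hm (k j)).toLp (f (k j)) x) (hψ.toLp ψ x) ∂μ =
      ∫ x, inner ℝ (f (k j) x) (ψ x) ∂μ := fun j => by
    refine integral_congr_ae ?_
    filter_upwards [(hm (k j)).coeFn_toLp, hψ.coeFn_toLp] with x h1 h2
    rw [h1, h2]
  have e2 : ∫ x, inner ℝ (a x) (hψ.toLp ψ x) ∂μ = ∫ x, inner ℝ (a x) (ψ x) ∂μ := by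
    refine integral_congr_ae ?_
    filter_upwards [hψ.coeFn_toLp] with x h2
    rw [h2]
  simpa only [e1, e2] using h1

instance separableSpace_Lp_upperHalf (E : Type*) [NormedAddCommGroup E]
    [TopologicalSpace.SeparableSpace E] :
    TopologicalSpace.SeparableSpace
      (Lp E 2 ((volume : Measure (Cyl n)).restrict (upperHalf n))) := by
  have : SecondCountableTopology (Lp E 2 ((volume : Measure (Cyl n)).restrict (upperHalf n))) :=
    Lp.SecondCountableTopology
  infer_instance

end WeakCompactness

/-! ### Rellich compactness on the half cylinder -/

section Rellich

/-- A small open set of translations. -/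
def smallBox (n : ℕ) (δ : ℝ) : Set (Cyl n) := cylCover n '' pi univ fun _ => Ioo 0 δ

theorem isOpen_smallBox (δ : ℝ) : IsOpen (smallBox n δ) :=
  isOpenQuotientMap_cylCover.isOpenMap _ (isOpen_set_pi finite_univ fun _ _ => isOpen_Ioo)

theorem smallBox_nonempty {δ : ℝ} (hδ : 0 < δ) : (smallBox n δ).Nonempty :=
  ⟨_, fun _ => δ / 2, fun _ _ => ⟨by positivity, by linarith⟩, rfl⟩

theorem smallBox_subset_strip (δ : ℝ) : smallBox n δ ⊆ strip n δ := by
  rintro _ ⟨w, hw, rfl⟩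
  exact mem_strip.2 (hw (Fin.last n) (mem_univ _))

theorem lintegral_le_sqrt_mul_eLpNorm {α E : Type*} [MeasurableSpace α] [NormedAddCommGroup E]
    {μ : Measure α} {f : α → E} (hf : AEStronglyMeasurable f μ) :
    ∫⁻ x, ‖f x‖ₑ ∂μ ≤ μ univ ^ (1 / 2 : ℝ) * eLpNorm f 2 μ := by
  have h := eLpNorm_le_eLpNorm_mul_rpow_measure_univ (p := 1) (q := 2) (by norm_num) hf
  rw [eLpNorm_one_eq_lintegral_enorm, mul_comm] at h
  convert h using 3
  norm_num

theorem lintegral_slab_translate_le {z : Cyl n → ℝ} {Z : Cyl n → EuclideanSpace ℝ (Fin (n + 1))}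
    (hz : IsH1LocGrad (cylCover n) (upperHalf n) z Z) {a R δ : ℝ} (ha : 0 < a) {b : Cyl n}
    (hb : b ∈ smallBox n δ) :
    ∫⁻ p in slab n a R, ‖z (p + b) - z p‖ₑ ≤ ENNReal.ofReal (R - a) ^ (1 / 2 : ℝ) *
      (ENNReal.ofReal ((n + 1) * δ) * eLpNorm Z 2 (volume.restrict (upperHalf n))) := by
  obtain ⟨w, hw, rfl⟩ := hb
  have hb0 : 0 ≤ (cylCover n w).2 := (hw (Fin.last n) (mem_univ _)).1.le
  have hm := hz.aestronglyMeasurable_fun isOpen_upperHalf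
  have hle : (volume : Measure (Cyl n)).restrict (slab n a R) ≤ volume.restrict (upperHalf n) :=
    Measure.restrict_mono (slab_subset_upperHalf ha R) le_rfl
  refine (lintegral_le_sqrt_mul_eLpNorm (((hm.comp_quasiMeasurePreserving
    (quasiMeasurePreserving_add_upperHalf hb0)).sub hm).mono_measure hle)).trans ?_
  rw [Measure.restrict_apply_univ, volume_slab]
  gcongr
  refine (eLpNorm_mono_measure _ hle).trans
    ((hz.eLpNorm_translate_le fun i => (hw i (mem_univ _)).1.le).trans ?_)
  gcongr
  calc ∑ i, w i ≤ ∑ _i : Fin (n + 1), δ := Finset.sum_le_sum fun i _ => (hw i (mem_univ _)).2.le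
    _ = (n + 1) * δ := by simp

/-- Rellich by averaging. The mean of `z j` over translates by a small open box `W` is a pairing
with a fixed `L²` function at each point, so it tends to zero pointwise and, by domination, in `L¹`.
The distance of `z j` from its mean is bounded uniformly in `j` by the size of the box times the
gradient bound. -/
theorem tendsto_lintegral_slab_of_weak {z : ℕ → Cyl n → ℝ}
    {Z : ℕ → Cyl n → EuclideanSpace ℝ (Fin (n + 1))}
    (hz : ∀ j, IsH1LocGrad (cylCover n) (upperHalf n) (z j) (Z j)) {B : ℝ≥0∞} (hB : B ≠ ⊤)
    (hZ : ∀ j, eLpNorm (Z j) 2 (volume.restrict (upperHalf n)) ≤ B)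
    (hbdd : ∀ a R : ℝ, 0 < a → ∃ C : ℝ≥0∞, C ≠ ⊤ ∧ ∀ j, ∫⁻ p in slab n a R, ‖z j p‖ₑ ≤ C)
    (hweak : ∀ a R : ℝ, 0 < a → ∀ ψ : Cyl n → ℝ, MemLp ψ 2 (volume.restrict (slab n a R)) →
      Tendsto (fun j => ∫ p in slab n a R, z j p * ψ p) atTop (𝓝 0))
    {a R : ℝ} (ha : 0 < a) :
    Tendsto (fun j => ∫⁻ p in slab n a R, ‖z j p‖ₑ) atTop (𝓝 0) := by
  rw [ENNReal.tendsto_nhds_zero]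
  intro η hη
  set S := slab n a R
  have hS : MeasurableSet S := measurableSet_slab a R
  have hSv : volume S ≠ ⊤ := (isCompact_slab a R).measure_ne_top
  -- choice of the scale
  have hscale : Tendsto (fun δ : ℝ => ENNReal.ofReal (R - a) ^ (1 / 2 : ℝ) *
      (ENNReal.ofReal ((n + 1) * δ) * B)) (𝓝[>] 0) (𝓝 0) := by
    have h1 : Tendsto (fun δ : ℝ => ENNReal.ofReal ((n + 1) * δ)) (𝓝[>] 0) (𝓝 0) := by
      have : Tendsto (fun δ : ℝ => ENNReal.ofReal ((n + 1) * δ)) (𝓝 0)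
          (𝓝 (ENNReal.ofReal ((n + 1) * 0))) :=
        (ENNReal.continuous_ofReal.comp (continuous_const.mul continuous_id)).tendsto 0
      rw [mul_zero, ENNReal.ofReal_zero] at this
      exact this.mono_left nhdsWithin_le_nhds
    have h2 := ENNReal.Tendsto.mul_const h1 (b := B) (Or.inr hB)
    rw [zero_mul] at h2
    have h3 := ENNReal.Tendsto.const_mul h2 (a := ENNReal.ofReal (R - a) ^ (1 / 2 : ℝ))
      (Or.inr (ENNReal.rpow_ne_top_of_nonneg (by norm_num) ENNReal.ofReal_ne_top))
    rwa [mul_zero] at h3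
  have hη2 : 0 < η / 2 := ENNReal.half_pos hη.ne'
  obtain ⟨δ, hδη, δ0, δ1⟩ : ∃ δ : ℝ, ENNReal.ofReal (R - a) ^ (1 / 2 : ℝ) *
      (ENNReal.ofReal ((n + 1) * δ) * B) ≤ η / 2 ∧ 0 < δ ∧ δ < 1 := by
    obtain ⟨δ, h1, h2⟩ := (((ENNReal.tendsto_nhds_zero.1 hscale) _ hη2).and
      (Ioo_mem_nhdsGT one_pos)).exists
    exact ⟨δ, h1, h2⟩
  set W := smallBox n δ
  have hWm : MeasurableSet W := (isOpen_smallBox δ).measurableSet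
  have hW0 : volume W ≠ 0 := ((isOpen_smallBox δ).measure_pos _ (smallBox_nonempty δ0)).ne'
  have hWt : volume W ≠ ⊤ := ne_top_of_le_ne_top (by rw [volume_strip]; exact ENNReal.ofReal_ne_top)
    (measure_mono (smallBox_subset_strip δ))
  have hWb : ∀ b ∈ W, 0 < b.2 ∧ b.2 < 1 := fun b hb =>
    ⟨(mem_strip.1 (smallBox_subset_strip δ hb)).1,
      (mem_strip.1 (smallBox_subset_strip δ hb)).2.trans δ1⟩
  -- Translations in `W` raise points by less than `1`, so the translates of `S` stay in this slab;
  -- cutting off to it makes the functions globally integrable.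
  set K := slab n a (R + 1)
  have hK : MeasurableSet K := measurableSet_slab a (R + 1)
  have hKU : K ⊆ upperHalf n := slab_subset_upperHalf ha _
  have hSK : ∀ p ∈ S, ∀ b ∈ W, p + b ∈ K := fun p hp b hb => by
    have h1 := mem_slab.1 hp
    have h2 := hWb b hb
    exact mem_slab.2 ⟨by simp only [Prod.snd_add]; linarith, by simp only [Prod.snd_add]; linarith⟩
  set y : ℕ → Cyl n → ℝ := fun j => K.indicator (z j)
  have hy : ∀ j, AEStronglyMeasurable (y j) volume := fun j =>
    (aestronglyMeasurable_indicator_iff hK).2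
      (((hz j).aestronglyMeasurable_fun isOpen_upperHalf).mono_set hKU)
  obtain ⟨C, hC, hzC⟩ := hbdd a (R + 1) ha
  have hyC : ∀ j, ∫⁻ p, ‖y j p‖ₑ ≤ C := fun j => by
    refine le_trans (le_of_eq ?_) (hzC j)
    rw [← lintegral_indicator hK]
    congr 1; ext p
    by_cases hp : p ∈ K <;> simp [y, hp]
  have hyi : ∀ j, Integrable (y j) := fun j => ⟨hy j, (hyC j).trans_lt hC.lt_top⟩
  have hy2 : ∀ j, AEStronglyMeasurable (fun q : Cyl n × Cyl n => y j (q.1 + q.2))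
      ((volume.restrict S).prod (volume.restrict W)) := fun j => by
    rw [Measure.prod_restrict]
    exact ((hy j).comp_fst.comp_measurePreserving
      (measurePreserving_add_prod (volume : Measure (Cyl n)) volume)).restrict
  set A : ℕ → Cyl n → ℝ := fun j p => ∫ b in W, y j (p + b)
  -- the averages converge to zero
  have hAlim : ∀ p, Tendsto (fun j => A j p) atTop (𝓝 0) := by
    intro p
    have hψ : MemLp (fun q => W.indicator (1 : Cyl n → ℝ) (q - p)) 2 (volume.restrict K) := by
      have : IsFiniteMeasure ((volume : Measure (Cyl n)).restrict K) :=
        ⟨by simpa using (isCompact_slab a (R + 1)).measure_lt_top⟩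
      refine MemLp.of_bound (C := 1) ?_ (ae_of_all _ fun q => ?_)
      · exact ((measurable_one.indicator hWm).comp (measurable_sub_const p)).aestronglyMeasurable
      · by_cases hq : q - p ∈ W <;> simp [hq]
    refine (hweak a (R + 1) ha _ hψ).congr fun j => ?_
    rw [← integral_indicator hK]
    simp only [A]
    rw [← integral_indicator hWm, ← integral_add_right_eq_self _ p]
    congr 1; ext b
    rw [add_comm b p]
    by_cases hb : b ∈ W <;> by_cases hk : p + b ∈ K <;> simp [y, indicator, hb, hk]
  have hA0 : Tendsto (fun j => ∫⁻ p in S, ‖A j p‖ₑ) atTop (𝓝 0) := by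
    have := tendsto_lintegral_of_dominated_convergence' (μ := volume.restrict S)
      (F := fun j p => ‖A j p‖ₑ) (f := fun _ => 0) (fun _ => C)
      (fun j => (hy2 j).integral_prod_right'.enorm) (fun j => ae_of_all _ fun p => ?_)
      (by simpa using ENNReal.mul_ne_top hC hSv) (ae_of_all _ fun p => ?_)
    · simpa using this
    · refine (enorm_integral_le_lintegral_enorm _).trans ?_
      refine (setLIntegral_le_lintegral _ _).trans ?_
      rw [lintegral_add_left_eq_self (fun b => ‖y j b‖ₑ) p]
      exact hyC j
    · simpa using (hAlim p).enorm
  have hA1 : Tendsto (fun j => (volume W)⁻¹ * ∫⁻ p in S, ‖A j p‖ₑ) atTop (𝓝 0) := by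
    have := ENNReal.Tendsto.const_mul hA0 (a := (volume W)⁻¹) (Or.inr (ENNReal.inv_ne_top.2 hW0))
    rwa [mul_zero] at this
  filter_upwards [(ENNReal.tendsto_nhds_zero.1 hA1) _ hη2] with j hj
  -- Both sides carry the factor `volume W`, as `A` is the unnormalised average; it is cancelled at
  -- the very end.
  have hpt : ∀ p ∈ S, volume W * ‖z j p‖ₑ ≤ ‖A j p‖ₑ + ∫⁻ b in W, ‖y j (p + b) - y j p‖ₑ := by
    intro p hp
    have hpK : p ∈ K := mem_slab.2 ⟨(mem_slab.1 hp).1, by linarith [(mem_slab.1 hp).2]⟩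
    have hyp : y j p = z j p := indicator_of_mem hpK _
    have hi1 : Integrable (fun b => y j (p + b)) (volume.restrict W) :=
      ((measurePreserving_add_left volume p).integrable_comp_of_integrable (hyi j)).integrableOn
    have hi2 : Integrable (fun _ : Cyl n => y j p) (volume.restrict W) :=
      integrableOn_const hWt (by simp)
    have e : ∫ b in W, (y j (p + b) - y j p) = A j p - (volume W).toReal * z j p := by
      rw [integral_sub hi1 hi2, setIntegral_const, hyp]; rfl
    have e2 : (volume W).toReal * z j p = A j p - ∫ b in W, (y j (p + b) - y j p) := by
      rw [e]; ring
    calc volume W * ‖z j p‖ₑ = ‖(volume W).toReal * z j p‖ₑ := by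
          rw [enorm_mul, Real.enorm_of_nonneg ENNReal.toReal_nonneg, ENNReal.ofReal_toReal hWt]
      _ ≤ ‖A j p‖ₑ + ‖∫ b in W, (y j (p + b) - y j p)‖ₑ := by rw [e2]; exact enorm_sub_le
      _ ≤ _ := by gcongr; exact enorm_integral_le_lintegral_enorm _
  have hdiff : AEMeasurable (Function.uncurry fun p b => ‖y j (p + b) - y j p‖ₑ)
      ((volume.restrict S).prod (volume.restrict W)) := by
    refine ((hy2 j).sub ?_).enorm
    exact ((hy j).restrict (s := S)).comp_fst
  have hsecond : ∫⁻ p in S, ∫⁻ b in W, ‖y j (p + b) - y j p‖ₑ ≤ volume W * (η / 2) := by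
    rw [lintegral_lintegral_swap hdiff]
    calc ∫⁻ b in W, ∫⁻ p in S, ‖y j (p + b) - y j p‖ₑ ≤ ∫⁻ _b in W, η / 2 := by
          refine setLIntegral_mono' hWm fun b hb => ?_
          calc ∫⁻ p in S, ‖y j (p + b) - y j p‖ₑ = ∫⁻ p in S, ‖z j (p + b) - z j p‖ₑ := by
                refine setLIntegral_congr_fun hS fun p hp => ?_
                have hpK : p ∈ K := mem_slab.2 ⟨(mem_slab.1 hp).1, by linarith [(mem_slab.1 hp).2]⟩
                simp only [y, indicator_of_mem hpK, indicator_of_mem (hSK p hp b hb)]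
            _ ≤ _ := lintegral_slab_translate_le (hz j) ha hb
            _ ≤ _ := by gcongr; exact hZ j
            _ ≤ _ := hδη
      _ = _ := by simp [mul_comm]
  have hfinal : volume W * ∫⁻ p in S, ‖z j p‖ₑ ≤
      (∫⁻ p in S, ‖A j p‖ₑ) + volume W * (η / 2) := by
    rw [← lintegral_const_mul' _ _ hWt]
    calc _ ≤ ∫⁻ p in S, (‖A j p‖ₑ + ∫⁻ b in W, ‖y j (p + b) - y j p‖ₑ) :=
          setLIntegral_mono' hS hpt
      _ = _ := lintegral_add_left' (hy2 j).integral_prod_right'.enorm _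
      _ ≤ _ := by gcongr
  have h2 : ∫⁻ p in S, ‖A j p‖ₑ ≤ volume W * (η / 2) := by
    rwa [ENNReal.inv_mul_le_iff hW0 hWt] at hj
  have h3 : volume W * ∫⁻ p in S, ‖z j p‖ₑ ≤ volume W * η := by
    refine hfinal.trans ((add_le_add h2 le_rfl).trans_eq ?_)
    rw [← mul_add, ENNReal.add_halves]
  exact (ENNReal.mul_le_mul_iff_right hW0 hWt).1 h3

end Rellich

/-! ### Compactness on the half cylinder -/

section HalfCylinder

theorem lintegral_exp_neg_Ioi : ∫⁻ y in Ioi (0 : ℝ), ENNReal.ofReal (Real.exp (-y)) = 1 := by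
  rw [← ofReal_integral_eq_lintegral_ofReal (integrableOn_exp_neg_Ioi 0)
    (ae_of_all _ fun y => (Real.exp_pos _).le), integral_exp_neg_Ioi]
  simp

theorem aestronglyMeasurable_exp_neg_snd (μ : Measure (Cyl n)) :
    AEStronglyMeasurable (fun p : Cyl n => Real.exp (-p.2)) μ :=
  (by fun_prop : Continuous fun p : Cyl n => Real.exp (-p.2)).aestronglyMeasurable

/-- The functions need not be square integrable as `y → ∞`. The weight `exp (-y)` puts the whole
sequence into one `L²` space, so that a single extraction handles every compact set. -/
theorem eLpNorm_fst_mul_exp_le {ρ : Torus n → ℝ} (hρ : AEStronglyMeasurable ρ volume) :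
    eLpNorm (fun p : Cyl n => ρ p.1 * Real.exp (-p.2)) 2 (volume.restrict (upperHalf n)) ≤
      eLpNorm ρ 2 volume := by
  rw [eLpNorm_two_le_iff, eLpNorm_two_sq, restrict_upperHalf]
  have e : ∀ p : Cyl n, ‖ρ p.1 * Real.exp (-p.2)‖ₑ ^ 2 =
      ‖ρ p.1‖ₑ ^ 2 * ENNReal.ofReal (Real.exp (-p.2)) ^ 2 := fun p => by
    rw [enorm_mul, mul_pow, Real.enorm_of_nonneg (Real.exp_pos _).le]
  simp_rw [e]
  rw [lintegral_prod_mul (f := fun x => ‖ρ x‖ₑ ^ 2)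
    (g := fun y : ℝ => ENNReal.ofReal (Real.exp (-y)) ^ 2) (hρ.enorm.pow_const 2)
    (by fun_prop)]
  refine (mul_le_mul_right (lintegral_exp_neg_Ioi ▸ setLIntegral_mono (by fun_prop)
    fun y hy => ?_) _).trans_eq (mul_one _)
  rw [sq]
  refine (mul_le_mul_right (ENNReal.ofReal_le_one.2 ?_) _).trans_eq (mul_one _)
  exact Real.exp_le_one_iff.2 (neg_nonpos.2 (mem_Ioi.1 hy).le)

/-- The squared primitive grows at most linearly in `y`, and `y exp (-2y) ≤ exp (-y)` has integral
at most `1`. -/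
theorem eLpNorm_vprim_mul_exp_le {F : Cyl n → ℝ}
    (hF : AEStronglyMeasurable F (volume.restrict (upperHalf n))) :
    eLpNorm (fun p : Cyl n => vprim F 0 p * Real.exp (-p.2)) 2 (volume.restrict (upperHalf n)) ≤
      eLpNorm F 2 (volume.restrict (upperHalf n)) := by
  rw [eLpNorm_two_le_iff, eLpNorm_two_sq]
  have e : ∀ p : Cyl n, ‖vprim F 0 p * Real.exp (-p.2)‖ₑ ^ 2 =
      ‖vprim F 0 p‖ₑ ^ 2 * ENNReal.ofReal (Real.exp (-p.2)) ^ 2 := fun p => by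
    rw [enorm_mul, mul_pow, Real.enorm_of_nonneg (Real.exp_pos _).le]
  simp_rw [e]
  refine (lintegral_vprim_sq_mul_le hF
    (κ := fun y => ENNReal.ofReal (Real.exp (-y)) ^ 2) (by fun_prop)).trans ?_
  refine (mul_le_mul_left (lintegral_exp_neg_Ioi ▸ setLIntegral_mono (by fun_prop)
    fun y hy => ?_) _).trans_eq (one_mul _)
  rw [sq, ← mul_assoc]
  refine (mul_le_mul_left ?_ _).trans_eq (one_mul _)
  rw [← ENNReal.ofReal_mul (mem_Ioi.1 hy).le, Real.exp_neg]
  refine ENNReal.ofReal_le_one.2 ?_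
  rw [mul_inv_le_iff₀ (Real.exp_pos _), one_mul]
  linarith [Real.add_one_le_exp y]

/-- Convergence of functions on the half cylinder together with their gradients. -/
structure HalfTendsto (v : ℕ → Cyl n → ℝ) (G : ℕ → Cyl n → EuclideanSpace ℝ (Fin (n + 1)))
    (w : Cyl n → ℝ) (H : Cyl n → EuclideanSpace ℝ (Fin (n + 1))) : Prop where
  isH1LocGrad : IsH1LocGrad (cylCover n) (upperHalf n) w H
  memLp : MemLp H 2 (volume.restrict (upperHalf n))
  weak_fun : ∀ K, IsCompact K → K ⊆ upperHalf n → ∀ ψ : Cyl n → ℝ,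
    MemLp ψ 2 (volume.restrict K) →
    Tendsto (fun j => ∫ p in K, v j p * ψ p) atTop (𝓝 (∫ p in K, w p * ψ p))
  weak_grad : ∀ ψ : Cyl n → EuclideanSpace ℝ (Fin (n + 1)),
    MemLp ψ 2 (volume.restrict (upperHalf n)) →
    Tendsto (fun j => ∫ p in upperHalf n, inner ℝ (G j p) (ψ p)) atTop
      (𝓝 (∫ p in upperHalf n, inner ℝ (H p) (ψ p)))
  l1 : L1LocTendsto (upperHalf n) v w

theorem HalfTendsto.comp {v : ℕ → Cyl n → ℝ} {G : ℕ → Cyl n → EuclideanSpace ℝ (Fin (n + 1))}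
    {w : Cyl n → ℝ} {H : Cyl n → EuclideanSpace ℝ (Fin (n + 1))} (h : HalfTendsto v G w H)
    {k : ℕ → ℕ} (hk : StrictMono k) :
    HalfTendsto (fun j => v (k j)) (fun j => G (k j)) w H where
  isH1LocGrad := h.isH1LocGrad
  memLp := h.memLp
  weak_fun K hK hKU ψ hψ := (h.weak_fun K hK hKU ψ hψ).comp hk.tendsto_atTop
  weak_grad ψ hψ := (h.weak_grad ψ hψ).comp hk.tendsto_atTop
  l1 K hK hKU := ⟨fun j => (h.l1 K hK hKU).1 (k j), (h.l1 K hK hKU).2.1,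
    (h.l1 K hK hKU).2.2.comp hk.tendsto_atTop⟩

theorem memLp_mul_exp {K : Set (Cyl n)} (hK : IsCompact K) {f : Cyl n → ℝ}
    (hf : MemLp f 2 (volume.restrict K)) :
    MemLp (fun p => f p * Real.exp p.2) 2 (volume.restrict K) := by
  obtain ⟨R, -, hR⟩ := exists_subset_slab hK
  refine MemLp.of_le_mul (c := Real.exp R) hf (hf.1.mul
    (by fun_prop : Continuous fun p : Cyl n => Real.exp p.2).aestronglyMeasurable) ?_
  refine (ae_restrict_iff' hK.measurableSet).2 (ae_of_all _ fun p hp => ?_)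
  rw [norm_mul, mul_comm, Real.norm_of_nonneg (Real.exp_pos _).le]
  gcongr
  exact (mem_slab.1 (hR hp)).2

/-- The trace and gradient bounds control `exp (-y) v j` in `L²`. Weak limits of the weighted
functions and of the gradients exist along a common subsequence; testing the integration by parts
identity shows that they fit together, and Rellich applied to `v j - w` gives the strong
convergence. -/
theorem exists_halfTendsto {v : ℕ → Cyl n → ℝ} {G : ℕ → Cyl n → EuclideanSpace ℝ (Fin (n + 1))}
    {ρ : ℕ → Torus n → ℝ} (hv : ∀ j, IsH1LocGrad (cylCover n) (upperHalf n) (v j) (G j))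
    (hρ : ∀ j, AEStronglyMeasurable (ρ j) volume)
    (hrep : ∀ j, ∀ᵐ p ∂volume.restrict (upperHalf n),
      v j p = ρ j p.1 + vprim (fun q => G j q (Fin.last n)) 0 p)
    {B : ℝ≥0∞} (hB : B ≠ ⊤) (hρB : ∀ j, eLpNorm (ρ j) 2 volume ≤ B)
    (hGB : ∀ j, eLpNorm (G j) 2 (volume.restrict (upperHalf n)) ≤ B) :
    ∃ (k : ℕ → ℕ) (w : Cyl n → ℝ) (H : Cyl n → EuclideanSpace ℝ (Fin (n + 1))),
      StrictMono k ∧ HalfTendsto (fun j => v (k j)) (fun j => G (k j)) w H := by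
  have hvm : ∀ j, AEStronglyMeasurable (v j) (volume.restrict (upperHalf n)) := fun j =>
    (hv j).aestronglyMeasurable_fun isOpen_upperHalf
  have hGm : ∀ j, AEStronglyMeasurable (G j) (volume.restrict (upperHalf n)) := fun j =>
    (hv j).aestronglyMeasurable_grad isOpen_upperHalf
  have hGlm : ∀ j, AEStronglyMeasurable (fun q => G j q (Fin.last n))
      (volume.restrict (upperHalf n)) := fun j =>
    (EuclideanSpace.proj (Fin.last n) :
      EuclideanSpace ℝ (Fin (n + 1)) →L[ℝ] ℝ).continuous.comp_aestronglyMeasurable (hGm j)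
  set f : ℕ → Cyl n → ℝ := fun j p => v j p * Real.exp (-p.2)
  have hfm : ∀ j, AEStronglyMeasurable (f j) (volume.restrict (upperHalf n)) := fun j =>
    (hvm j).mul (aestronglyMeasurable_exp_neg_snd _)
  have hfB : ∀ j, eLpNorm (f j) 2 (volume.restrict (upperHalf n)) ≤ B + B := fun j => by
    have e : f j =ᵐ[volume.restrict (upperHalf n)] (fun p => ρ j p.1 * Real.exp (-p.2)) +
        fun p => vprim (fun q => G j q (Fin.last n)) 0 p * Real.exp (-p.2) := by
      filter_upwards [hrep j] with p hp
      simp only [f, hp, Pi.add_apply, add_mul]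
    rw [eLpNorm_congr_ae e]
    refine (eLpNorm_add_le ?_ ?_ (by norm_num)).trans (add_le_add
      ((eLpNorm_fst_mul_exp_le (hρ j)).trans (hρB j))
      (((eLpNorm_vprim_mul_exp_le (hGlm j)).trans ?_).trans (hGB j)))
    · exact ((hρ j).comp_fst.restrict).mul (aestronglyMeasurable_exp_neg_snd _)
    · exact (aestronglyMeasurable_vprim_upperHalf (hGlm j)).mul (aestronglyMeasurable_exp_neg_snd _)
    · exact eLpNorm_mono fun p => PiLp.norm_apply_le _ _
  obtain ⟨k₁, a, hk₁, ha, hlim₁⟩ := exists_weakly_convergent_subseq_memLp hfm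
    (ENNReal.add_ne_top.2 ⟨hB, hB⟩) hfB
  obtain ⟨k₂, H, hk₂, hH, hlim₂⟩ := exists_weakly_convergent_subseq_memLp
    (fun j => hGm (k₁ j)) hB (fun j => hGB (k₁ j))
  set k : ℕ → ℕ := fun j => k₁ (k₂ j)
  set w : Cyl n → ℝ := fun p => a p * Real.exp p.2
  -- Undoing the weight is harmless on compact sets, where `exp y` is bounded; in weak pairings it
  -- is moved onto the test function.
  have hwK : ∀ K, IsCompact K → K ⊆ upperHalf n → MemLp w 2 (volume.restrict K) :=
    fun K hK hKU => memLp_mul_exp hK (ha.mono_measure (Measure.restrict_mono hKU le_rfl))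
  have hweak : ∀ K, IsCompact K → K ⊆ upperHalf n → ∀ ψ : Cyl n → ℝ,
      MemLp ψ 2 (volume.restrict K) →
      Tendsto (fun j => ∫ p in K, v (k j) p * ψ p) atTop (𝓝 (∫ p in K, w p * ψ p)) := by
    intro K hK hKU ψ hψ
    have hψ' : MemLp (K.indicator fun p => ψ p * Real.exp p.2) 2
        (volume.restrict (upperHalf n)) := by
      rw [memLp_indicator_iff_restrict hK.measurableSet, Measure.restrict_restrict
        hK.measurableSet, inter_eq_self_of_subset_left hKU]
      exact memLp_mul_exp hK hψ
    have e : ∀ b : Cyl n → ℝ, ∫ p in upperHalf n,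
        inner ℝ (b p) (K.indicator (fun p => ψ p * Real.exp p.2) p) =
        ∫ p in K, b p * Real.exp p.2 * ψ p := fun b => by
      rw [← inter_eq_self_of_subset_left hKU, ← Measure.restrict_restrict hK.measurableSet,
        ← integral_indicator hK.measurableSet, inter_eq_self_of_subset_left hKU]
      congr 1; ext p
      by_cases hp : p ∈ K
      · simp only [indicator_of_mem hp, RCLike.inner_apply, conj_trivial]; ring
      · simp [hp]
    have h := (hlim₁ _ hψ').comp hk₂.tendsto_atTop
    simp only [Function.comp_def, e] at h
    refine h.congr fun j => ?_
    congr 1; ext p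
    simp only [f, mul_assoc, ← Real.exp_add]
    simp [k]
  have hgrad : IsH1LocGrad (cylCover n) (upperHalf n) w H := by
    refine ⟨hwK, fun K hK hKU => hH.mono_measure (Measure.restrict_mono hKU le_rfl),
      fun φ hφ i => ?_⟩
    have h1 : ∀ b : Cyl n → ℝ, ∫ p in upperHalf n, b p * pderiv (cylCover n) i φ p =
        ∫ p in tsupport φ, b p * pderiv (cylCover n) i φ p := fun b =>
      setIntegral_eq_of_subset_of_forall_sdiff_eq_zero measurableSet_upperHalf
        hφ.tsupport_subset fun p hp => by
          rw [pderiv_eq_zero_of_notMem_tsupport i hp.2, mul_zero]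
    have hd : MemLp (pderiv (cylCover n) i φ) 2 (volume.restrict (tsupport φ)) := by
      have : IsFiniteMeasure ((volume : Measure (Cyl n)).restrict (tsupport φ)) :=
        ⟨by simpa using hφ.hasCompactSupport.isCompact.measure_lt_top⟩
      obtain ⟨C, -, hC⟩ := hφ.exists_bound_pderiv i
      exact MemLp.of_bound (hφ.continuous_pderiv i).aestronglyMeasurable C (ae_of_all _ hC)
    have h2 := hweak (tsupport φ) hφ.hasCompactSupport.isCompact hφ.tsupport_subset _ hd
    simp only [← h1] at h2
    have hψ : MemLp (fun p => EuclideanSpace.single i (φ p)) 2 (volume.restrict (upperHalf n)) := by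
      have : MemLp φ 2 (volume.restrict (upperHalf n)) :=
        (hφ.continuous.memLp_of_hasCompactSupport hφ.hasCompactSupport).restrict _
      refine MemLp.of_le this ?_ (ae_of_all _ fun p => by simp)
      have : Continuous fun t : ℝ => (EuclideanSpace.single i t : EuclideanSpace ℝ (Fin (n + 1))) :=
        (PiLp.continuous_toLp 2 _).comp (continuous_single (A := fun _ : Fin (n + 1) => ℝ) i)
      exact (this.comp hφ.continuous).aestronglyMeasurable
    have h3 := (hlim₂ _ hψ).neg
    have e3 : ∀ b : Cyl n → EuclideanSpace ℝ (Fin (n + 1)),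
        ∫ p in upperHalf n, inner ℝ (b p) (EuclideanSpace.single i (φ p)) =
        ∫ p in upperHalf n, b p i * φ p := fun b => by
      congr 1; ext p
      rw [EuclideanSpace.inner_single_right]
      simp [mul_comm]
    simp only [e3] at h3
    exact tendsto_nhds_unique (h2.congr fun j => (hv (k j)).weakGrad φ hφ i) h3
  have hsub : ∀ j, IsH1LocGrad (cylCover n) (upperHalf n) (fun p => v (k j) p - w p)
      (fun p => G (k j) p - H p) := fun j => (hv (k j)).sub hgrad
  have hslab : ∀ a R : ℝ, 0 < a →
      Tendsto (fun j => ∫⁻ p in slab n a R, ‖v (k j) p - w p‖ₑ) atTop (𝓝 0) := by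
    intro a₀ R₀ ha₀
    have hfin : B + eLpNorm H 2 (volume.restrict (upperHalf n)) ≠ ⊤ :=
      ENNReal.add_ne_top.2 ⟨hB, hH.2.ne⟩
    refine tendsto_lintegral_slab_of_weak hsub hfin (fun j => ?_) (fun a' R ha' => ?_)
      (fun a' R ha' ψ hψ => ?_) ha₀
    · exact (eLpNorm_sub_le (hGm _) hH.1 (by norm_num)).trans (add_le_add (hGB _) le_rfl)
    · have hle : (volume : Measure (Cyl n)).restrict (slab n a' R) ≤
          volume.restrict (upperHalf n) :=
        Measure.restrict_mono (slab_subset_upperHalf ha' R) le_rfl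
      refine ⟨ENNReal.ofReal (Real.exp R) * (ENNReal.ofReal (R - a') ^ (1 / 2 : ℝ) *
        (B + B + eLpNorm a 2 (volume.restrict (upperHalf n)))), ?_, fun j => ?_⟩
      · refine ENNReal.mul_ne_top ENNReal.ofReal_ne_top (ENNReal.mul_ne_top
          (ENNReal.rpow_ne_top_of_nonneg (by norm_num) ENNReal.ofReal_ne_top)
          (ENNReal.add_ne_top.2 ⟨ENNReal.add_ne_top.2 ⟨hB, hB⟩, ha.2.ne⟩))
      · have hm := (hfm (k j)).sub ha.1
        calc ∫⁻ p in slab n a' R, ‖v (k j) p - w p‖ₑ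
            ≤ ∫⁻ p in slab n a' R, ENNReal.ofReal (Real.exp R) * ‖(f (k j) - a) p‖ₑ := by
              refine setLIntegral_mono' (measurableSet_slab a' R) fun p hp => ?_
              have e : v (k j) p - w p = Real.exp p.2 * (f (k j) - a) p := by
                have : Real.exp p.2 * Real.exp (-p.2) = 1 := by rw [← Real.exp_add]; simp
                simp only [f, w, Pi.sub_apply]
                linear_combination -v (k j) p * this
              rw [e, enorm_mul, Real.enorm_of_nonneg (Real.exp_pos _).le]
              gcongr
              exact (mem_slab.1 hp).2
          _ = ENNReal.ofReal (Real.exp R) * ∫⁻ p in slab n a' R, ‖(f (k j) - a) p‖ₑ :=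
              lintegral_const_mul' _ _ ENNReal.ofReal_ne_top
          _ ≤ _ := by
              gcongr
              refine (lintegral_le_sqrt_mul_eLpNorm (hm.mono_measure hle)).trans ?_
              rw [Measure.restrict_apply_univ, volume_slab]
              gcongr
              refine (eLpNorm_mono_measure _ hle).trans
                ((eLpNorm_sub_le (hfm _) ha.1 (by norm_num)).trans ?_)
              gcongr
              exact hfB _
    · have hK := isCompact_slab (n := n) a' R
      have hKU := slab_subset_upperHalf (n := n) ha' R
      have h := (hweak _ hK hKU ψ hψ).sub_const (∫ p in slab n a' R, w p * ψ p)
      rw [sub_self] at h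
      refine h.congr fun j => ?_
      simp only [sub_mul]
      exact (integral_sub (((hv (k j)).memLp_fun _ hK hKU).integrable_mul hψ)
        ((hwK _ hK hKU).integrable_mul hψ)).symm
  refine ⟨k, w, H, hk₁.comp hk₂, hgrad, hH, hweak, hlim₂, fun K hK hKU =>
    ⟨fun j => (hv (k j)).integrableOn_fun K hK hKU, hgrad.integrableOn_fun K hK hKU, ?_⟩⟩
  obtain ⟨a', R, ha', -, hKs⟩ := exists_subset_slab_of_upperHalf hK hKU
  exact tendsto_of_tendsto_of_tendsto_of_le_of_le tendsto_const_nhds (hslab a' R ha')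
    (fun _ => zero_le) fun j => lintegral_mono_set hKs

end HalfCylinder

/-! ### Compactness of sequences with bounded energy -/

section Compactness

theorem IsH1LocGrad.sub_const {U : Set (Cyl n)} {u : Cyl n → ℝ}
    {G : Cyl n → EuclideanSpace ℝ (Fin (n + 1))} (h : IsH1LocGrad (cylCover n) U u G) (c : ℝ) :
    IsH1LocGrad (cylCover n) U (fun p => u p - c) G := by
  simpa using h.sub (isH1LocGrad_const U c)

/-- Local convergence only sees slabs at positive distance from `y = 0`; bounds uniform in that
distance pass to the strip by monotone convergence. -/
theorem setLIntegral_strip_le_of_slab {f : Cyl n → ℝ≥0∞} {h : ℝ} {C : ℝ≥0∞}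
    (hf : ∀ a, 0 < a → ∫⁻ p in slab n a h, f p ≤ C) : ∫⁻ p in strip n h, f p ≤ C := by
  have hsub : strip n h ⊆ ⋃ m : ℕ, slab n (1 / ((m : ℝ) + 1)) h := fun p hp => by
    obtain ⟨h1, h2⟩ := mem_strip.1 hp
    obtain ⟨m, hm⟩ := exists_nat_one_div_lt h1
    exact mem_iUnion.2 ⟨m, mem_slab.2 ⟨hm.le, h2.le⟩⟩
  refine (lintegral_mono_set hsub).trans ?_
  have hmono : Monotone fun m : ℕ => slab n (1 / ((m : ℝ) + 1)) h := fun m m' hmm p hp => by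
    refine mem_slab.2 ⟨le_trans ?_ (mem_slab.1 hp).1, (mem_slab.1 hp).2⟩
    exact one_div_le_one_div_of_le (by positivity) (by exact_mod_cast Nat.succ_le_succ hmm)
  rw [setLIntegral_iUnion_of_directed _ hmono.directed_le]
  exact iSup_le fun m => hf _ (by positivity)

variable {g : Torus n → ℝ} {M : ℝ} {ε : ℕ → ℝ} {u : ℕ → Cyl n → ℝ}
  {G : ℕ → Cyl n → EuclideanSpace ℝ (Fin (n + 1))}

theorem rpow_half_sq (c : ℝ≥0∞) : (c ^ (1 / 2 : ℝ)) ^ 2 = c := by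
  rw [← ENNReal.rpow_natCast, ← ENNReal.rpow_mul]
  norm_num

theorem eLpNorm_gradUp_le (hM : ∀ᵐ x, |g x| ≤ M) (hM0 : 0 ≤ M) {e : ℝ} (he : 0 < e)
    {F : Cyl n → EuclideanSpace ℝ (Fin (n + 1))} :
    eLpNorm (gradUp (M * e) F) 2 (volume.restrict (upperHalf n)) ≤
      strainDefect g e F ^ (1 / 2 : ℝ) := by
  rw [eLpNorm_two_le_iff, rpow_half_sq]
  exact le_self_add.trans (lintegral_gradUp_add_gradDown_le hM hM0 he)

theorem eLpNorm_gradDown_le (hM : ∀ᵐ x, |g x| ≤ M) (hM0 : 0 ≤ M) {e : ℝ} (he : 0 < e)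
    {F : Cyl n → EuclideanSpace ℝ (Fin (n + 1))} :
    eLpNorm (gradDown (M * e) F) 2 (volume.restrict (upperHalf n)) ≤
      strainDefect g e F ^ (1 / 2 : ℝ) := by
  rw [eLpNorm_two_le_iff, rpow_half_sq]
  exact le_add_self.trans (lintegral_gradUp_add_gradDown_le hM hM0 he)

/-- Quantifies the error in the jump condition. The primitives contribute order `e^{3/2}` and `r`
only order `e`; the latter is acceptable because `r` tends to zero along the sequence. -/
theorem lintegral_strip_jump_le {e : ℝ} {v : Cyl n → ℝ} {r : Torus n → ℝ}
    {Fp Fm : Cyl n → EuclideanSpace ℝ (Fin (n + 1))} {B : ℝ≥0∞}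
    (hr : AEStronglyMeasurable r volume)
    (hFp : AEStronglyMeasurable Fp (volume.restrict (upperHalf n)))
    (hFm : AEStronglyMeasurable Fm (volume.restrict (upperHalf n)))
    (hFpB : eLpNorm Fp 2 (volume.restrict (upperHalf n)) ≤ B)
    (hFmB : eLpNorm Fm 2 (volume.restrict (upperHalf n)) ≤ B)
    (hv : ∀ᵐ p ∂volume.restrict (upperHalf n), v p = r p.1 +
      vprim (fun q => Fp q (Fin.last n)) 0 p - vprim (fun q => Fm q (Fin.last n)) 0 p) :
    ∫⁻ p in strip n e, ‖v p‖ₑ ≤ ENNReal.ofReal e ^ (1 / 2 : ℝ) *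
      (ENNReal.ofReal e ^ (1 / 2 : ℝ) * eLpNorm r 2 volume + ENNReal.ofReal e * (B + B)) := by
  have hle : (volume : Measure (Cyl n)).restrict (strip n e) ≤ volume.restrict (upperHalf n) :=
    Measure.restrict_mono (strip_subset_upperHalf e) le_rfl
  have hl : ∀ {F : Cyl n → EuclideanSpace ℝ (Fin (n + 1))},
      AEStronglyMeasurable F (volume.restrict (upperHalf n)) →
      AEStronglyMeasurable (fun q => F q (Fin.last n)) (volume.restrict (upperHalf n)) := fun hF =>
    (EuclideanSpace.proj (Fin.last n) :
      EuclideanSpace ℝ (Fin (n + 1)) →L[ℝ] ℝ).continuous.comp_aestronglyMeasurable hF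
  have hn : ∀ {F : Cyl n → EuclideanSpace ℝ (Fin (n + 1))},
      eLpNorm (fun q => F q (Fin.last n)) 2 (volume.restrict (upperHalf n)) ≤
        eLpNorm F 2 (volume.restrict (upperHalf n)) := fun {F} =>
    eLpNorm_mono fun p => PiLp.norm_apply_le _ _
  have h1 : AEStronglyMeasurable (fun p : Cyl n => r p.1) (volume.restrict (strip n e)) :=
    hr.comp_fst.restrict
  have h2 := (aestronglyMeasurable_vprim_upperHalf (hl hFp)).mono_measure hle
  have h3 := (aestronglyMeasurable_vprim_upperHalf (hl hFm)).mono_measure hle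
  have hae : v =ᵐ[volume.restrict (strip n e)] (fun p : Cyl n => r p.1) +
      vprim (fun q => Fp q (Fin.last n)) 0 - vprim (fun q => Fm q (Fin.last n)) 0 :=
    ae_mono hle hv
  have hm : AEStronglyMeasurable v (volume.restrict (strip n e)) := ((h1.add h2).sub h3).congr hae.symm
  refine (lintegral_le_sqrt_mul_eLpNorm hm).trans ?_
  rw [Measure.restrict_apply_univ, volume_strip, eLpNorm_congr_ae hae]
  gcongr
  refine (eLpNorm_sub_le (h1.add h2) h3 (by norm_num)).trans ((add_le_add
    (eLpNorm_add_le h1 h2 (by norm_num)) le_rfl).trans ?_)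
  rw [eLpNorm_strip_fst hr, mul_add, ← add_assoc]
  gcongr
  · exact (eLpNorm_strip_vprim_le (hl hFp)).trans (by gcongr; exact hn.trans hFpB)
  · exact (eLpNorm_strip_vprim_le (hl hFm)).trans (by gcongr; exact hn.trans hFmB)

/-- Common source of the compactness statement and of the liminf inequality. The `h^{3/2}` bound is
the jump condition in a form that survives `L¹_loc` limits: it compares the two one-sided functions
on strips and mentions no traces. -/
theorem exists_halfTendsto_shift (hg : MemLp g 2 volume) (hM : ∀ᵐ x, |g x| ≤ M) (hM0 : 0 ≤ M)
    (hε_pos : ∀ j, 0 < ε j) (hε_anti : Antitone ε) (hε_lim : Tendsto ε atTop (𝓝 0))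
    (hu : ∀ j, IsH1LocGrad (cylCover n) univ (u j) (G j)) {C : ℝ≥0∞} (hC : C ≠ ⊤)
    (hGC : ∀ j, strainDefect g (ε j) (G j) ≤ C) :
    ∃ (k : ℕ → ℕ) (c : ℕ → ℝ) (up um : Cyl n → ℝ)
      (Hp Hm : Cyl n → EuclideanSpace ℝ (Fin (n + 1))), StrictMono k ∧
      HalfTendsto (fun j p => shiftUp (M * ε (k j)) (u (k j)) p - c j)
        (fun j => gradUp (M * ε (k j)) (G (k j))) up Hp ∧
      HalfTendsto (fun j p => shiftDown (M * ε (k j)) (u (k j)) p - c j)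
        (fun j => gradDown (M * ε (k j)) (G (k j))) um Hm ∧
      ∃ A : ℝ≥0∞, A ≠ ⊤ ∧ ∀ h : ℝ, 0 < h → ∫⁻ p in strip n h, ‖up p - um p - g p.1‖ₑ ≤
        ENNReal.ofReal h * ENNReal.ofReal h ^ (1 / 2 : ℝ) * A := by
  have hCh : C ^ (1 / 2 : ℝ) ≠ ⊤ := ENNReal.rpow_ne_top_of_nonneg (by norm_num) hC
  choose σ r hσ hr hrC hup hdown using fun j =>
    exists_trace_repr hg.1 hM hM0 (hε_pos j) (hu j)
  have hpH : ∀ j, IsH1LocGrad (cylCover n) (upperHalf n) (shiftUp (M * ε j) (u j))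
      (gradUp (M * ε j) (G j)) := fun j => (hu j).shiftUp _
  have hmH : ∀ j, IsH1LocGrad (cylCover n) (upperHalf n) (shiftDown (M * ε j) (u j))
      (gradDown (M * ε j) (G j)) := fun j => (hu j).shiftDown _
  have hpB : ∀ j, eLpNorm (gradUp (M * ε j) (G j)) 2 (volume.restrict (upperHalf n)) ≤
      C ^ (1 / 2 : ℝ) := fun j => (eLpNorm_gradUp_le hM hM0 (hε_pos j)).trans
    (ENNReal.rpow_le_rpow (hGC j) (by norm_num))
  have hmB : ∀ j, eLpNorm (gradDown (M * ε j) (G j)) 2 (volume.restrict (upperHalf n)) ≤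
      C ^ (1 / 2 : ℝ) := fun j => (eLpNorm_gradDown_le hM hM0 (hε_pos j)).trans
    (ENNReal.rpow_le_rpow (hGC j) (by norm_num))
  -- The constant comes from the upper trace alone; the lower trace differs from it by `g + r j`,
  -- which is bounded in `L²`. Using one constant on both sides preserves the jump.
  choose c hc using fun j => exists_trace_sub_const_le (hpH j) (hσ j) (ae_restrict_of_ae (hup j))
  have hrn : ∀ j, eLpNorm (r j) 2 volume ≤ (ENNReal.ofReal (2 * (M * ε j)) * C) ^ (1 / 2 : ℝ) := by
    intro j
    rw [eLpNorm_two_le_iff, rpow_half_sq]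
    exact (hrC j).trans (by gcongr; exact hGC j)
  have hρp : ∀ j, eLpNorm (fun x => σ j x - c j) 2 volume ≤ (n + 2) * C ^ (1 / 2 : ℝ) := fun j =>
    (hc j).trans (by gcongr; exact hpB j)
  have hσm : ∀ j, AEStronglyMeasurable (fun x => σ j x - c j) volume := fun j =>
    (hσ j).aestronglyMeasurable.sub aestronglyMeasurable_const
  have hρm : ∀ j, eLpNorm (fun x => σ j x - c j - g x - r j x) 2 volume ≤
      (n + 2) * C ^ (1 / 2 : ℝ) + eLpNorm g 2 volume +
        (ENNReal.ofReal (2 * (M * ε 0)) * C) ^ (1 / 2 : ℝ) := fun j => by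
    refine (eLpNorm_sub_le ((hσm j).sub hg.1) (hr j) (by norm_num)).trans (add_le_add
      ((eLpNorm_sub_le (hσm j) hg.1 (by norm_num)).trans (add_le_add (hρp j) le_rfl))
      ((hrn j).trans ?_))
    gcongr
    exact hε_anti (Nat.zero_le j)
  have hK1 : ((n : ℝ≥0∞) + 2) * C ^ (1 / 2 : ℝ) ≠ ⊤ := ENNReal.mul_ne_top (by simp) hCh
  have hC' : C ^ (1 / 2 : ℝ) ≤ (n + 2) * C ^ (1 / 2 : ℝ) := by
    refine le_mul_of_one_le_left' ?_
    exact le_add_self.trans' (by norm_num)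
  obtain ⟨k₁, up, Hp, hk₁, hlp⟩ := exists_halfTendsto (fun j => (hpH j).sub_const (c j)) hσm
    (fun j => (ae_restrict_of_ae (hup j)).mono fun p hp => by rw [hp]; ring)
    hK1 hρp (fun j => (hpB j).trans hC')
  obtain ⟨k₂, um, Hm, hk₂, hlm⟩ := exists_halfTendsto
    (fun j => (hmH (k₁ j)).sub_const (c (k₁ j)))
    (ρ := fun j x => σ (k₁ j) x - c (k₁ j) - g x - r (k₁ j) x)
    (fun j => ((hσm _).sub hg.1).sub (hr _))
    (fun j => (ae_restrict_of_ae (hdown (k₁ j))).mono fun p hp => by rw [hp]; ring)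
    (ENNReal.add_ne_top.2 ⟨ENNReal.add_ne_top.2 ⟨hK1, hg.2.ne⟩,
      ENNReal.rpow_ne_top_of_nonneg (by norm_num) (ENNReal.mul_ne_top ENNReal.ofReal_ne_top hC)⟩)
    (fun j => hρm (k₁ j)) (fun j => (hmB _).trans (hC'.trans (le_self_add.trans le_self_add)))
  have hlp' := hlp.comp hk₂
  refine ⟨fun j => k₁ (k₂ j), fun j => c (k₁ (k₂ j)), up, um, Hp, Hm, hk₁.comp hk₂, hlp', hlm,
    ENNReal.ofReal 2 * ENNReal.ofReal 2 ^ (1 / 2 : ℝ) * (C ^ (1 / 2 : ℝ) + C ^ (1 / 2 : ℝ)),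
    ENNReal.mul_ne_top (ENNReal.mul_ne_top ENNReal.ofReal_ne_top
      (ENNReal.rpow_ne_top_of_nonneg (by norm_num) ENNReal.ofReal_ne_top))
      (ENNReal.add_ne_top.2 ⟨hCh, hCh⟩), fun h hh => ?_⟩
  refine setLIntegral_strip_le_of_slab fun a ha => ?_
  have hS := isCompact_slab (n := n) a h
  have hSU := slab_subset_upperHalf (n := n) ha h
  -- The slab is closed at height `h` and the strip open, hence the doubled height; the powers of
  -- `2` go into the constant.
  have hsm : slab n a h ⊆ strip n (2 * h) := fun p hp => by
    have := mem_slab.1 hp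
    exact mem_strip.2 ⟨by linarith, by linarith⟩
  set k := fun j => k₁ (k₂ j)
  have hkt : Tendsto k atTop atTop := (hk₁.comp hk₂).tendsto_atTop
  set X : ℝ≥0∞ := ENNReal.ofReal (2 * h)
  have hX : X ≠ ⊤ := ENNReal.ofReal_ne_top
  have hX2 : X ^ (1 / 2 : ℝ) ≠ ⊤ := ENNReal.rpow_ne_top_of_nonneg (by norm_num) hX
  have hb : ∀ j, ∫⁻ p in slab n a h, ‖up p - um p - g p.1‖ₑ ≤
      (∫⁻ p in slab n a h, ‖shiftUp (M * ε (k j)) (u (k j)) p - c (k j) - up p‖ₑ) +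
      (∫⁻ p in slab n a h, ‖shiftDown (M * ε (k j)) (u (k j)) p - c (k j) - um p‖ₑ) +
      X ^ (1 / 2 : ℝ) * (X ^ (1 / 2 : ℝ) *
        (ENNReal.ofReal (2 * (M * ε (k j))) * C) ^ (1 / 2 : ℝ) +
        X * (C ^ (1 / 2 : ℝ) + C ^ (1 / 2 : ℝ))) := by
    intro j
    have hm1 : AEMeasurable (fun p => ‖shiftUp (M * ε (k j)) (u (k j)) p - c (k j) - up p‖ₑ)
        (volume.restrict (slab n a h)) :=
      (((hlp'.l1 _ hS hSU).1 j).sub (hlp'.l1 _ hS hSU).2.1).1.enorm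
    have hm2 : AEMeasurable (fun p => ‖shiftDown (M * ε (k j)) (u (k j)) p - c (k j) - um p‖ₑ)
        (volume.restrict (slab n a h)) :=
      (((hlm.l1 _ hS hSU).1 j).sub (hlm.l1 _ hS hSU).2.1).1.enorm
    have h3 := lintegral_strip_jump_le (e := 2 * h)
      (v := fun p => shiftUp (M * ε (k j)) (u (k j)) p - shiftDown (M * ε (k j)) (u (k j)) p -
        g p.1) (hr (k j))
      ((hpH (k j)).aestronglyMeasurable_grad isOpen_upperHalf)
      ((hmH (k j)).aestronglyMeasurable_grad isOpen_upperHalf) (hpB _) (hmB _) (by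
        filter_upwards [ae_restrict_of_ae (hup (k j)), ae_restrict_of_ae (hdown (k j))] with p h1 h2
        rw [h1, h2]; ring)
    calc ∫⁻ p in slab n a h, ‖up p - um p - g p.1‖ₑ
        ≤ ∫⁻ p in slab n a h, (‖shiftUp (M * ε (k j)) (u (k j)) p - c (k j) - up p‖ₑ +
          ‖shiftDown (M * ε (k j)) (u (k j)) p - c (k j) - um p‖ₑ +
          ‖shiftUp (M * ε (k j)) (u (k j)) p - shiftDown (M * ε (k j)) (u (k j)) p -
            g p.1‖ₑ) := by
          refine lintegral_mono fun p => ?_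
          have e : up p - um p - g p.1 =
            -(shiftUp (M * ε (k j)) (u (k j)) p - c (k j) - up p) +
            (shiftDown (M * ε (k j)) (u (k j)) p - c (k j) - um p) +
            (shiftUp (M * ε (k j)) (u (k j)) p - shiftDown (M * ε (k j)) (u (k j)) p - g p.1) := by
            ring
          rw [e]
          refine (enorm_add_le _ _).trans (add_le_add ((enorm_add_le _ _).trans ?_) le_rfl)
          rw [enorm_neg]
      _ = (∫⁻ p in slab n a h, ‖shiftUp (M * ε (k j)) (u (k j)) p - c (k j) - up p‖ₑ) +
          (∫⁻ p in slab n a h, ‖shiftDown (M * ε (k j)) (u (k j)) p - c (k j) - um p‖ₑ) +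
          ∫⁻ p in slab n a h, ‖shiftUp (M * ε (k j)) (u (k j)) p -
            shiftDown (M * ε (k j)) (u (k j)) p - g p.1‖ₑ :=
          (lintegral_add_left' (hm1.add hm2) _).trans
            (congrArg (· + _) (lintegral_add_left' hm1 _))
      _ ≤ _ := by
          gcongr
          refine (lintegral_mono_set hsm).trans (h3.trans ?_)
          gcongr
          exact hrn (k j)
  have hεk : Tendsto (fun j => (ENNReal.ofReal (2 * (M * ε (k j))) * C) ^ (1 / 2 : ℝ)) atTop
      (𝓝 0) := by
    have h1 : Tendsto (fun j => ENNReal.ofReal (2 * (M * ε (k j)))) atTop (𝓝 0) := by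
      have := ENNReal.tendsto_ofReal (((hε_lim.comp hkt).const_mul M).const_mul 2)
      simpa using this
    have h2 := (ENNReal.Tendsto.mul_const h1 (b := C) (Or.inr hC)).ennrpow_const (1 / 2)
    rwa [zero_mul, ENNReal.zero_rpow_of_pos (by norm_num)] at h2
  have hlim := (((hlp'.l1 _ hS hSU).2.2).add ((hlm.l1 _ hS hSU).2.2)).add
    (ENNReal.Tendsto.const_mul (a := X ^ (1 / 2 : ℝ)) ((ENNReal.Tendsto.const_mul
      (a := X ^ (1 / 2 : ℝ)) hεk (Or.inr hX2)).add_const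
        (X * (C ^ (1 / 2 : ℝ) + C ^ (1 / 2 : ℝ)))) (Or.inr hX2))
  refine (ge_of_tendsto' hlim hb).trans_eq ?_
  have e1 : X = ENNReal.ofReal 2 * ENNReal.ofReal h := ENNReal.ofReal_mul (by norm_num)
  rw [mul_zero, zero_add, zero_add, zero_add, e1,
    ENNReal.mul_rpow_of_nonneg _ _ (by norm_num : (0 : ℝ) ≤ 1 / 2)]
  ring

end Compactness

/-! ### Energies and gradients -/

section Energies

theorem lintegral_ofReal_half_sq {α E : Type*} [MeasurableSpace α] [NormedAddCommGroup E]
    (μ : Measure α) (f : α → E) :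
    ∫⁻ x, ENNReal.ofReal (1 / 2 * ‖f x‖ ^ 2) ∂μ = 2⁻¹ * ∫⁻ x, ‖f x‖ₑ ^ 2 ∂μ := by
  rw [← lintegral_const_mul' _ _ (by simp)]
  congr 1; ext x
  rw [ENNReal.ofReal_mul (by norm_num), ENNReal.ofReal_pow (norm_nonneg _), ofReal_norm,
    one_div, ENNReal.ofReal_inv_of_pos (by norm_num)]
  simp

/-- The energy is an infimum over representatives of the gradient, so a strict bound is what yields
an actual representative. -/
theorem exists_grad_of_energyEps_lt {g : Torus n → ℝ} {e : ℝ} {u : Cyl n → ℝ} {b : ℝ≥0∞}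
    (h : energyEps g e u < b) : ∃ G, IsH1LocGrad (cylCover n) univ u G ∧
      strainDefect g e G ≤ 2 * b := by
  simp only [energyEps, iInf_lt_iff] at h
  obtain ⟨G, hG, hlt⟩ := h
  refine ⟨G, hG, ?_⟩
  rw [lintegral_ofReal_half_sq] at hlt
  calc strainDefect g e G = 2 * (2⁻¹ * strainDefect g e G) := by
        rw [← mul_assoc, ENNReal.mul_inv_cancel (by simp) (by simp), one_mul]
    _ ≤ 2 * b := by gcongr; exact hlt.le

theorem HalfTendsto.weakH1LocTendsto {v : ℕ → Cyl n → ℝ}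
    {G : ℕ → Cyl n → EuclideanSpace ℝ (Fin (n + 1))} {w : Cyl n → ℝ}
    {H : Cyl n → EuclideanSpace ℝ (Fin (n + 1))} (h : HalfTendsto v G w H)
    (hv : ∀ j, IsH1LocGrad (cylCover n) (upperHalf n) (v j) (G j)) :
    WeakH1LocTendsto (cylCover n) (upperHalf n) v w := by
  refine ⟨G, H, hv, h.isH1LocGrad, fun K hK hKU ψ hψ => ⟨h.weak_fun K hK hKU ψ hψ, fun i => ?_⟩⟩
  have hψ' : MemLp (fun p => EuclideanSpace.single i (K.indicator ψ p)) 2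
      (volume.restrict (upperHalf n)) := by
    have h1 : MemLp (K.indicator ψ) 2 (volume.restrict (upperHalf n)) := by
      rw [memLp_indicator_iff_restrict hK.measurableSet, Measure.restrict_restrict
        hK.measurableSet, inter_eq_self_of_subset_left hKU]
      exact hψ
    refine MemLp.of_le h1 ?_ (ae_of_all _ fun p => by simp)
    have : Continuous fun t : ℝ => (EuclideanSpace.single i t : EuclideanSpace ℝ (Fin (n + 1))) :=
      (PiLp.continuous_toLp 2 _).comp (continuous_single (A := fun _ : Fin (n + 1) => ℝ) i)
    exact this.comp_aestronglyMeasurable h1.1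
  have e : ∀ b : Cyl n → EuclideanSpace ℝ (Fin (n + 1)),
      ∫ p in upperHalf n, inner ℝ (b p) (EuclideanSpace.single i (K.indicator ψ p)) =
      ∫ p in K, b p i * ψ p := fun b => by
    rw [← inter_eq_self_of_subset_left hKU, ← Measure.restrict_restrict hK.measurableSet,
      ← integral_indicator hK.measurableSet, inter_eq_self_of_subset_left hKU]
    congr 1; ext p
    rw [EuclideanSpace.inner_single_right]
    by_cases hp : p ∈ K <;> simp [hp, mul_comm]
  simpa only [e] using h.weak_grad _ hψ'

/-- Weak lower semicontinuity of the norm through `2 ⟨G, H⟩ ≤ ‖G‖² + ‖H‖²`: the left side tends to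
`2 ‖H‖²`, and one `‖H‖²` cancels. The two halves are treated together, since only their sum is
bounded by `b`. -/
theorem HalfTendsto.two_mul_lintegral_le {v v' : ℕ → Cyl n → ℝ}
    {G G' : ℕ → Cyl n → EuclideanSpace ℝ (Fin (n + 1))} {w w' : Cyl n → ℝ}
    {H H' : Cyl n → EuclideanSpace ℝ (Fin (n + 1))} (h : HalfTendsto v G w H)
    (h' : HalfTendsto v' G' w' H')
    (hGm : ∀ j, AEStronglyMeasurable (G j) (volume.restrict (upperHalf n)))
    (hGm' : ∀ j, AEStronglyMeasurable (G' j) (volume.restrict (upperHalf n)))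
    {b : ℝ≥0∞} (hb : b ≠ ⊤) (hG : ∀ j, (∫⁻ p in upperHalf n, ‖G j p‖ₑ ^ 2) +
      ∫⁻ p in upperHalf n, ‖G' j p‖ₑ ^ 2 ≤ b) :
    (∫⁻ p in upperHalf n, ‖H p‖ₑ ^ 2) + ∫⁻ p in upperHalf n, ‖H' p‖ₑ ^ 2 ≤ b := by
  set μ := (volume : Measure (Cyl n)).restrict (upperHalf n)
  have hfin : ∀ F : Cyl n → EuclideanSpace ℝ (Fin (n + 1)), MemLp F 2 μ →
      ∫⁻ p, ‖F p‖ₑ ^ 2 ∂μ ≠ ⊤ := fun F hF => by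
    rw [← eLpNorm_two_sq]
    exact ENNReal.pow_ne_top hF.2.ne
  have hreal : ∀ F : Cyl n → EuclideanSpace ℝ (Fin (n + 1)), MemLp F 2 μ →
      ENNReal.ofReal (∫ p, ‖F p‖ ^ 2 ∂μ) = ∫⁻ p, ‖F p‖ₑ ^ 2 ∂μ := fun F hF => by
    rw [ofReal_integral_eq_lintegral_ofReal hF.norm.integrable_sq
      (ae_of_all _ fun p => by positivity)]
    simp only [ENNReal.ofReal_pow (norm_nonneg _), ofReal_norm]
  have hmem : ∀ j, MemLp (G j) 2 μ := fun j => ⟨hGm j, by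
    refine lt_of_le_of_lt ((eLpNorm_two_le_iff (c := b ^ (1 / 2 : ℝ))).2 ?_)
      (ENNReal.rpow_lt_top_of_nonneg (by norm_num) hb)
    rw [rpow_half_sq]
    exact le_self_add.trans (hG j)⟩
  have hmem' : ∀ j, MemLp (G' j) 2 μ := fun j => ⟨hGm' j, by
    refine lt_of_le_of_lt ((eLpNorm_two_le_iff (c := b ^ (1 / 2 : ℝ))).2 ?_)
      (ENNReal.rpow_lt_top_of_nonneg (by norm_num) hb)
    rw [rpow_half_sq]
    exact le_add_self.trans (hG j)⟩
  have hyoung : ∀ F K : Cyl n → EuclideanSpace ℝ (Fin (n + 1)), MemLp F 2 μ → MemLp K 2 μ →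
      2 * ∫ p, inner ℝ (F p) (K p) ∂μ ≤ ∫ p, ‖F p‖ ^ 2 ∂μ + ∫ p, ‖K p‖ ^ 2 ∂μ := by
    intro F K hF hK
    rw [← integral_add hF.norm.integrable_sq hK.norm.integrable_sq, ← integral_const_mul]
    refine integral_mono ?_ (hF.norm.integrable_sq.add hK.norm.integrable_sq) fun p => ?_
    · refine Integrable.const_mul ?_ 2
      refine Integrable.mono' (hF.norm.integrable_mul hK.norm) (hF.1.inner hK.1) ?_
      exact ae_of_all _ fun p => norm_inner_le_norm _ _
    · have := real_inner_le_norm (F p) (K p)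
      have h2 := sq_nonneg (‖F p‖ - ‖K p‖)
      simp only
      nlinarith
  have hle : ∀ j, 2 * ∫ p, inner ℝ (G j p) (H p) ∂μ + 2 * ∫ p, inner ℝ (G' j p) (H' p) ∂μ ≤
      b.toReal + (∫ p, ‖H p‖ ^ 2 ∂μ + ∫ p, ‖H' p‖ ^ 2 ∂μ) := by
    intro j
    have h1 := hyoung _ _ (hmem j) h.memLp
    have h2 := hyoung _ _ (hmem' j) h'.memLp
    have h3 : ∫ p, ‖G j p‖ ^ 2 ∂μ + ∫ p, ‖G' j p‖ ^ 2 ∂μ ≤ b.toReal := by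
      rw [← ENNReal.ofReal_le_iff_le_toReal hb, ENNReal.ofReal_add
        (integral_nonneg fun _ => by positivity) (integral_nonneg fun _ => by positivity),
        hreal _ (hmem j), hreal _ (hmem' j)]
      exact hG j
    linarith
  have hlim := le_of_tendsto' (((h.weak_grad H h.memLp).const_mul 2).add
    ((h'.weak_grad H' h'.memLp).const_mul 2)) hle
  simp only [real_inner_self_eq_norm_sq] at hlim
  rw [← hreal _ h.memLp, ← hreal _ h'.memLp, ← ENNReal.ofReal_add
    (integral_nonneg fun _ => by positivity) (integral_nonneg fun _ => by positivity),
    ENNReal.ofReal_le_iff_le_toReal hb]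
  linarith

end Energies

/-! ### Traces -/

section Traces

theorem lintegral_strip_fst (h : ℝ) {f : Torus n → ℝ≥0∞} (hf : AEMeasurable f volume) :
    ∫⁻ p in strip n h, f p.1 = ENNReal.ofReal h * ∫⁻ x, f x := by
  have e : strip n h = (univ : Set (Torus n)) ×ˢ Ioo 0 h := by ext p; simp [mem_strip]
  rw [e, restrict_univ_prod]
  have := lintegral_prod_mul (μ := (volume : Measure (Torus n)))
    (ν := volume.restrict (Ioo (0 : ℝ) h)) (f := f) (g := fun _ => 1) hf aemeasurable_const
  simpa [mul_comm] using this

theorem tendsto_div_ofReal {f : ℝ → ℝ≥0∞} {A : ℝ≥0∞} (hA : A ≠ ⊤)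
    (hf : ∀ h, 0 < h → f h ≤ ENNReal.ofReal h * ENNReal.ofReal h ^ (1 / 2 : ℝ) * A) :
    Tendsto (fun h => f h / ENNReal.ofReal h) (𝓝[>] 0) (𝓝 0) := by
  have h1 : Tendsto (fun h : ℝ => ENNReal.ofReal h ^ (1 / 2 : ℝ) * A) (𝓝[>] 0) (𝓝 0) := by
    have h0 : Tendsto (fun h : ℝ => ENNReal.ofReal h) (𝓝[>] 0) (𝓝 0) := by
      have := ENNReal.continuous_ofReal.tendsto 0
      rw [ENNReal.ofReal_zero] at this
      exact this.mono_left nhdsWithin_le_nhds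
    have h2 := ENNReal.Tendsto.mul_const (h0.ennrpow_const (1 / 2)) (b := A) (Or.inr hA)
    rwa [ENNReal.zero_rpow_of_pos (by norm_num), zero_mul] at h2
  refine tendsto_of_tendsto_of_tendsto_of_le_of_le' tendsto_const_nhds h1
    (Eventually.of_forall fun _ => zero_le) ?_
  filter_upwards [self_mem_nhdsWithin] with h hh
  have h0 : ENNReal.ofReal h ≠ 0 := (ENNReal.ofReal_pos.2 hh).ne'
  rw [ENNReal.div_le_iff h0 ENNReal.ofReal_ne_top]
  exact (hf h hh).trans_eq (by ring)

theorem isTraceAbove_iff {u : Cyl n → ℝ} {τ : Torus n → ℝ} : IsTraceAbove u τ ↔ Integrable τ ∧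
    Tendsto (fun h : ℝ => (∫⁻ p in strip n h, ‖u p - τ p.1‖ₑ) / ENNReal.ofReal h)
      (𝓝[>] 0) (𝓝 0) := by
  have e : ∀ h, {p : Cyl n | 0 < p.2 ∧ p.2 < h} = strip n h := fun h => by
    ext p; simp [mem_strip]
  simp only [IsTraceAbove, e]

theorem lintegral_lower_strip (f : Cyl n → ℝ≥0∞) (h : ℝ) :
    ∫⁻ p in {p : Cyl n | -h < p.2 ∧ p.2 < 0}, f p = ∫⁻ p in strip n h, f (p.1, -p.2) := by
  have hmp := measurePreserving_yAff (n := n) (σ := -1) (by norm_num) 0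
  have hc := hmp.setLIntegral_comp_preimage_emb
    (yAffHomeo (n := n) (σ := -1) (by norm_num) 0).measurableEmbedding f
    {p : Cyl n | -h < p.2 ∧ p.2 < 0}
  have e : yAff (-1) 0 ⁻¹' {p : Cyl n | -h < p.2 ∧ p.2 < 0} = strip n h := by
    ext p; simp [yAff, mem_strip, and_comm]
  rw [← hc, e]
  simp [yAff]

theorem isTraceBelow_iff {u : Cyl n → ℝ} {τ : Torus n → ℝ} :
    IsTraceBelow u τ ↔ IsTraceAbove (fun p => u (p.1, -p.2)) τ := by
  simp only [IsTraceBelow, isTraceAbove_iff, lintegral_lower_strip]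

theorem IsTraceAbove.congr {u v : Cyl n → ℝ} {τ : Torus n → ℝ} (h : IsTraceAbove u τ)
    (huv : ∀ p ∈ upperHalf n, u p = v p) : IsTraceAbove v τ := by
  rw [isTraceAbove_iff] at h ⊢
  refine ⟨h.1, h.2.congr fun a => ?_⟩
  congr 1
  exact setLIntegral_congr_fun (measurableSet_strip a) fun p hp => by
    simp only [huv p (strip_subset_upperHalf a hp)]

/-- `τ - τ' - f` does not depend on `y`, so its strip averages equal its full `L¹` norm for every
height. They are bounded by three averages tending to zero. -/
theorem IsTraceAbove.ae_sub_eq {u v : Cyl n → ℝ} {τ τ' f : Torus n → ℝ}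
    (h : IsTraceAbove u τ) (h' : IsTraceAbove v τ')
    (hu : AEStronglyMeasurable u (volume.restrict (upperHalf n)))
    (hv : AEStronglyMeasurable v (volume.restrict (upperHalf n)))
    (hf : AEStronglyMeasurable f volume)
    (huv : Tendsto (fun h : ℝ => (∫⁻ p in strip n h, ‖u p - v p - f p.1‖ₑ) / ENNReal.ofReal h)
      (𝓝[>] 0) (𝓝 0)) : ∀ᵐ x, τ x - τ' x = f x := by
  rw [isTraceAbove_iff] at h h'
  have hfm : AEMeasurable (fun x => ‖τ x - τ' x - f x‖ₑ) volume :=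
    ((h.1.1.sub h'.1.1).sub hf).enorm
  have hb : ∀ᶠ a : ℝ in 𝓝[>] 0, ∫⁻ x, ‖τ x - τ' x - f x‖ₑ ≤
      (∫⁻ p in strip n a, ‖u p - τ p.1‖ₑ) / ENNReal.ofReal a +
      (∫⁻ p in strip n a, ‖v p - τ' p.1‖ₑ) / ENNReal.ofReal a +
      (∫⁻ p in strip n a, ‖u p - v p - f p.1‖ₑ) / ENNReal.ofReal a := by
    filter_upwards [self_mem_nhdsWithin] with a ha
    have h0 : ENNReal.ofReal a ≠ 0 := (ENNReal.ofReal_pos.2 ha).ne'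
    have hle : (volume : Measure (Cyl n)).restrict (strip n a) ≤ volume.restrict (upperHalf n) :=
      Measure.restrict_mono (strip_subset_upperHalf a) le_rfl
    have hm1 : AEMeasurable (fun p => ‖u p - τ p.1‖ₑ) (volume.restrict (strip n a)) :=
      ((hu.mono_measure hle).sub h.1.1.comp_fst.restrict).enorm
    have hm2 : AEMeasurable (fun p => ‖v p - τ' p.1‖ₑ) (volume.restrict (strip n a)) :=
      ((hv.mono_measure hle).sub h'.1.1.comp_fst.restrict).enorm
    rw [← ENNReal.add_div, ← ENNReal.add_div, ENNReal.le_div_iff_mul_le (Or.inl h0)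
      (Or.inl ENNReal.ofReal_ne_top), mul_comm, ← lintegral_strip_fst a hfm]
    calc ∫⁻ p in strip n a, ‖τ p.1 - τ' p.1 - f p.1‖ₑ
        ≤ ∫⁻ p in strip n a, (‖u p - τ p.1‖ₑ + ‖v p - τ' p.1‖ₑ + ‖u p - v p - f p.1‖ₑ) := by
          refine lintegral_mono fun p => ?_
          have e : τ p.1 - τ' p.1 - f p.1 = -(u p - τ p.1) + (v p - τ' p.1) +
              (u p - v p - f p.1) := by ring
          rw [e]
          refine (enorm_add_le _ _).trans (add_le_add ((enorm_add_le _ _).trans ?_) le_rfl)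
          rw [enorm_neg]
      _ = _ := (lintegral_add_left' (hm1.add hm2) _).trans
            (congrArg (· + _) (lintegral_add_left' hm1 _))
  have hlim := (h.2.add h'.2).add huv
  rw [add_zero, add_zero] at hlim
  have hz : ∫⁻ x, ‖τ x - τ' x - f x‖ₑ = 0 := le_antisymm (ge_of_tendsto hlim hb) zero_le
  rw [lintegral_eq_zero_iff' hfm] at hz
  filter_upwards [hz] with x hx
  simpa [sub_eq_zero] using hx

theorem IsTraceAbove.ae_eq {u : Cyl n → ℝ} {τ τ' : Torus n → ℝ}
    (h : IsTraceAbove u τ) (h' : IsTraceAbove u τ')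
    (hu : AEStronglyMeasurable u (volume.restrict (upperHalf n))) : ∀ᵐ x, τ x = τ' x := by
  filter_upwards [h.ae_sub_eq h' hu hu (f := fun _ => 0) aestronglyMeasurable_const
    (by simp)] with x hx
  linarith

/-- The trace is the initial value in the vertical primitive representation; the primitive itself
has `L¹` norm of order `h^{3/2}` on the strip of height `h`. -/
theorem IsH1LocGrad.exists_trace {w : Cyl n → ℝ} {H : Cyl n → EuclideanSpace ℝ (Fin (n + 1))}
    (hw : IsH1LocGrad (cylCover n) (upperHalf n) w H)
    (hH : MemLp H 2 (volume.restrict (upperHalf n))) :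
    ∃ τ : Torus n → ℝ, IsTraceAbove w τ ∧ ∀ᵐ p ∂volume.restrict (upperHalf n),
      w p = τ p.1 + vprim (fun q => H q (Fin.last n)) 0 p := by
  set F : Cyl n → ℝ := fun q => H q (Fin.last n)
  have hF2 : MemLp F 2 (volume.restrict (upperHalf n)) := hH.euclidean_apply _
  -- Extension by zero below makes the derivative integrable near `y = 0`, so the primitive can be
  -- based at height `0`.
  have hFi : ∀ K, IsCompact K → IntegrableOn ((upperHalf n).indicator F) K := fun K hK =>
    integrableOn_of_memLp_two hK
      (((memLp_indicator_iff_restrict measurableSet_upperHalf).2 hF2).restrict K)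
  have hwd : IsWeakPDeriv (Fin.last n) {p : Cyl n | p.2 ∈ Ioi (0 : ℝ)} w
      ((upperHalf n).indicator F) := by
    intro φ hφ
    refine (hw.isWeakPDeriv (Fin.last n) φ hφ).trans (congrArg Neg.neg ?_)
    exact setIntegral_congr_fun measurableSet_upperHalf fun p hp => by
      simp only [indicator_of_mem hp, F]
  obtain ⟨τ, hτm, hτi, hτ⟩ := exists_eq_add_vprim (I := Ioi (0 : ℝ)) isOpen_Ioi ordConnected_Ioi
    (c := 1) (d := 2) (by norm_num) (fun y hy => by rw [mem_Ioi]; linarith [hy.1])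
    hw.integrableOn_fun hFi hwd 0
  have hrep : ∀ᵐ p ∂volume.restrict (upperHalf n), w p = τ p.1 + vprim F 0 p := by
    filter_upwards [hτ, ae_restrict_mem measurableSet_upperHalf] with p hp hpu
    rw [hp]
    congr 1
    refine intervalIntegral.integral_congr_ae (ae_of_all _ fun s hs => ?_)
    rw [uIoc_of_le (le_of_lt hpu)] at hs
    exact indicator_of_mem (show (p.1, s) ∈ upperHalf n from hs.1) _
  refine ⟨τ, isTraceAbove_iff.2 ⟨hτi, tendsto_div_ofReal hF2.2.ne fun h hh => ?_⟩, hrep⟩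
  have hle : (volume : Measure (Cyl n)).restrict (strip n h) ≤ volume.restrict (upperHalf n) :=
    Measure.restrict_mono (strip_subset_upperHalf h) le_rfl
  calc ∫⁻ p in strip n h, ‖w p - τ p.1‖ₑ = ∫⁻ p in strip n h, ‖vprim F 0 p‖ₑ :=
        lintegral_congr_ae (by
          filter_upwards [ae_mono hle hrep] with p hp
          rw [hp, add_sub_cancel_left])
    _ ≤ _ := lintegral_le_sqrt_mul_eLpNorm
        ((aestronglyMeasurable_vprim_upperHalf hF2.1).mono_measure hle)
    _ ≤ _ := by
        rw [Measure.restrict_apply_univ, volume_strip, mul_comm (ENNReal.ofReal h), mul_assoc]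
        gcongr
        exact eLpNorm_strip_vprim_le hF2.1

end Traces

/-! ### Compactness and the liminf inequality -/

section Liminf

variable {g : Torus n → ℝ} {M : ℝ} {ε : ℕ → ℝ}

theorem MemH1.memLp {U : Set (Torus n)} (h : MemH1 (torusCover n) U g) :
    MemLp g 2 (volume.restrict U) := by
  obtain ⟨D, h, -⟩ := h
  exact h

theorem compactness (hg : MemLp g 2 volume) (hM : ∀ᵐ x, |g x| ≤ M)
    (hε_pos : ∀ j, 0 < ε j) (hε_anti : Antitone ε) (hε_lim : Tendsto ε atTop (𝓝 0))
    {u : ℕ → Cyl n → ℝ} {C : ℝ} (hC : ∀ j, energyEps g (ε j) (u j) ≤ ENNReal.ofReal C) :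
    ∃ (k : ℕ → ℕ) (c : ℕ → ℝ) (up um : Cyl n → ℝ), StrictMono k ∧
      MemH1Loc (cylCover n) (upperHalf n) up ∧ MemH1Loc (cylCover n) (upperHalf n) um ∧
      WeakH1LocTendsto (cylCover n) (upperHalf n)
        (fun j p => shiftUp (M * ε (k j)) (u (k j)) p - c j) up ∧
      WeakH1LocTendsto (cylCover n) (upperHalf n)
        (fun j p => shiftDown (M * ε (k j)) (u (k j)) p - c j) um ∧
      L1LocTendsto (upperHalf n) (fun j p => shiftUp (M * ε (k j)) (u (k j)) p - c j) up ∧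
      L1LocTendsto (upperHalf n) (fun j p => shiftDown (M * ε (k j)) (u (k j)) p - c j) um := by
  have hM0 : 0 ≤ M := by
    obtain ⟨x, hx⟩ := hM.exists
    exact (abs_nonneg _).trans hx
  have hlt : ∀ j, energyEps g (ε j) (u j) < ENNReal.ofReal C + 1 := fun j =>
    (hC j).trans_lt (ENNReal.lt_add_right ENNReal.ofReal_ne_top one_ne_zero)
  choose G hG hGC using fun j => exists_grad_of_energyEps_lt (hlt j)
  obtain ⟨k, c, up, um, Hp, Hm, hk, hp, hm, -⟩ := exists_halfTendsto_shift hg hM hM0 hε_pos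
    hε_anti hε_lim hG (ENNReal.mul_ne_top (by simp) (ENNReal.add_ne_top.2
      ⟨ENNReal.ofReal_ne_top, by simp⟩)) hGC
  refine ⟨k, c, up, um, hk, ⟨Hp, hp.isH1LocGrad⟩, ⟨Hm, hm.isH1LocGrad⟩,
    hp.weakH1LocTendsto fun j => ?_, hm.weakH1LocTendsto fun j => ?_, hp.l1, hm.l1⟩
  · exact ((hG (k j)).shiftUp _).sub_const (c j)
  · exact ((hG (k j)).shiftDown _).sub_const (c j)

theorem L1LocTendsto.comp {U : Set (Cyl n)} {v : ℕ → Cyl n → ℝ} {w : Cyl n → ℝ}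
    (h : L1LocTendsto U v w) {k : ℕ → ℕ} (hk : Tendsto k atTop atTop) :
    L1LocTendsto U (fun j => v (k j)) w := fun K hK hKU =>
  ⟨fun j => (h K hK hKU).1 (k j), (h K hK hKU).2.1, (h K hK hKU).2.2.comp hk⟩

theorem L1LocTendsto.tendsto_integral {U K : Set (Cyl n)} {v : ℕ → Cyl n → ℝ} {w : Cyl n → ℝ}
    (h : L1LocTendsto U v w) (hK : IsCompact K) (hKU : K ⊆ U) :
    Tendsto (fun j => ∫ p in K, v j p) atTop (𝓝 (∫ p in K, w p)) :=
  tendsto_integral_of_L1 _ (h K hK hKU).2.1.1 (Eventually.of_forall (h K hK hKU).1) (h K hK hKU).2.2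

/-- The slab `T^n × [1, 2]` has volume `1`, so `c j` is the difference of two convergent integrals
over it. -/
theorem L1LocTendsto.exists_tendsto_const {v : ℕ → Cyl n → ℝ} {w w' : Cyl n → ℝ} {c : ℕ → ℝ}
    (h : L1LocTendsto (upperHalf n) v w') (h' : L1LocTendsto (upperHalf n) (fun j p => v j p - c j) w) :
    ∃ c₀, Tendsto c atTop (𝓝 c₀) := by
  have hS := isCompact_slab (n := n) 1 2
  have hSU := slab_subset_upperHalf (n := n) one_pos 2
  have hv : (volume (slab n 1 2)).toReal = 1 := by rw [volume_slab]; norm_num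
  refine ⟨_, ((h.tendsto_integral hS hSU).sub (h'.tendsto_integral hS hSU)).congr fun j => ?_⟩
  rw [← integral_sub ((h _ hS hSU).1 j) ((h' _ hS hSU).1 j)]
  simp [Measure.real, hv]

theorem L1LocTendsto.ae_eq_add_const {v : ℕ → Cyl n → ℝ} {w w' : Cyl n → ℝ} {c : ℕ → ℝ} {c₀ : ℝ}
    (h : L1LocTendsto (upperHalf n) v w') (h' : L1LocTendsto (upperHalf n) (fun j p => v j p - c j) w)
    (hc : Tendsto c atTop (𝓝 c₀)) : ∀ᵐ p ∂volume.restrict (upperHalf n), w p + c₀ = w' p := by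
  refine ae_restrict_of_forall_isCompact isOpen_upperHalf fun K hK hKU => ?_
  obtain ⟨hi, hi', hl⟩ := h K hK hKU
  obtain ⟨ki, ki', kl⟩ := h' K hK hKU
  have hKf : volume K ≠ ⊤ := hK.measure_ne_top
  have hm1 : ∀ j, AEMeasurable (fun p => ‖v j p - w' p‖ₑ) (volume.restrict K) := fun j =>
    ((hi j).sub hi').1.enorm
  have hm2 : ∀ j, AEMeasurable (fun p => ‖v j p - c j - w p‖ₑ) (volume.restrict K) := fun j =>
    ((ki j).sub ki').1.enorm
  have hb : ∀ j, ∫⁻ p in K, ‖w p + c₀ - w' p‖ₑ ≤ (∫⁻ p in K, ‖v j p - w' p‖ₑ) +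
      (∫⁻ p in K, ‖v j p - c j - w p‖ₑ) + ‖c j - c₀‖ₑ * volume K := by
    intro j
    calc ∫⁻ p in K, ‖w p + c₀ - w' p‖ₑ
        ≤ ∫⁻ p in K, (‖v j p - w' p‖ₑ + ‖v j p - c j - w p‖ₑ + ‖c j - c₀‖ₑ) := by
          refine lintegral_mono fun p => ?_
          have e : w p + c₀ - w' p = (v j p - w' p) + -(v j p - c j - w p) + -(c j - c₀) := by ring
          rw [e]
          refine (enorm_add_le _ _).trans (add_le_add ((enorm_add_le _ _).trans ?_) ?_)
          · rw [enorm_neg]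
          · rw [enorm_neg]
      _ = _ := (lintegral_add_left' ((hm1 j).add (hm2 j)) _).trans (by
          rw [lintegral_const, Measure.restrict_apply_univ]
          exact congrArg (· + _) (lintegral_add_left' (hm1 j) _))
  have hc0 : Tendsto (fun j => ‖c j - c₀‖ₑ * volume K) atTop (𝓝 0) := by
    have h1 := (hc.sub_const c₀).enorm
    rw [sub_self, enorm_zero] at h1
    simpa using ENNReal.Tendsto.mul_const h1 (b := volume K) (Or.inr hKf)
  have hlim := (hl.add kl).add hc0
  rw [add_zero, add_zero] at hlim
  have hz := le_antisymm (ge_of_tendsto' hlim hb) zero_le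
  have hm3 : AEMeasurable (fun p => ‖w p + c₀ - w' p‖ₑ) (volume.restrict K) :=
    ((ki'.1.add aestronglyMeasurable_const).sub hi'.1).enorm
  rw [lintegral_eq_zero_iff' hm3] at hz
  filter_upwards [hz] with p hp
  simpa [sub_eq_zero] using hp

theorem lintegral_slitCyl_glueGrad (Hp Hm : Cyl n → EuclideanSpace ℝ (Fin (n + 1))) :
    ∫⁻ p in slitCyl n, ‖glueGrad Hp Hm p‖ₑ ^ 2 =
      (∫⁻ p in upperHalf n, ‖Hp p‖ₑ ^ 2) + ∫⁻ p in upperHalf n, ‖Hm p‖ₑ ^ 2 := by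
  rw [slitCyl_eq_union, lintegral_union isOpen_lowerHalf.measurableSet disjoint_upperHalf_lowerHalf]
  congr 1
  · refine setLIntegral_congr_fun measurableSet_upperHalf fun p hp => ?_
    have hp' : 0 < p.2 := hp
    simp [glueGrad, hp']
  · have hmp := measurePreserving_yAff (n := n) (σ := -1) (by norm_num) 0
    have hc := hmp.setLIntegral_comp_preimage_emb
      (yAffHomeo (n := n) (σ := -1) (by norm_num) 0).measurableEmbedding
      (fun p => ‖glueGrad Hp Hm p‖ₑ ^ 2) (lowerHalf n)
    have e : yAff (-1) 0 ⁻¹' lowerHalf n = upperHalf n := by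
      ext p; simp [yAff, lowerHalf, upperHalf]
    rw [← hc, e]
    refine setLIntegral_congr_fun measurableSet_upperHalf fun p hp => ?_
    have hp' : ¬ 0 < -p.2 := by have : 0 < p.2 := hp; linarith
    have e1 : ‖scaleLast (-1) (Hm p)‖ = ‖Hm p‖ := norm_scaleLast (by norm_num) _
    have e2 : ‖scaleLast (-1) (Hm p)‖ₑ = ‖Hm p‖ₑ := by rw [← ofReal_norm, e1, ofReal_norm]
    simp [glueGrad, yAff, hp', e2]

theorem hasJump_glue {up um : Cyl n → ℝ} {Hp Hm : Cyl n → EuclideanSpace ℝ (Fin (n + 1))}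
    (hp : IsH1LocGrad (cylCover n) (upperHalf n) up Hp)
    (hm : IsH1LocGrad (cylCover n) (upperHalf n) um Hm)
    (hHp : MemLp Hp 2 (volume.restrict (upperHalf n)))
    (hHm : MemLp Hm 2 (volume.restrict (upperHalf n))) (hg : AEStronglyMeasurable g volume)
    (hj : Tendsto (fun h : ℝ => (∫⁻ p in strip n h, ‖up p - um p - g p.1‖ₑ) / ENNReal.ofReal h)
      (𝓝[>] 0) (𝓝 0)) : HasJump (glue up um) g := by
  obtain ⟨τp, hτp, -⟩ := hp.exists_trace hHp
  obtain ⟨τm, hτm, -⟩ := hm.exists_trace hHm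
  refine ⟨τp, τm, hτp.congr fun p hp' => ?_, isTraceBelow_iff.2 (hτm.congr fun p hp' => ?_),
    hτp.ae_sub_eq hτm (hp.aestronglyMeasurable_fun isOpen_upperHalf)
      (hm.aestronglyMeasurable_fun isOpen_upperHalf) hg hj⟩
  · have : 0 < p.2 := hp'
    simp [glue, this]
  · have h0 : 0 < p.2 := hp'
    have : ¬ 0 < -p.2 := by linarith
    simp [glue, this]

/-- It suffices to bound the limit energy by each finite `b` above the liminf. Such a `b` bounds the
energies along a subsequence, to which compactness applies. Its limits agree with `up` and `um` up
to one common constant, which changes neither gradients nor jump. -/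
theorem energyLimit_glue_le (hg : MemLp g 2 volume) (hM : ∀ᵐ x, |g x| ≤ M)
    (hε_pos : ∀ j, 0 < ε j) (hε_anti : Antitone ε) (hε_lim : Tendsto ε atTop (𝓝 0))
    {u : ℕ → Cyl n → ℝ} {up um : Cyl n → ℝ}
    (hup : L1LocTendsto (upperHalf n) (fun j => shiftUp (M * ε j) (u j)) up)
    (hum : L1LocTendsto (upperHalf n) (fun j => shiftDown (M * ε j) (u j)) um) :
    energyLimit g (glue up um) ≤ liminf (fun j => energyEps g (ε j) (u j)) atTop := by
  have hM0 : 0 ≤ M := by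
    obtain ⟨x, hx⟩ := hM.exists
    exact (abs_nonneg _).trans hx
  refine le_of_forall_gt_imp_ge_of_dense fun b hb => ?_
  rcases eq_or_ne b ⊤ with rfl | hbt
  · exact le_top
  obtain ⟨φ, hφ, hφb⟩ := extraction_of_frequently_atTop (frequently_lt_of_liminf_lt (by isBoundedDefault) hb)
  choose G hG hGC using fun j => exists_grad_of_energyEps_lt (hφb j)
  have h2b : 2 * b ≠ ⊤ := ENNReal.mul_ne_top (by simp) hbt
  obtain ⟨k, c, wp, wm, Hp, Hm, hk, hp, hm, A, hA, hjump⟩ := exists_halfTendsto_shift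
    (ε := fun j => ε (φ j)) hg hM hM0 (fun j => hε_pos _) (hε_anti.comp_monotone hφ.monotone)
    (hε_lim.comp hφ.tendsto_atTop) hG h2b hGC
  have hφk : Tendsto (fun j => φ (k j)) atTop atTop := (hφ.comp hk).tendsto_atTop
  have hup' := hup.comp hφk
  have hum' := hum.comp hφk
  -- Convergence of the unnormalised functions forces the subtracted constants to converge.
  obtain ⟨c₀, hc₀⟩ := hup'.exists_tendsto_const hp.l1
  have ep := hup'.ae_eq_add_const hp.l1 hc₀
  have em := hum'.ae_eq_add_const hm.l1 hc₀
  have hpH : IsH1LocGrad (cylCover n) (upperHalf n) up Hp := (hp.isH1LocGrad.sub_const (-c₀)).congr_ae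
    (ep.mono fun p h => by rw [sub_neg_eq_add, h]) (ae_of_all _ fun _ => rfl)
  have hmH : IsH1LocGrad (cylCover n) (upperHalf n) um Hm := (hm.isH1LocGrad.sub_const (-c₀)).congr_ae
    (em.mono fun p h => by rw [sub_neg_eq_add, h]) (ae_of_all _ fun _ => rfl)
  have hj : Tendsto (fun h : ℝ => (∫⁻ p in strip n h, ‖up p - um p - g p.1‖ₑ) / ENNReal.ofReal h)
      (𝓝[>] 0) (𝓝 0) := by
    refine tendsto_div_ofReal hA fun h hh => le_trans (le_of_eq ?_) (hjump h hh)
    refine lintegral_congr_ae (ae_mono (Measure.restrict_mono (strip_subset_upperHalf h) le_rfl) ?_)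
    filter_upwards [ep, em] with p h1 h2
    rw [← h1, ← h2]
    congr 1; ring
  have hle := hp.two_mul_lintegral_le hm
    (fun j => ((hG (k j)).shiftUp _).aestronglyMeasurable_grad isOpen_upperHalf)
    (fun j => ((hG (k j)).shiftDown _).aestronglyMeasurable_grad isOpen_upperHalf) h2b
    (fun j => (lintegral_gradUp_add_gradDown_le hM hM0 (hε_pos _)).trans (hGC (k j)))
  refine (iInf₂_le_of_le (glueGrad Hp Hm) (hpH.glue hmH)
    (iInf_le _ (hasJump_glue hpH hmH hp.memLp hm.memLp hg.1 hj))).trans ?_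
  rw [lintegral_ofReal_half_sq, lintegral_slitCyl_glueGrad]
  calc _ ≤ 2⁻¹ * (2 * b) := by gcongr
    _ = b := by rw [← mul_assoc, ENNReal.inv_mul_cancel (by simp) (by simp), one_mul]

end Liminf

/-! ### Difference quotients -/

section DifferenceQuotients

theorem tendsto_lintegral_translate {F : Cyl n → ℝ} (hF : Integrable F) (i : Fin (n + 1)) :
    Tendsto (fun s => ∫⁻ p, ‖F (p + dirVec i s) - F p‖ₑ) (𝓝 0) (𝓝 0) := by
  let T : C(ℝ, C(Cyl n, Cyl n)) := (ContinuousMap.mk (fun q : ℝ × Cyl n => q.2 + dirVec i q.1)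
    (continuous_snd.add ((continuous_dirVec i).comp continuous_fst))).curry
  have hT : ∀ s, MeasurePreserving (T s) (volume : Measure (Cyl n)) volume := fun s =>
    measurePreserving_add_const (dirVec i s)
  have hF1 : MemLp F 1 volume := memLp_one_iff_integrable.2 hF
  have h := (Continuous.compMeasurePreservingLp (μ := (volume : Measure (Cyl n)))
    (f := fun _ : ℝ => hF1.toLp F) continuous_const T.continuous hT (by simp)).tendsto 0
  rw [tendsto_iff_edist_tendsto_0] at h
  refine h.congr fun s => ?_
  rw [Lp.edist_def, eLpNorm_one_eq_lintegral_enorm]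
  refine lintegral_congr_ae ?_
  filter_upwards [Lp.coeFn_compMeasurePreserving (hF1.toLp F) (hT s),
    Lp.coeFn_compMeasurePreserving (hF1.toLp F) (hT 0), hF1.coeFn_toLp,
    (hT s).quasiMeasurePreserving.ae hF1.coeFn_toLp,
    (hT 0).quasiMeasurePreserving.ae hF1.coeFn_toLp] with p h1 h2 h3 h4 h5
  rw [Pi.sub_apply, h1, h2, Function.comp_apply, Function.comp_apply, h4, h5]
  simp [T, dirVec_zero]

/-- The quotient is the mean of the translates `F(· + s eᵢ)` over `s ∈ (0, t]`, and translation is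
continuous in `L¹`. -/
theorem tendsto_lintegral_differenceQuotient {u F : Cyl n → ℝ} (hF : Integrable F)
    (i : Fin (n + 1)) (h : ∀ t, 0 < t → ∀ᵐ p, u (p + dirVec i t) - u p =
      ∫ s in (0 : ℝ)..t, F (p + dirVec i s)) :
    Tendsto (fun t => ∫⁻ p, ‖t⁻¹ * (u (p + dirVec i t) - u p) - F p‖ₑ) (𝓝[>] 0) (𝓝 0) := by
  rw [ENNReal.tendsto_nhds_zero]
  intro η hη
  obtain ⟨δ, δ0, hδ⟩ := Metric.eventually_nhds_iff.1
    ((ENNReal.tendsto_nhds_zero.1 (tendsto_lintegral_translate hF i)) η hη)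
  filter_upwards [Ioo_mem_nhdsGT δ0] with t ht
  have ht0 : 0 < t := ht.1
  have hi := integrable_comp_add_dirVec hF i (volume.restrict (Ioc 0 t))
  have hslice : ∀ᵐ p : Cyl n, Integrable (fun s => F (p + dirVec i s)) (volume.restrict (Ioc 0 t)) :=
    hi.prod_left_ae
  have hm : AEMeasurable (Function.uncurry fun (p : Cyl n) s => ‖F (p + dirVec i s) - F p‖ₑ)
      (volume.prod (volume.restrict (Ioc 0 t))) := by
    refine (AEStronglyMeasurable.sub ?_ hF.1.comp_fst).enorm
    exact hi.1.prod_swap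
  calc ∫⁻ p, ‖t⁻¹ * (u (p + dirVec i t) - u p) - F p‖ₑ
      ≤ ∫⁻ p, ENNReal.ofReal t⁻¹ * ∫⁻ s in Ioc 0 t, ‖F (p + dirVec i s) - F p‖ₑ := by
        refine lintegral_mono_ae ?_
        filter_upwards [h t ht0, hslice] with p hp hps
        have e : t⁻¹ * (u (p + dirVec i t) - u p) - F p =
            t⁻¹ * ∫ s in Ioc 0 t, (F (p + dirVec i s) - F p) := by
          rw [integral_sub hps (integrable_const _), hp, intervalIntegral.integral_of_le ht0.le]
          simp [ht0.le]
          field_simp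
        rw [e, enorm_mul, Real.enorm_of_nonneg (inv_nonneg.2 ht0.le)]
        gcongr
        exact enorm_integral_le_lintegral_enorm _
    _ = ENNReal.ofReal t⁻¹ * ∫⁻ p, ∫⁻ s in Ioc 0 t, ‖F (p + dirVec i s) - F p‖ₑ :=
        lintegral_const_mul' _ _ ENNReal.ofReal_ne_top
    _ = ENNReal.ofReal t⁻¹ * ∫⁻ s in Ioc 0 t, ∫⁻ p, ‖F (p + dirVec i s) - F p‖ₑ := by
        rw [lintegral_lintegral_swap hm]
    _ ≤ ENNReal.ofReal t⁻¹ * ∫⁻ _s in Ioc 0 t, η := by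
        refine mul_le_mul_right (setLIntegral_mono' measurableSet_Ioc fun s hs => hδ ?_) _
        rw [Real.dist_eq, sub_zero, abs_of_pos hs.1]
        exact hs.2.trans_lt ht.2
    _ = η := by
        rw [lintegral_const, Measure.restrict_apply_univ, Real.volume_Ioc, sub_zero, mul_comm η,
          ← mul_assoc, ← ENNReal.ofReal_mul (inv_nonneg.2 ht0.le), inv_mul_cancel₀ ht0.ne',
          ENNReal.ofReal_one, one_mul]

/-- The derivative of `s ↦ min 0 s` at `s` in the direction `d`. -/
def minSlope (s d : ℝ) : ℝ := if s < 0 then d else if s = 0 then min 0 d else 0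

theorem abs_minSlope_le (s d : ℝ) : |minSlope s d| ≤ |d| := by
  unfold minSlope
  split_ifs
  · exact le_rfl
  · rcases le_total 0 d with h | h
    · simp [h]
    · simp [h]
  · simp

theorem abs_min_zero_sub_le (s t : ℝ) : |min 0 s - min 0 t| ≤ |s - t| := by
  simpa using abs_min_sub_min_le_max 0 s 0 t

/-- For `t ↓ 0` the quotient converges at every `s`, the kink included. The chain rule therefore
needs no statement about the gradient of `g` on level sets. -/
theorem tendsto_minSlope (s d : ℝ) :
    Tendsto (fun t : ℝ => t⁻¹ * (min 0 (s + t * d) - min 0 s)) (𝓝[>] 0) (𝓝 (minSlope s d)) := by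
  have hc : Tendsto (fun t : ℝ => s + t * d) (𝓝[>] 0) (𝓝 s) := by
    have : Tendsto (fun t : ℝ => s + t * d) (𝓝 0) (𝓝 (s + 0 * d)) :=
      (by fun_prop : Continuous fun t : ℝ => s + t * d).tendsto 0
    rw [zero_mul, add_zero] at this
    exact this.mono_left nhdsWithin_le_nhds
  refine tendsto_const_nhds.congr' ?_
  rcases lt_trichotomy s 0 with h | h | h
  · filter_upwards [hc.eventually_lt_const h, self_mem_nhdsWithin] with t h1 (ht : 0 < t)
    rw [min_eq_right h1.le, min_eq_right h.le, minSlope, if_pos h]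
    field_simp
    ring
  · filter_upwards [self_mem_nhdsWithin] with t (ht : 0 < t)
    subst h
    rw [minSlope, if_neg (lt_irrefl _), if_pos rfl, zero_add, min_self, sub_zero,
      mul_min_of_nonneg _ _ (inv_nonneg.2 ht.le), mul_zero, inv_mul_cancel_left₀ ht.ne']
  · filter_upwards [hc.eventually_const_lt h] with t h1
    rw [min_eq_left h1.le, min_eq_left h.le, minSlope, if_neg h.not_gt, if_neg h.ne']
    simp

theorem aemeasurable_minSlope {α : Type*} [MeasurableSpace α] {μ : Measure α} {s d : α → ℝ}
    (hs : AEMeasurable s μ) (hd : AEMeasurable d μ) :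
    AEMeasurable (fun x => minSlope (s x) (d x)) μ := by
  have h : Measurable fun q : ℝ × ℝ => minSlope q.1 q.2 := by
    refine Measurable.ite (measurableSet_lt measurable_fst measurable_const) measurable_snd
      (Measurable.ite ?_ (measurable_const.min measurable_snd) measurable_const)
    exact measurable_fst (measurableSet_singleton 0)
  exact h.comp_aemeasurable (hs.prodMk hd)

/-- The chain rule for `min` in a horizontal direction. -/
theorem isWeakPDeriv_min_fst {g : Torus n → ℝ} {D : Torus n → EuclideanSpace ℝ (Fin n)}
    (hg : Integrable g) (hD : ∀ k, Integrable (fun x => D x k))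
    (h : IsWeakGrad (torusCover n) univ g D) {a b : ℝ → ℝ} (ha : Continuous a) (hb : Continuous b)
    (k : Fin n) : IsWeakPDeriv k.castSucc univ
      (fun p : Cyl n => min (a p.2) (g p.1 + b p.2))
      (fun p => minSlope (g p.1 + b p.2 - a p.2) (D p.1 k)) := by
  set i : Fin (n + 1) := k.castSucc
  set S : Cyl n → ℝ := fun p => g p.1 + b p.2 - a p.2
  have hfst : ∀ f : Torus n → ℝ, Integrable f → ∀ K : Set (Cyl n), IsCompact K →
      IntegrableOn (fun p : Cyl n => f p.1) K := fun f hf K hK => by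
    obtain ⟨R, -, hR⟩ := exists_subset_slab hK
    have e : slab n (-R) R = (univ : Set (Torus n)) ×ˢ Icc (-R) R := by
      ext p; simp [mem_slab]
    refine IntegrableOn.mono_set ?_ hR
    rw [IntegrableOn, e, restrict_univ_prod]
    exact hf.comp_fst _
  have hdir : ∀ (p : Cyl n) (t : ℝ), (p + dirVec i t).2 = p.2 := fun p t => by simp [i]
  have hsnd : ∀ f : ℝ → ℝ, Continuous f → ∀ K : Set (Cyl n), IsCompact K →
      IntegrableOn (fun p : Cyl n => f p.2) K := fun f hf K hK =>
    (hf.comp continuous_snd).continuousOn.integrableOn_compact hK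
  refine isWeakPDeriv_of_tendsto i (fun K hK => ?_) fun φ hφ => ?_
  · exact (hsnd a ha K hK).inf ((hfst g hg K hK).add (hsnd b hb K hK))
  obtain ⟨C, C0, hC⟩ := hφ.exists_bound
  obtain ⟨R, -, hR⟩ := exists_subset_slab hφ.hasCompactSupport.isCompact
  -- A slab is invariant under horizontal translations, so cutting off to it gives global
  -- integrability and commutes with the difference quotients.
  set A := slab n (-R) R
  have hA : IsCompact A := isCompact_slab _ _
  have hφ0 : ∀ p, p ∉ A → φ p = 0 := fun p hp => image_eq_zero_of_notMem_tsupport fun h' => hp (hR h')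
  set F : Cyl n → ℝ := A.indicator fun p => D p.1 k
  have hF : Integrable F :=
    (integrable_indicator_iff hA.measurableSet).2 (hfst _ (hD k) A hA)
  have hFφ : Integrable (fun p => |F p| * |φ p|) := by
    refine hF.abs.mul_bdd (c := C) hφ.continuous.abs.aestronglyMeasurable (ae_of_all _ fun p => ?_)
    rw [Real.norm_eq_abs, abs_abs]
    exact hC p
  have hAdir : ∀ (p : Cyl n) (t : ℝ), p + dirVec i t ∈ A ↔ p ∈ A := fun p t => by
    simp only [A, mem_slab, hdir]
  have htr := tendsto_lintegral_differenceQuotient (u := A.indicator fun p => g p.1) hF i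
    fun t ht => by
      have h1 := translate_ae (V := univ) (U := univ) isOpen_univ i ht.le (by simp)
        (fun K hK _ => hfst g hg K hK) (fun K hK _ => hfst _ (hD k) K hK)
        (isWeakPDeriv_fst hg hD h k)
      rw [Measure.restrict_univ] at h1
      filter_upwards [h1] with p hp
      by_cases hpA : p ∈ A
      · simp only [F, indicator_of_mem hpA, indicator_of_mem ((hAdir p _).2 hpA), hp]
      · simp only [F, indicator_of_notMem hpA, indicator_of_notMem (mt (hAdir p _).1 hpA),
          sub_self, intervalIntegral.integral_zero]
  have hgm : AEStronglyMeasurable (fun p : Cyl n => g p.1) volume := hg.1.comp_fst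
  have hDm : AEStronglyMeasurable (fun p : Cyl n => D p.1 k) volume := (hD k).1.comp_fst
  have hSm : AEStronglyMeasurable S volume :=
    (hgm.add (hb.comp continuous_snd).aestronglyMeasurable).sub
      (ha.comp continuous_snd).aestronglyMeasurable
  -- `Q` is the difference quotient with the increment of `g` replaced by its linearisation `t D`.
  -- It converges by dominated convergence, and since `min 0` is 1-Lipschitz its distance to the
  -- true quotient `P` is controlled by the `L¹` error of the difference quotients of `g`.
  set Q : ℝ → Cyl n → ℝ := fun t p => t⁻¹ * (min 0 (S p + t * D p.1 k) - min 0 (S p)) * φ p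
  have hQm : ∀ t, AEStronglyMeasurable (Q t) volume := fun t =>
    (((aestronglyMeasurable_const.inf (hSm.add (hDm.const_mul t))).sub
      (aestronglyMeasurable_const.inf hSm)).const_mul _).mul hφ.continuous.aestronglyMeasurable
  have hQb : ∀ t, 0 < t → ∀ p, ‖Q t p‖ ≤ |F p| * |φ p| := fun t ht p => by
    by_cases hp : p ∈ A
    · rw [norm_mul, Real.norm_eq_abs, Real.norm_eq_abs, abs_mul, abs_of_pos (inv_pos.2 ht)]
      gcongr
      rw [show F p = D p.1 k from indicator_of_mem hp _, inv_mul_le_iff₀ ht]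
      refine (abs_min_zero_sub_le _ _).trans_eq ?_
      rw [add_sub_cancel_left, abs_mul, abs_of_pos ht]
    · simp [Q, hφ0 p hp]
  have hQlim : Tendsto (fun t => ∫ p, Q t p) (𝓝[>] 0)
      (𝓝 (∫ p, minSlope (S p) (D p.1 k) * φ p)) := by
    refine tendsto_integral_filter_of_dominated_convergence _ (Eventually.of_forall hQm) ?_ hFφ
      (ae_of_all _ fun p => (tendsto_minSlope _ _).mul_const _)
    filter_upwards [self_mem_nhdsWithin] with t ht
    exact ae_of_all _ (hQb t ht)
  set P : ℝ → Cyl n → ℝ := fun t p =>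
    t⁻¹ * (min (a (p + dirVec i t).2) (g (p + dirVec i t).1 + b (p + dirVec i t).2) -
      min (a p.2) (g p.1 + b p.2)) * φ p
  have hPe : ∀ t p, P t p = t⁻¹ * (min 0 (S p + (g (p + dirVec i t).1 - g p.1)) -
      min 0 (S p)) * φ p := fun t p => by
    have e : ∀ x y : ℝ, min x y = x + min 0 (y - x) := fun x y => by
      rw [← min_add_add_left]; simp
    simp only [P, hdir, S]
    rw [e (a p.2), e (a p.2) (g p.1 + b p.2)]
    ring_nf
  have hdiff : ∀ t, 0 < t → ∀ p, ‖P t p - Q t p‖ₑ ≤ ENNReal.ofReal C *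
      ‖t⁻¹ * (A.indicator (fun p => g p.1) (p + dirVec i t) - A.indicator (fun p => g p.1) p) -
        F p‖ₑ := fun t ht p => by
    by_cases hp : p ∈ A
    · rw [indicator_of_mem hp, indicator_of_mem ((hAdir p t).2 hp),
        show F p = D p.1 k from indicator_of_mem hp _, hPe]
      simp only [Q]
      rw [← sub_mul, ← mul_sub, sub_sub_sub_cancel_right, enorm_mul, mul_comm,
        ← ofReal_norm (φ p)]
      gcongr
      · exact hC p
      · rw [← ofReal_norm, ← ofReal_norm]
        gcongr
        rw [norm_mul, Real.norm_eq_abs, Real.norm_eq_abs]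
        refine (mul_le_mul_of_nonneg_left (abs_min_zero_sub_le _ _) (abs_nonneg _)).trans_eq ?_
        rw [← abs_mul, Real.norm_eq_abs]
        congr 1
        field_simp
        ring
    · simp [P, Q, hφ0 p hp]
  have hPm : ∀ t, AEStronglyMeasurable (P t) volume := fun t => by
    have hg' : AEStronglyMeasurable (fun p : Cyl n => g (p + dirVec i t).1) volume :=
      hgm.comp_measurePreserving (measurePreserving_add_const (dirVec i t))
    refine AEStronglyMeasurable.congr ?_ (ae_of_all _ fun p => (hPe t p).symm)
    exact (((aestronglyMeasurable_const.inf (hSm.add (hg'.sub hgm))).sub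
      (aestronglyMeasurable_const.inf hSm)).const_mul _).mul hφ.continuous.aestronglyMeasurable
  have hPQ : Tendsto (fun t => ∫⁻ p, ‖P t p - Q t p‖ₑ) (𝓝[>] 0) (𝓝 0) := by
    have h1 := ENNReal.Tendsto.const_mul htr (a := ENNReal.ofReal C) (Or.inr ENNReal.ofReal_ne_top)
    rw [mul_zero] at h1
    refine tendsto_of_tendsto_of_tendsto_of_le_of_le' tendsto_const_nhds h1
      (Eventually.of_forall fun _ => zero_le) ?_
    filter_upwards [self_mem_nhdsWithin] with t ht
    rw [← lintegral_const_mul' _ _ ENNReal.ofReal_ne_top]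
    exact lintegral_mono (hdiff t ht)
  have hsub : Tendsto (fun t => ∫ p, (P t p - Q t p)) (𝓝[>] 0) (𝓝 0) := by
    rw [tendsto_zero_iff_enorm_tendsto_zero]
    exact tendsto_of_tendsto_of_tendsto_of_le_of_le tendsto_const_nhds hPQ
      (fun _ => zero_le) fun t => enorm_integral_le_lintegral_enorm _
  have hsum := hsub.add hQlim
  rw [zero_add] at hsum
  refine hsum.congr' ?_
  have hfin : ∀ᶠ t in 𝓝[>] 0, ∫⁻ p, ‖P t p - Q t p‖ₑ < ⊤ := hPQ.eventually_lt_const (by simp)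
  filter_upwards [hfin, self_mem_nhdsWithin] with t h1 ht
  have hi1 : Integrable (fun p => P t p - Q t p) := ⟨(hPm t).sub (hQm t), h1⟩
  have hi2 : Integrable (Q t) := hFφ.mono' (hQm t) (ae_of_all _ (hQb t ht))
  rw [← integral_add hi1 hi2]
  simp only [sub_add_cancel, P]

end DifferenceQuotients

/-! ### Ingredients of the recovery sequence -/

section Recovery

theorem add_dirVec_last (p : Cyl n) (t : ℝ) : p + dirVec (Fin.last n) t = (p.1, p.2 + t) := by
  rw [dirVec_last]; ext1 <;> simp

/-- On a slab, a vertical shift by `δ` costs at most `δ` times the local `L²` norm of the vertical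
derivative, so no global energy bound is needed. -/
theorem l1LocTendsto_shift {w : Cyl n → ℝ} {H : Cyl n → EuclideanSpace ℝ (Fin (n + 1))}
    (hw : IsH1LocGrad (cylCover n) (upperHalf n) w H) {δ : ℕ → ℝ} (hδ0 : ∀ j, 0 ≤ δ j)
    (hδ : Tendsto δ atTop (𝓝 0)) :
    L1LocTendsto (upperHalf n) (fun j p => w (p.1, p.2 + δ j)) w := by
  intro K hK hKU
  obtain ⟨a, R, ha, -, hKs⟩ := exists_subset_slab_of_upperHalf hK hKU
  have hs : ∀ j, IsH1LocGrad (cylCover n) (upperHalf n) (fun p => w (p.1, p.2 + δ j))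
      (fun p => scaleLast 1 (H (yAff 1 (δ j) p))) := fun j => by
    have := hw.comp_yAff (V := upperHalf n) (σ := 1) (by norm_num) (δ j) fun p hp => by
      have h0 : 0 < p.2 := hp
      have h1 := hδ0 j
      simp only [yAff, upperHalf, mem_ofPred_eq]
      linarith
    simpa [yAff] using this
  have hm := hw.aestronglyMeasurable_fun isOpen_upperHalf
  have hle : (volume : Measure (Cyl n)).restrict (slab n a R) ≤ volume.restrict (upperHalf n) :=
    Measure.restrict_mono (slab_subset_upperHalf ha R) le_rfl
  refine ⟨fun j => (hs j).integrableOn_fun K hK hKU, hw.integrableOn_fun K hK hKU, ?_⟩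
  set W := slab n a (R + 1)
  have hW := hw.memLp_grad_apply (Fin.last n) W (isCompact_slab _ _) (slab_subset_upperHalf ha _)
  set X := eLpNorm (fun p => H p (Fin.last n)) 2 (volume.restrict W)
  have hlim : Tendsto (fun j => ENNReal.ofReal (R - a) ^ (1 / 2 : ℝ) * (ENNReal.ofReal (δ j) * X))
      atTop (𝓝 0) := by
    have h1 := ENNReal.tendsto_ofReal hδ
    rw [ENNReal.ofReal_zero] at h1
    have h2 := ENNReal.Tendsto.const_mul (a := ENNReal.ofReal (R - a) ^ (1 / 2 : ℝ))
      (ENNReal.Tendsto.mul_const h1 (b := X) (Or.inr hW.2.ne))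
      (Or.inr (ENNReal.rpow_ne_top_of_nonneg (by norm_num) ENNReal.ofReal_ne_top))
    simpa using h2
  refine tendsto_of_tendsto_of_tendsto_of_le_of_le' tendsto_const_nhds hlim
    (Eventually.of_forall fun _ => zero_le) ?_
  filter_upwards [hδ.eventually_le_const one_pos] with j hj
  refine (lintegral_mono_set hKs).trans ((lintegral_le_sqrt_mul_eLpNorm
    ((((hs j).aestronglyMeasurable_fun isOpen_upperHalf).sub hm).mono_measure hle)).trans ?_)
  rw [Measure.restrict_apply_univ, volume_slab]
  gcongr
  have htr := translate_ae isOpen_upperHalf (Fin.last n) (hδ0 j)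
    (fun p hp s hs => add_mem_upperHalf hp (dirVec_snd_nonneg _ hs.1)) hw.integrableOn_fun
    (hw.integrableOn_grad _) (hw.isWeakPDeriv (Fin.last n))
  have hsq := lintegral_translate_sq_le (measurableSet_slab a R) (measurableSet_slab a (R + 1))
    (Fin.last n) (hδ0 j) (fun p hp s hs => by
      rw [add_dirVec_last]
      have h1 := mem_slab.1 hp
      exact mem_slab.2 ⟨by linarith [hs.1], by linarith [hs.2]⟩) hW.1 (ae_mono hle htr)
  rw [eLpNorm_two_le_iff, mul_pow, eLpNorm_two_sq]
  simpa only [add_dirVec_last, Pi.sub_apply] using hsq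

/-- The profile that carries the transformation strain. -/
def profile (g : Torus n → ℝ) (e : ℝ) (p : Cyl n) : ℝ :=
  min (max p.2 0 / e) (g p.1 + max (-p.2) 0 / e)

/-- The recovery sequence. -/
def recovery (g : Torus n → ℝ) (e : ℝ) (u : Cyl n → ℝ) (p : Cyl n) : ℝ :=
  u p - (if 0 < p.2 then g p.1 else 0) + profile g e p

variable {g : Torus n → ℝ} {M e : ℝ} {u : Cyl n → ℝ}

/-- Above the layer the profile equals `g` and cancels the subtraction; below it the profile is
zero. -/
theorem recovery_eq (he : 0 < e) {p : Cyl n} (hx : |g p.1| ≤ M) (hp : M * e ≤ |p.2|) :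
    recovery g e u p = u p := by
  have h1 := (abs_le.1 hx).1
  have h2 := (abs_le.1 hx).2
  unfold recovery profile
  split_ifs with h
  · rw [abs_of_pos h] at hp
    rw [max_eq_left h.le, max_eq_right (by linarith), zero_div, add_zero, min_eq_right]
    · ring
    · exact h2.trans ((le_div_iff₀ he).2 hp)
  · rw [abs_of_nonpos (not_lt.1 h)] at hp
    rw [max_eq_right (not_lt.1 h), max_eq_left (by linarith), zero_div, min_eq_left]
    · ring
    · have := (le_div_iff₀ he).2 hp
      linarith

/-- For fixed `x` the profile is continuous and piecewise affine in `y`, with kinks at most at `0`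
and `e g(x)`. The four cases are the slopes `0, -1/e, 1/e, 0`, and two exceptional points do not
affect the fundamental theorem. -/
theorem integral_strainLast_eq_profile (he : 0 < e) (x : Torus n) (y y' : ℝ) :
    ∫ s in y..y', e⁻¹ * strainLast (fun x => e * g x) (x, s) =
      profile g e (x, y') - profile g e (x, y) := by
  refine integral_eq_of_hasDerivAt_off_countable (fun s => profile g e (x, s)) _
    (s := {0, e * g x}) (Set.toFinite _).countable ?_ ?_
    ((intervalIntegrable_strainLast _ _ _ _).const_mul _)
  · refine Continuous.continuousOn ?_
    exact (by fun_prop : Continuous fun s : ℝ => min (max s 0 / e) (g x + max (-s) 0 / e))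
  · rintro s ⟨-, hs⟩
    simp only [mem_insert_iff, mem_singleton_iff, not_or] at hs
    rcases lt_or_gt_of_ne hs.1 with h0 | h0 <;> rcases lt_or_gt_of_ne hs.2 with h1 | h1
    · have hst : strainLast (fun x => e * g x) (x, s) = 0 := by
        simp [strainLast, h0.le, h1.le]
      rw [hst, mul_zero]
      refine (hasDerivAt_const s (0 : ℝ)).congr_of_eventuallyEq ?_
      filter_upwards [eventually_lt_nhds h0, eventually_lt_nhds h1] with r h2 h3
      simp only [profile]
      rw [max_eq_right h2.le, max_eq_left (by linarith), zero_div, min_eq_left]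
      have : r / e ≤ g x := (div_le_iff₀ he).2 (by linarith)
      rw [neg_div]; linarith
    · have hst : strainLast (fun x => e * g x) (x, s) = -1 := by
        simp [strainLast, h0.le, not_le.2 h1]
      rw [hst]
      have hd : HasDerivAt (fun r : ℝ => g x + -r / e) (e⁻¹ * -1) s := by
        have := ((hasDerivAt_id' s).neg.div_const e).const_add (g x)
        rwa [div_eq_inv_mul] at this
      refine hd.congr_of_eventuallyEq ?_
      filter_upwards [eventually_lt_nhds h0, eventually_gt_nhds h1] with r h2 h3
      simp only [profile]
      rw [max_eq_right h2.le, max_eq_left (by linarith), zero_div, min_eq_right]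
      have : g x ≤ r / e := (le_div_iff₀ he).2 (by linarith)
      rw [neg_div]; linarith
    · have hst : strainLast (fun x => e * g x) (x, s) = 1 := by
        simp [strainLast, h0, h1.le]
      rw [hst]
      have hd : HasDerivAt (fun r : ℝ => r / e) (e⁻¹ * 1) s := by
        have := (hasDerivAt_id' s).div_const e
        rwa [div_eq_inv_mul] at this
      refine hd.congr_of_eventuallyEq ?_
      filter_upwards [eventually_gt_nhds h0, eventually_lt_nhds h1] with r h2 h3
      simp only [profile]
      rw [max_eq_left h2.le, max_eq_right (by linarith), zero_div, add_zero, min_eq_left]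
      exact (div_le_iff₀ he).2 (by linarith)
    · have hst : strainLast (fun x => e * g x) (x, s) = 0 := by
        simp [strainLast, h0, not_le.2 h1]
      rw [hst, mul_zero]
      refine (hasDerivAt_const s (g x)).congr_of_eventuallyEq ?_
      filter_upwards [eventually_gt_nhds h0, eventually_gt_nhds h1] with r h2 h3
      simp only [profile]
      rw [max_eq_left h2.le, max_eq_right (by linarith), zero_div, add_zero, min_eq_right]
      exact (le_div_iff₀ he).2 (by linarith)

theorem abs_strainLast_le (p : Cyl n) : |strainLast g p| ≤ 1 := by
  unfold strainLast
  split_ifs <;> simp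

theorem aestronglyMeasurable_strainLast (hg : AEStronglyMeasurable g volume) :
    AEStronglyMeasurable (strainLast g) volume := by
  have := (EuclideanSpace.proj (Fin.last n) :
    EuclideanSpace ℝ (Fin (n + 1)) →L[ℝ] ℝ).continuous.comp_aestronglyMeasurable
      (aestronglyMeasurable_strain hg)
  refine this.congr (ae_of_all _ fun p => ?_)
  simp [strain]

theorem memLp_two_fst {f : Torus n → ℝ} (hf : MemLp f 2 volume) {K : Set (Cyl n)}
    (hK : IsCompact K) : MemLp (fun p : Cyl n => f p.1) 2 (volume.restrict K) := by
  obtain ⟨R, -, hR⟩ := exists_subset_slab hK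
  have e : slab n (-R) R = (univ : Set (Torus n)) ×ˢ Icc (-R) R := by
    ext p; simp [mem_slab]
  have h : MemLp (fun p : Cyl n => f p.1) 2 (volume.restrict (slab n (-R) R)) := by
    rw [e, restrict_univ_prod]
    exact hf.comp_fst _
  exact h.mono_measure (Measure.restrict_mono hR le_rfl)

theorem memLp_two_of_continuous {f : Cyl n → ℝ} (hf : Continuous f) {K : Set (Cyl n)}
    (hK : IsCompact K) : MemLp f 2 (volume.restrict K) := by
  have : IsFiniteMeasure ((volume : Measure (Cyl n)).restrict K) :=
    ⟨by simpa using hK.measure_lt_top⟩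
  obtain ⟨C, hC⟩ := hK.exists_bound_of_continuousOn hf.continuousOn
  exact MemLp.of_bound hf.aestronglyMeasurable C
    ((ae_restrict_iff' hK.measurableSet).2 (ae_of_all _ hC))

theorem memLp_two_profile (hg : MemLp g 2 volume) {K : Set (Cyl n)} (hK : IsCompact K) :
    MemLp (profile g e) 2 (volume.restrict K) :=
  (memLp_two_of_continuous (f := fun p : Cyl n => max p.2 0 / e) (by fun_prop) hK).inf
    ((memLp_two_fst hg hK).add
      (memLp_two_of_continuous (f := fun p : Cyl n => max (-p.2) 0 / e) (by fun_prop) hK))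

theorem isWeakPDeriv_profile_last (hg : MemLp g 2 volume) (he : 0 < e) :
    IsWeakPDeriv (Fin.last n) univ (profile g e)
      (fun p => e⁻¹ * strainLast (fun x => e * g x) p) := by
  refine isWeakPDeriv_of_translate _ (fun K hK => integrableOn_of_memLp_two hK
    (memLp_two_profile hg hK)) (fun K hK => ?_) fun t ht => ae_of_all _ fun p => ?_
  · have : IsFiniteMeasure ((volume : Measure (Cyl n)).restrict K) :=
      ⟨by simpa using hK.measure_lt_top⟩
    refine Integrable.const_mul ?_ _
    exact Integrable.of_bound (aestronglyMeasurable_strainLast (hg.1.const_mul e)).restrict 1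
      (ae_of_all _ fun p => abs_strainLast_le p)
  · simp only [add_dirVec_last]
    rw [intervalIntegral.integral_comp_add_left
      (fun s => e⁻¹ * strainLast (fun x => e * g x) (p.1, s)), add_zero,
      integral_strainLast_eq_profile he]

end Recovery

/-! ### Functions of finite Dirichlet energy on the slit cylinder -/

section SlitCylinder

variable {g : Torus n → ℝ} {u : Cyl n → ℝ} {G : Cyl n → EuclideanSpace ℝ (Fin (n + 1))}

theorem ae_snd_ne_zero : ∀ᵐ p : Cyl n, p.2 ≠ 0 := by
  rw [ae_iff]
  have e : {p : Cyl n | ¬ p.2 ≠ 0} = (univ : Set (Torus n)) ×ˢ {0} := by ext p; simp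
  rw [e, volume_univ_prod]
  simp

theorem restrict_slitCyl : (volume : Measure (Cyl n)).restrict (slitCyl n) = volume :=
  Measure.restrict_eq_self_of_ae_mem ae_snd_ne_zero

/-- Square integrability up to `y = 0`, about which `H¹_loc` of the open half cylinder says nothing.
The trace is first known only in `L¹`; it is in `L²` because on the slab `[1, 2]` it is the
difference of `w` and the primitive. -/
theorem IsH1LocGrad.memLp_strip {w : Cyl n → ℝ} {H : Cyl n → EuclideanSpace ℝ (Fin (n + 1))}
    (hw : IsH1LocGrad (cylCover n) (upperHalf n) w H)
    (hH : MemLp H 2 (volume.restrict (upperHalf n))) (R : ℝ) :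
    MemLp w 2 (volume.restrict (strip n R)) := by
  obtain ⟨τ, hτ, hrep⟩ := hw.exists_trace hH
  have hF := hH.euclidean_apply (Fin.last n)
  have hvm := aestronglyMeasurable_vprim_upperHalf hF.1
  have hle : ∀ S, (volume : Measure (Cyl n)).restrict (strip n S) ≤
      volume.restrict (upperHalf n) := fun S =>
    Measure.restrict_mono (strip_subset_upperHalf S) le_rfl
  have hv : ∀ S, MemLp (vprim (fun q => H q (Fin.last n)) 0) 2 (volume.restrict (strip n S)) :=
    fun S => ⟨hvm.mono_measure (hle S), (eLpNorm_strip_vprim_le hF.1).trans_lt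
      (ENNReal.mul_lt_top ENNReal.ofReal_lt_top hF.2)⟩
  have hs : slab n 1 2 ⊆ strip n 3 := fun p hp => by
    have := mem_slab.1 hp
    exact mem_strip.2 ⟨by linarith, by linarith⟩
  have h1 : MemLp (fun p : Cyl n => τ p.1) 2 (volume.restrict (slab n 1 2)) := by
    refine ((hw.memLp_fun _ (isCompact_slab 1 2) (slab_subset_upperHalf one_pos 2)).sub
      ((hv 3).mono_measure (Measure.restrict_mono hs le_rfl))).ae_eq ?_
    filter_upwards [ae_mono (Measure.restrict_mono (slab_subset_upperHalf one_pos 2) le_rfl)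
      hrep] with p hp
    rw [Pi.sub_apply, hp, add_sub_cancel_right]
  have e : slab n 1 2 = (univ : Set (Torus n)) ×ˢ Icc (1 : ℝ) 2 := by ext p; simp [mem_slab]
  have hprob : IsProbabilityMeasure ((volume : Measure ℝ).restrict (Icc 1 2)) :=
    ⟨by rw [Measure.restrict_apply_univ, Real.volume_Icc]; norm_num⟩
  have h2 : MemLp τ 2 volume := by
    refine ⟨hτ.1.1, ?_⟩
    rw [e, restrict_univ_prod] at h1
    have := eLpNorm_comp_measurePreserving (p := 2) hτ.1.1 (measurePreserving_fst
      (μ := (volume : Measure (Torus n))) (ν := (volume : Measure ℝ).restrict (Icc 1 2)))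
    rw [← this]
    exact h1.2
  have h3 : MemLp (fun p : Cyl n => τ p.1) 2 (volume.restrict (strip n R)) := by
    refine ⟨hτ.1.1.comp_fst.restrict, ?_⟩
    rw [eLpNorm_strip_fst hτ.1.1]
    exact ENNReal.mul_lt_top (ENNReal.rpow_lt_top_of_nonneg (by norm_num) ENNReal.ofReal_ne_top)
      h2.2
  exact (h3.add (hv R)).ae_eq
    (Eventually.mono (ae_mono (hle R) hrep) fun p hp => by rw [hp]; rfl)

/-- The gradient of `(x, y) ↦ u(x, -y)`. -/
def gradReflect (G : Cyl n → EuclideanSpace ℝ (Fin (n + 1))) :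
    Cyl n → EuclideanSpace ℝ (Fin (n + 1)) := fun p => scaleLast (-1) (G (p.1, -p.2))

theorem IsH1LocGrad.reflect (h : IsH1LocGrad (cylCover n) (slitCyl n) u G) :
    IsH1LocGrad (cylCover n) (upperHalf n) (fun p => u (p.1, -p.2)) (gradReflect G) := by
  have := h.comp_yAff (V := upperHalf n) (σ := -1) (by norm_num) 0 fun p hp => by
    have h0 : 0 < p.2 := hp
    simp only [yAff, slitCyl, mem_ofPred_eq]
    linarith
  refine this.congr_ae (ae_of_all _ fun p => ?_) (ae_of_all _ fun p => ?_)
  · simp [yAff]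
  · simp [yAff, gradReflect]

theorem yAff_neg_one_zero : (yAff (-1) 0 : Cyl n → Cyl n) = fun p => (p.1, -p.2) := by
  ext1 p; simp [yAff]

theorem measurePreserving_reflect :
    MeasurePreserving (fun p : Cyl n => (p.1, -p.2)) volume volume := by
  rw [← yAff_neg_one_zero]
  exact measurePreserving_yAff (by norm_num) 0

theorem memLp_gradReflect (h : MemLp G 2 volume) : MemLp (gradReflect G) 2 volume := by
  have h1 := h.comp_measurePreserving (measurePreserving_reflect (n := n))
  refine MemLp.of_le h1 ((continuous_scaleLast _).comp_aestronglyMeasurable h1.1)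
    (ae_of_all _ fun p => ?_)
  exact (norm_scaleLast (by norm_num) _).le

theorem upperHalf_subset_slitCyl : upperHalf n ⊆ slitCyl n :=
  slitCyl_eq_union ▸ subset_union_left

theorem IsH1LocGrad.memLp_of_slitCyl (h : IsH1LocGrad (cylCover n) (slitCyl n) u G)
    (hG : MemLp G 2 volume) {K : Set (Cyl n)} (hK : IsCompact K) :
    MemLp u 2 (volume.restrict K) := by
  obtain ⟨R, -, hR⟩ := exists_subset_slab hK
  have h1 := (h.mono upperHalf_subset_slitCyl).memLp_strip (hG.restrict _) (R + 1)
  have h2 := h.reflect.memLp_strip ((memLp_gradReflect hG).restrict _) (R + 1)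
  set L := (fun p : Cyl n => (p.1, -p.2)) ⁻¹' strip n (R + 1)
  have hmp : MeasurePreserving (fun p : Cyl n => (p.1, -p.2)) (volume.restrict L)
      (volume.restrict (strip n (R + 1))) :=
    measurePreserving_reflect.restrict_preimage (measurableSet_strip _)
  have h3 : MemLp u 2 (volume.restrict L) := by
    simpa [Function.comp_def] using h2.comp_measurePreserving hmp
  have hsub : ∀ᵐ p : Cyl n, p ∈ K → p ∈ strip n (R + 1) ∪ L := by
    filter_upwards [ae_snd_ne_zero] with p hp hpK
    have hs := mem_slab.1 (hR hpK)
    rcases lt_or_gt_of_ne hp with h0 | h0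
    · exact Or.inr (mem_strip.2 ⟨by simpa using h0, by simp only; linarith⟩)
    · exact Or.inl (mem_strip.2 ⟨h0, by linarith⟩)
  refine (memLp_two_add_measure h1 h3).mono_measure ?_
  refine le_trans (Measure.restrict_mono_ae hsub) (Measure.restrict_union_le _ _)

/-- By uniqueness of traces, subtracting `g` on the upper half gives both sides the trace `τ`. A
single primitive formula then holds across `y = 0`, which is the absence of a singular vertical
derivative. -/
theorem IsH1LocGrad.exists_eq_of_hasJump (h : IsH1LocGrad (cylCover n) (slitCyl n) u G)
    (hG : MemLp G 2 volume) (hj : HasJump u g) :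
    ∃ τ : Torus n → ℝ, ∀ᵐ p : Cyl n, u p - (if 0 < p.2 then g p.1 else 0) =
      τ p.1 + vprim (fun q => G q (Fin.last n)) 0 p := by
  obtain ⟨τp, τm, htp, htm, hg⟩ := hj
  have hu := h.mono upperHalf_subset_slitCyl
  have hr := h.reflect
  obtain ⟨σp, hσp, hrp⟩ := hu.exists_trace (hG.restrict _)
  obtain ⟨σm, hσm, hrm⟩ := hr.exists_trace ((memLp_gradReflect hG).restrict _)
  have ep := htp.ae_eq hσp (hu.aestronglyMeasurable_fun isOpen_upperHalf)
  have em := (isTraceBelow_iff.1 htm).ae_eq hσm (hr.aestronglyMeasurable_fun isOpen_upperHalf)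
  have e : ∀ᵐ x, σp x - g x = σm x := by
    filter_upwards [ep, em, hg] with x h1 h2 h3
    rw [← h1, ← h2, ← h3]; ring
  have hlow := (measurePreserving_reflect (n := n)).quasiMeasurePreserving.ae
    ((ae_restrict_iff' measurableSet_upperHalf).1 hrm)
  refine ⟨σm, ?_⟩
  filter_upwards [ae_snd_ne_zero, ae_of_ae_fst e, (ae_restrict_iff' measurableSet_upperHalf).1 hrp,
    hlow] with p h0 h1 h2 h3
  rcases lt_or_gt_of_ne h0 with h | h
  · rw [if_neg h.not_gt, sub_zero]
    have h4 := h3 (show 0 < -p.2 by linarith)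
    simp only [neg_neg, Prod.mk.eta] at h4
    rw [h4]
    congr 1
    have e1 : ∀ s, (gradReflect G (p.1, s)) (Fin.last n) = -(G (p.1, -s) (Fin.last n)) :=
      fun s => by simp [gradReflect, scaleLast_apply]
    simp only [vprim, e1]
    rw [intervalIntegral.integral_neg,
      intervalIntegral.integral_comp_neg (fun s => G (p.1, s) (Fin.last n)), neg_neg, neg_zero,
      ← intervalIntegral.integral_symm]
  · rw [if_pos h, h2 h, ← h1]; ring

theorem isWeakPDeriv_last_of_eq_vprim {w F : Cyl n → ℝ} {τ : Torus n → ℝ}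
    (hw : ∀ K, IsCompact K → IntegrableOn w K) (hF : ∀ K, IsCompact K → IntegrableOn F K)
    (h : ∀ᵐ p : Cyl n, w p = τ p.1 + vprim F 0 p) : IsWeakPDeriv (Fin.last n) univ w F := by
  refine isWeakPDeriv_of_translate _ hw hF fun t ht => ?_
  filter_upwards [h, (measurePreserving_add_const
    (dirVec (Fin.last n) t : Cyl n)).quasiMeasurePreserving.ae h,
    ae_of_ae_fst (ae_intervalIntegrable hF)] with p h1 h2 h3
  rw [h1, h2, ← vprim_add_dirVec_sub h3 0 p.2 t]
  simp only [add_dirVec_last]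
  ring

theorem IsWeakPDeriv.add {i : Fin (n + 1)} {v w E F : Cyl n → ℝ}
    (hv : IsWeakPDeriv i univ v E) (hw : IsWeakPDeriv i univ w F)
    (iv : ∀ K, IsCompact K → IntegrableOn v K) (iw : ∀ K, IsCompact K → IntegrableOn w K)
    (iE : ∀ K, IsCompact K → IntegrableOn E K) (iF : ∀ K, IsCompact K → IntegrableOn F K) :
    IsWeakPDeriv i univ (fun p => v p + w p) (fun p => E p + F p) := by
  intro φ hφ
  have h1 := hv φ hφ
  have h2 := hw φ hφ
  simp only [Measure.restrict_univ] at h1 h2 ⊢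
  simp only [add_mul]
  rw [integral_add (hφ.integrable_mul_pderiv i fun K hK _ => iv K hK)
      (hφ.integrable_mul_pderiv i fun K hK _ => iw K hK),
    integral_add (hφ.integrable_mul fun K hK _ => iE K hK)
      (hφ.integrable_mul fun K hK _ => iF K hK), h1, h2, neg_add]

theorem ae_intervalIntegrable_translate {F : Cyl n → ℝ}
    (hF : ∀ K, IsCompact K → IntegrableOn F K) (i : Fin (n + 1)) {t : ℝ} (ht : 0 ≤ t) :
    ∀ᵐ p : Cyl n, IntervalIntegrable (fun s => F (p + dirVec i s)) volume 0 t := by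
  rw [← Measure.restrict_univ (μ := (volume : Measure (Cyl n)))]
  refine ae_restrict_of_forall_isCompact isOpen_univ fun K hK _ => ?_
  have hS := isCompact_sweep i t hK
  have hi := integrable_comp_add_dirVec ((integrable_indicator_iff hS.measurableSet).2 (hF _ hS)) i
    (volume.restrict (Ioc 0 t))
  filter_upwards [ae_restrict_of_ae hi.prod_left_ae, ae_restrict_mem hK.measurableSet] with p hp hpK
  rw [intervalIntegrable_iff_integrableOn_Ioc_of_le ht]
  refine IntegrableOn.congr_fun hp (fun s hs => ?_) measurableSet_Ioc
  exact indicator_of_mem (mem_sweep hpK ⟨hs.1.le, hs.2⟩) F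

variable {D : Torus n → EuclideanSpace ℝ (Fin n)}

/-- Horizontal translations preserve the slit cylinder, so the translation identity holds on each
side separately and, the slit being null, almost everywhere. The jump plays no role in these
directions. -/
theorem IsH1LocGrad.isWeakPDeriv_castSucc_of_slitCyl
    (h : IsH1LocGrad (cylCover n) (slitCyl n) u G) (hG : MemLp G 2 volume)
    (hg : MemLp g 2 volume) (hD : MemLp D 2 volume) (hgD : IsWeakGrad (torusCover n) univ g D)
    (k : Fin n) : IsWeakPDeriv k.castSucc univ
      (fun p => u p - (if 0 < p.2 then g p.1 else 0))
      (fun p => G p k.castSucc - (if 0 < p.2 then D p.1 k else 0)) := by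
  set i : Fin (n + 1) := k.castSucc
  have hdir : ∀ (p : Cyl n) (t : ℝ), (p + dirVec i t).2 = p.2 := fun p t => by simp [i]
  have hgK : ∀ K : Set (Cyl n), IsCompact K → IntegrableOn (fun p : Cyl n => g p.1) K :=
    fun K hK => integrableOn_of_memLp_two hK (memLp_two_fst hg hK)
  have hDK : ∀ K : Set (Cyl n), IsCompact K → IntegrableOn (fun p : Cyl n => D p.1 k) K :=
    fun K hK => integrableOn_of_memLp_two hK (memLp_two_fst (f := fun x => D x k)
      (hD.euclidean_apply k) hK)
  have hGK : ∀ K : Set (Cyl n), IsCompact K → IntegrableOn (fun p => G p i) K :=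
    fun K hK => integrableOn_of_memLp_two hK ((hG.euclidean_apply i).restrict K)
  have huK : ∀ K : Set (Cyl n), IsCompact K → IntegrableOn u K :=
    fun K hK => integrableOn_of_memLp_two hK (h.memLp_of_slitCyl hG hK)
  have hite : ∀ f : Cyl n → ℝ, (fun p : Cyl n => if 0 < p.2 then f p else 0) =
      (upperHalf n).indicator f := fun f => by
    ext p; by_cases hp : 0 < p.2 <;> simp [upperHalf, indicator, hp]
  refine isWeakPDeriv_of_translate i (fun K hK => (huK K hK).sub ?_)
    (fun K hK => (hGK K hK).sub ?_) fun t ht => ?_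
  · rw [hite fun p => g p.1]
    exact (hgK K hK).indicator measurableSet_upperHalf
  · rw [hite fun p => D p.1 k]
    exact (hDK K hK).indicator measurableSet_upperHalf
  · have h1 := translate_ae isOpen_slitCyl i ht.le
      (fun p hp s _ => show (p + dirVec i s).2 ≠ 0 by rw [hdir]; exact hp)
      h.integrableOn_fun (h.integrableOn_grad i) (h.isWeakPDeriv i)
    have h2 := translate_ae (V := univ) (U := univ) isOpen_univ i ht.le (by simp)
      (fun K hK _ => hgK K hK) (fun K hK _ => hDK K hK)
      (isWeakPDeriv_fst (hg.integrable (by norm_num))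
        (fun k => (hD.euclidean_apply k).integrable (by norm_num)) hgD k)
    rw [restrict_slitCyl] at h1
    rw [Measure.restrict_univ] at h2
    filter_upwards [h1, h2, ae_intervalIntegrable_translate hGK i ht.le,
      ae_intervalIntegrable_translate hDK i ht.le] with p p1 p2 p3 p4
    simp only [hdir]
    by_cases hp : 0 < p.2
    · simp only [hp, if_true]
      rw [intervalIntegral.integral_sub p3 p4, ← p1, ← p2]
      ring
    · simp only [hp, if_false, sub_zero]
      exact p1

end SlitCylinder

/-! ### The recovery sequence -/

section RecoverySequence

variable {g : Torus n → ℝ} {M e : ℝ} {u : Cyl n → ℝ} {G : Cyl n → EuclideanSpace ℝ (Fin (n + 1))}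
  {D : Torus n → EuclideanSpace ℝ (Fin n)}

/-- The horizontal part of the gradient of `recovery g e u` that is not due to `u`. -/
def corrector (g : Torus n → ℝ) (D : Torus n → EuclideanSpace ℝ (Fin n)) (e : ℝ) (p : Cyl n) :
    EuclideanSpace ℝ (Fin (n + 1)) :=
  WithLp.toLp 2 (Fin.snoc (α := fun _ => ℝ) (fun k => minSlope
    (g p.1 + max (-p.2) 0 / e - max p.2 0 / e) (D p.1 k) - if 0 < p.2 then D p.1 k else 0) 0)

theorem corrector_castSucc (p : Cyl n) (k : Fin n) : corrector g D e p k.castSucc =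
    minSlope (g p.1 + max (-p.2) 0 / e - max p.2 0 / e) (D p.1 k) -
      if 0 < p.2 then D p.1 k else 0 := by
  simp [corrector]

theorem corrector_last (p : Cyl n) : corrector g D e p (Fin.last n) = 0 := by
  simp [corrector]

theorem abs_minSlope_sub_le (s d : ℝ) : |minSlope s d - d| ≤ |d| := by
  unfold minSlope
  split_ifs
  · simp
  · rcases le_total 0 d with h | h
    · simp [h]
    · simp [h]
  · simp

/-- `minSlope s d` lies between `0` and `d`, hence so does its complement to `d`, up to sign. -/
theorem norm_corrector_le (p : Cyl n) : ‖corrector g D e p‖ ≤ ‖D p.1‖ := by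
  rw [← abs_of_nonneg (norm_nonneg (corrector g D e p)), ← abs_of_nonneg (norm_nonneg (D p.1)),
    ← sq_le_sq, EuclideanSpace.norm_sq_eq, EuclideanSpace.norm_sq_eq, Fin.sum_univ_castSucc,
    corrector_last, norm_zero, zero_pow two_ne_zero, add_zero]
  refine Finset.sum_le_sum fun k _ => ?_
  rw [corrector_castSucc, Real.norm_eq_abs, Real.norm_eq_abs]
  refine pow_le_pow_left₀ (abs_nonneg _) ?_ 2
  split_ifs
  · exact abs_minSlope_sub_le _ _
  · rw [sub_zero]; exact abs_minSlope_le _ _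

theorem corrector_eq_zero (he : 0 < e) {p : Cyl n} (hx : |g p.1| ≤ M) (hp : M * e < |p.2|) :
    corrector g D e p = 0 := by
  have h1 := (abs_le.1 hx).1
  have h2 := (abs_le.1 hx).2
  have hM : M < |p.2| / e := (lt_div_iff₀ he).2 hp
  ext i
  refine Fin.lastCases ?_ (fun k => ?_) i
  · rw [corrector_last]; rfl
  · rw [corrector_castSucc]
    split_ifs with h
    · rw [abs_of_pos h] at hM
      rw [max_eq_left h.le, max_eq_right (by linarith), zero_div, add_zero, minSlope,
        if_pos (by linarith), sub_self]
      rfl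
    · rw [abs_of_nonpos (not_lt.1 h)] at hM
      rw [max_eq_right (not_lt.1 h), max_eq_left (by linarith [not_lt.1 h]), zero_div, sub_zero,
        sub_zero, minSlope, if_neg (by linarith), if_neg (by linarith)]
      rfl

theorem aestronglyMeasurable_corrector (hg : AEStronglyMeasurable g volume)
    (hD : AEStronglyMeasurable D volume) : AEStronglyMeasurable (corrector g D e) volume := by
  have hgm : AEMeasurable (fun p : Cyl n => g p.1) volume := hg.comp_fst.aemeasurable
  have hDm : ∀ k, AEMeasurable (fun p : Cyl n => D p.1 k) volume := fun k =>
    ((EuclideanSpace.proj k : EuclideanSpace ℝ (Fin n) →L[ℝ]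
      ℝ).continuous.comp_aestronglyMeasurable hD).comp_fst.aemeasurable
  refine (PiLp.continuous_toLp 2 _).comp_aestronglyMeasurable
    (AEMeasurable.aestronglyMeasurable (aemeasurable_pi_iff.2 fun i => ?_))
  refine Fin.lastCases ?_ (fun k => ?_) i
  · simp
  · simp only [Fin.snoc_castSucc]
    refine (aemeasurable_minSlope ((hgm.add ?_).sub ?_) (hDm k)).sub ?_
    · exact (by fun_prop : Continuous fun p : Cyl n => max (-p.2) 0 / e).aemeasurable
    · exact (by fun_prop : Continuous fun p : Cyl n => max p.2 0 / e).aemeasurable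
    · have e1 : (fun p : Cyl n => if 0 < p.2 then D p.1 k else 0) =
          (upperHalf n).indicator fun p => D p.1 k := by
        ext p; by_cases hp : 0 < p.2 <;> simp [upperHalf, indicator, hp]
      rw [e1]
      exact (hDm k).indicator measurableSet_upperHalf

/-- The corrector is bounded by `|∇g|` and lives in a layer of thickness `2 M e`. -/
theorem eLpNorm_corrector_le (hM : ∀ᵐ x, |g x| ≤ M) (he : 0 < e)
    (hD : AEStronglyMeasurable D volume) : eLpNorm (corrector g D e) 2 volume ≤
      ENNReal.ofReal (2 * (M * e)) ^ (1 / 2 : ℝ) * eLpNorm D 2 volume := by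
  rw [eLpNorm_two_le_iff, mul_pow, rpow_half_sq, eLpNorm_two_sq]
  have hs : slab n (-(M * e)) (M * e) = (univ : Set (Torus n)) ×ˢ Icc (-(M * e)) (M * e) := by
    ext p; simp [mem_slab]
  calc ∫⁻ p, ‖corrector g D e p‖ₑ ^ 2
      ≤ ∫⁻ p, (slab n (-(M * e)) (M * e)).indicator (fun p => ‖D p.1‖ₑ ^ 2) p := by
        refine lintegral_mono_ae ?_
        filter_upwards [ae_of_ae_fst hM] with p hp
        by_cases hps : |p.2| ≤ M * e
        · rw [indicator_of_mem (mem_slab.2 (abs_le.1 hps))]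
          gcongr
          rw [← ofReal_norm, ← ofReal_norm]
          exact ENNReal.ofReal_le_ofReal (norm_corrector_le p)
        · rw [corrector_eq_zero he hp (not_le.1 hps)]
          simp
    _ = ∫⁻ p in slab n (-(M * e)) (M * e), ‖D p.1‖ₑ ^ 2 :=
        lintegral_indicator (measurableSet_slab _ _) _
    _ = ENNReal.ofReal (2 * (M * e)) * ∫⁻ x, ‖D x‖ₑ ^ 2 := by
        rw [hs, restrict_univ_prod]
        have := lintegral_prod_mul (μ := (volume : Measure (Torus n)))
          (ν := volume.restrict (Icc (-(M * e)) (M * e))) (f := fun x => ‖D x‖ₑ ^ 2)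
          (g := fun _ => 1) (hD.enorm.pow_const 2) aemeasurable_const
        simp only [mul_one, lintegral_const, Measure.restrict_apply_univ, Real.volume_Icc,
          one_mul] at this
        rw [this, mul_comm, sub_neg_eq_add, ← two_mul]

/-- The gradient of `recovery g e u`. -/
def recoveryGrad (g : Torus n → ℝ) (D : Torus n → EuclideanSpace ℝ (Fin n)) (e : ℝ)
    (G : Cyl n → EuclideanSpace ℝ (Fin (n + 1))) (p : Cyl n) : EuclideanSpace ℝ (Fin (n + 1)) :=
  G p + e⁻¹ • strain (fun x => e * g x) p + corrector g D e p

/-- Vertically, the jump-free representation of `u - g 1_{y>0}` and the profile contribute `G` and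
the strain. Horizontally, each side of the slit is differentiated separately and the chain rule for
`min` handles the profile. -/
theorem isH1LocGrad_recovery (hg : MemLp g 2 volume) (hD : MemLp D 2 volume)
    (hgD : IsWeakGrad (torusCover n) univ g D) (he : 0 < e)
    (h : IsH1LocGrad (cylCover n) (slitCyl n) u G) (hG : MemLp G 2 volume) (hj : HasJump u g) :
    IsH1LocGrad (cylCover n) univ (recovery g e u) (recoveryGrad g D e G) := by
  have hite : ∀ f : Torus n → ℝ, (fun p : Cyl n => if 0 < p.2 then f p.1 else 0) =
      (upperHalf n).indicator fun p => f p.1 := fun f => by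
    ext p; by_cases hp : 0 < p.2 <;> simp [upperHalf, indicator, hp]
  have hit2 : ∀ f : Torus n → ℝ, MemLp f 2 volume → ∀ K : Set (Cyl n), IsCompact K →
      MemLp (fun p : Cyl n => if 0 < p.2 then f p.1 else 0) 2 (volume.restrict K) :=
    fun f hf K hK => by
      rw [hite]
      exact (memLp_two_fst hf hK).indicator measurableSet_upperHalf
  have hU2 : ∀ K : Set (Cyl n), IsCompact K →
      MemLp (fun p => u p - (if 0 < p.2 then g p.1 else 0)) 2 (volume.restrict K) := fun K hK =>
    (h.memLp_of_slitCyl hG hK).sub (hit2 g hg K hK)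
  have hP2 : ∀ K : Set (Cyl n), IsCompact K → MemLp (profile g e) 2 (volume.restrict K) :=
    fun K hK => memLp_two_profile hg hK
  have hGi : ∀ i, ∀ K : Set (Cyl n), IsCompact K → IntegrableOn (fun p => G p i) K :=
    fun i K hK => integrableOn_of_memLp_two hK ((hG.euclidean_apply i).restrict K)
  have hs2 : ∀ K : Set (Cyl n), IsCompact K →
      MemLp (strain (fun x => e * g x)) 2 (volume.restrict K) := fun K hK => by
    have : IsFiniteMeasure ((volume : Measure (Cyl n)).restrict K) :=
      ⟨by simpa using hK.measure_lt_top⟩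
    refine MemLp.of_bound (C := 1) (aestronglyMeasurable_strain (hg.1.const_mul e)).restrict
      (ae_of_all _ fun p => ?_)
    rw [strain, PiLp.norm_single]
    exact abs_strainLast_le p
  have hDi : ∀ k, Integrable (fun x => D x k) := fun k =>
    (hD.euclidean_apply k).integrable (by norm_num)
  have hc2 : ∀ K : Set (Cyl n), IsCompact K →
      MemLp (corrector g D e) 2 (volume.restrict K) := fun K hK => by
    refine MemLp.of_le (memLp_two_fst (f := fun x => ‖D x‖) hD.norm hK)
      (aestronglyMeasurable_corrector hg.1 hD.1).restrict (ae_of_all _ fun p => ?_)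
    rw [norm_norm]
    exact norm_corrector_le p
  refine ⟨fun K hK _ => (hU2 K hK).add (hP2 K hK), fun K hK _ =>
    ((hG.restrict K).add ((hs2 K hK).const_smul e⁻¹)).add (hc2 K hK), ?_⟩
  suffices H : ∀ i, IsWeakPDeriv i univ (recovery g e u) (fun p => recoveryGrad g D e G p i) from
    fun φ hφ i => H i φ hφ
  intro i
  refine Fin.lastCases ?_ (fun k => ?_) i
  · obtain ⟨τ, hτ⟩ := h.exists_eq_of_hasJump hG hj
    have h1 := isWeakPDeriv_last_of_eq_vprim (fun K hK => integrableOn_of_memLp_two hK (hU2 K hK))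
      (hGi _) hτ
    have h2 := h1.add (isWeakPDeriv_profile_last hg he)
      (fun K hK => integrableOn_of_memLp_two hK (hU2 K hK))
      (fun K hK => integrableOn_of_memLp_two hK (hP2 K hK)) (hGi _) (fun K hK => ?_)
    · have hE : (fun p => recoveryGrad g D e G p (Fin.last n)) = fun p =>
          G p (Fin.last n) + e⁻¹ * strainLast (fun x => e * g x) p := by
        ext p
        simp [recoveryGrad, corrector_last, strain]
      rw [hE]
      exact h2
    · have := integrableOn_of_memLp_two hK ((((hs2 K hK).euclidean_apply (Fin.last n))).const_mul e⁻¹)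
      simpa [strain] using this
  · have h1 := h.isWeakPDeriv_castSucc_of_slitCyl hG hg hD hgD k
    have h2 := isWeakPDeriv_min_fst (hg.integrable (by norm_num)) hDi hgD
      (a := fun y => max y 0 / e) (b := fun y => max (-y) 0 / e) (by fun_prop) (by fun_prop) k
    have hDk2 : ∀ K : Set (Cyl n), IsCompact K → MemLp
        (fun p : Cyl n => if 0 < p.2 then D p.1 k else 0) 2 (volume.restrict K) :=
      hit2 (fun x => D x k) (hD.euclidean_apply k)
    have h3 := h1.add h2 (fun K hK => integrableOn_of_memLp_two hK (hU2 K hK))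
      (fun K hK => integrableOn_of_memLp_two hK (hP2 K hK))
      (fun K hK => (hGi _ K hK).sub (integrableOn_of_memLp_two hK (hDk2 K hK))) (fun K hK => ?_)
    · have hE : (fun p => recoveryGrad g D e G p k.castSucc) = fun p =>
          (G p k.castSucc - (if 0 < p.2 then D p.1 k else 0)) +
            minSlope (g p.1 + max (-p.2) 0 / e - max p.2 0 / e) (D p.1 k) := by
        ext p
        simp only [recoveryGrad, PiLp.add_apply, corrector_castSucc]
        simp [strain, (Fin.castSucc_lt_last k).ne]
        ring
      rw [hE]
      exact h3
    · have := integrableOn_of_memLp_two hK (((hc2 K hK).euclidean_apply k.castSucc).add (hDk2 K hK))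
      refine this.congr_fun (fun p _ => ?_) hK.measurableSet
      simp only [Pi.add_apply, corrector_castSucc, sub_add_cancel]

/-- The strain in the recovery gradient cancels the one in the energy exactly, leaving `G` plus the
corrector. -/
theorem energyEps_recovery_le (hg : MemLp g 2 volume) (hD : MemLp D 2 volume)
    (hgD : IsWeakGrad (torusCover n) univ g D) (hM : ∀ᵐ x, |g x| ≤ M) (he : 0 < e)
    (h : IsH1LocGrad (cylCover n) (slitCyl n) u G) (hG : MemLp G 2 volume) (hj : HasJump u g) :
    energyEps g e (recovery g e u) ≤ 2⁻¹ * (eLpNorm G 2 volume +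
      ENNReal.ofReal (2 * (M * e)) ^ (1 / 2 : ℝ) * eLpNorm D 2 volume) ^ 2 := by
  refine (iInf₂_le (recoveryGrad g D e G)
    (isH1LocGrad_recovery hg hD hgD he h hG hj)).trans ?_
  rw [lintegral_ofReal_half_sq]
  gcongr
  have e1 : ∀ p, recoveryGrad g D e G p - e⁻¹ • strain (fun x => e * g x) p =
      (G + corrector g D e) p := fun p => by
    simp only [recoveryGrad, Pi.add_apply]; abel
  simp only [e1]
  rw [← eLpNorm_two_sq]
  gcongr
  exact (eLpNorm_add_le hG.1 (aestronglyMeasurable_corrector hg.1 hD.1) (by norm_num)).trans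
    (add_le_add le_rfl (eLpNorm_corrector_le hM he hD.1))

theorem L1LocTendsto.congr_ae {U : Set (Cyl n)} {v v' : ℕ → Cyl n → ℝ} {w : Cyl n → ℝ}
    (h : L1LocTendsto U v w) (hv : ∀ j, ∀ᵐ p ∂volume.restrict U, v j p = v' j p) :
    L1LocTendsto U v' w := by
  intro K hK hKU
  have hK' : ∀ j, ∀ᵐ p ∂volume.restrict K, v j p = v' j p := fun j =>
    ae_mono (Measure.restrict_mono hKU le_rfl) (hv j)
  refine ⟨fun j => ((h K hK hKU).1 j).congr (hK' j), (h K hK hKU).2.1,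
    (h K hK hKU).2.2.congr fun j => lintegral_congr_ae ?_⟩
  filter_upwards [hK' j] with p hp
  rw [hp]

/-- One formula serves every `u`. Outside the layer it equals `u`, so convergence reduces to
vertical shifts of `u` itself; the jump condition and finite energy enter only in the energy bound.
-/
theorem exists_recovery_sequence {ε : ℕ → ℝ} (hg : MemH1 (torusCover n) univ g)
    (hM : ∀ᵐ x, |g x| ≤ M) (hε_pos : ∀ j, 0 < ε j) (hε_lim : Tendsto ε atTop (𝓝 0))
    (hu : MemH1Loc (cylCover n) (slitCyl n) u) :
    ∃ v : ℕ → Cyl n → ℝ,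
      L1LocTendsto (upperHalf n) (fun j => shiftUp (M * ε j) (v j)) u ∧
      L1LocTendsto (upperHalf n) (fun j => shiftDown (M * ε j) (v j)) (fun p => u (p.1, -p.2)) ∧
      limsup (fun j => energyEps g (ε j) (v j)) atTop ≤ energyLimit g u := by
  have hM0 : 0 ≤ M := by
    obtain ⟨x, hx⟩ := hM.exists
    exact (abs_nonneg _).trans hx
  obtain ⟨D, hg2, hD2, hgD⟩ := hg
  rw [Measure.restrict_univ] at hg2 hD2
  have hMε : ∀ j, 0 ≤ M * ε j := fun j => mul_nonneg hM0 (hε_pos j).le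
  have hMε0 : Tendsto (fun j => M * ε j) atTop (𝓝 0) := by simpa using hε_lim.const_mul M
  refine ⟨fun j => recovery g (ε j) u, ?_, ?_, ?_⟩
  · obtain ⟨G₀, hG₀⟩ := hu
    refine (l1LocTendsto_shift (hG₀.mono upperHalf_subset_slitCyl) hMε hMε0).congr_ae fun j => ?_
    filter_upwards [ae_restrict_of_ae (ae_of_ae_fst hM), ae_restrict_mem measurableSet_upperHalf]
      with p hp hpu
    have hp0 : 0 < p.2 := hpu
    refine (recovery_eq (p := (p.1, p.2 + M * ε j)) (hε_pos j) hp ?_).symm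
    exact le_trans (by simp only; linarith) (le_abs_self _)
  · obtain ⟨G₀, hG₀⟩ := hu
    refine (l1LocTendsto_shift hG₀.reflect hMε hMε0).congr_ae fun j => ?_
    filter_upwards [ae_restrict_of_ae (ae_of_ae_fst hM), ae_restrict_mem measurableSet_upperHalf]
      with p hp hpu
    have hp0 : 0 < p.2 := hpu
    have e1 : -(p.2 + M * ε j) = -p.2 - M * ε j := by ring
    simp only [e1]
    refine (recovery_eq (p := (p.1, -p.2 - M * ε j)) (hε_pos j) hp ?_).symm
    exact le_trans (by simp only; linarith) (neg_le_abs _)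
  -- If no gradient or no jump `g` is available, the infimum is over an empty family and equals `∞`.
  · refine le_iInf fun G => le_iInf fun hG => le_iInf fun hj => ?_
    rw [lintegral_ofReal_half_sq, restrict_slitCyl]
    rcases eq_or_ne (∫⁻ p, ‖G p‖ₑ ^ 2) ⊤ with htop | hfin
    · rw [htop, ENNReal.mul_top (by simp)]
      exact le_top
    have hG2 : MemLp G 2 volume := by
      have hm := hG.aestronglyMeasurable_grad isOpen_slitCyl
      rw [restrict_slitCyl] at hm
      refine ⟨hm, lt_of_le_of_lt (eLpNorm_two_le_iff.2 (rpow_half_sq _).ge)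
        (ENNReal.rpow_lt_top_of_nonneg (by norm_num) hfin)⟩
    have hlim : Tendsto (fun j => 2⁻¹ * (eLpNorm G 2 volume +
        ENNReal.ofReal (2 * (M * ε j)) ^ (1 / 2 : ℝ) * eLpNorm D 2 volume) ^ 2) atTop
        (𝓝 (2⁻¹ * (eLpNorm G 2 volume) ^ 2)) := by
      have h1 : Tendsto (fun j => ENNReal.ofReal (2 * (M * ε j)) ^ (1 / 2 : ℝ)) atTop (𝓝 0) := by
        have := (ENNReal.tendsto_ofReal (hMε0.const_mul 2)).ennrpow_const (1 / 2)
        rwa [mul_zero, ENNReal.ofReal_zero, ENNReal.zero_rpow_of_pos (by norm_num)] at this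
      have h2 := (ENNReal.Tendsto.mul_const h1 (b := eLpNorm D 2 volume)
        (Or.inr hD2.2.ne)).const_add (eLpNorm G 2 volume)
      rw [zero_mul, add_zero] at h2
      exact ENNReal.Tendsto.const_mul (ENNReal.Tendsto.pow h2) (Or.inr (by simp))
    rw [← eLpNorm_two_sq, ← hlim.limsup_eq]
    exact limsup_le_limsup (Eventually.of_forall fun j =>
      energyEps_recovery_le hg2 hD2 hgD hM (hε_pos j) hG hG2 hj)

end RecoverySequence

end InterfaceEnergy

end

theorem theorem2p1 (n : ℕ)
    -- the interface `g ∈ H¹(T^n) ∩ L^∞(T^n)`, with `‖g‖_∞ ≤ M`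
    (g : InterfaceEnergy.Torus n → ℝ)
    (hg : InterfaceEnergy.MemH1 (InterfaceEnergy.torusCover n) Set.univ g)
    (M : ℝ) (hM : ∀ᵐ x, |g x| ≤ M)
    (ε : ℕ → ℝ) (hε_pos : ∀ j, 0 < ε j) (hε_anti : Antitone ε)
    (hε_lim : Tendsto ε atTop (𝓝 0)) :
    -- compactness
    (∀ u : ℕ → InterfaceEnergy.Cyl n → ℝ,
      (∃ C : ℝ, ∀ j, InterfaceEnergy.energyEps g (ε j) (u j) ≤ ENNReal.ofReal C) →
      ∃ (k : ℕ → ℕ) (c : ℕ → ℝ) (up um : InterfaceEnergy.Cyl n → ℝ),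
        StrictMono k ∧
        InterfaceEnergy.MemH1Loc (InterfaceEnergy.cylCover n) (InterfaceEnergy.upperHalf n) up ∧
        InterfaceEnergy.MemH1Loc (InterfaceEnergy.cylCover n) (InterfaceEnergy.upperHalf n) um ∧
        InterfaceEnergy.WeakH1LocTendsto (InterfaceEnergy.cylCover n)
          (InterfaceEnergy.upperHalf n)
          (fun j p => InterfaceEnergy.shiftUp (M * ε (k j)) (u (k j)) p - c j) up ∧
        InterfaceEnergy.WeakH1LocTendsto (InterfaceEnergy.cylCover n)
          (InterfaceEnergy.upperHalf n)
          (fun j p => InterfaceEnergy.shiftDown (M * ε (k j)) (u (k j)) p - c j) um ∧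
        InterfaceEnergy.L1LocTendsto (InterfaceEnergy.upperHalf n)
          (fun j p => InterfaceEnergy.shiftUp (M * ε (k j)) (u (k j)) p - c j) up ∧
        InterfaceEnergy.L1LocTendsto (InterfaceEnergy.upperHalf n)
          (fun j p => InterfaceEnergy.shiftDown (M * ε (k j)) (u (k j)) p - c j) um) ∧
    -- liminf inequality
    (∀ (u : ℕ → InterfaceEnergy.Cyl n → ℝ) (up um : InterfaceEnergy.Cyl n → ℝ),
      InterfaceEnergy.L1LocTendsto (InterfaceEnergy.upperHalf n)
        (fun j => InterfaceEnergy.shiftUp (M * ε j) (u j)) up →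
      InterfaceEnergy.L1LocTendsto (InterfaceEnergy.upperHalf n)
        (fun j => InterfaceEnergy.shiftDown (M * ε j) (u j)) um →
      InterfaceEnergy.energyLimit g (InterfaceEnergy.glue up um) ≤
        liminf (fun j => InterfaceEnergy.energyEps g (ε j) (u j)) atTop) ∧
    -- recovery sequence
    (∀ u : InterfaceEnergy.Cyl n → ℝ,
      InterfaceEnergy.MemH1Loc (InterfaceEnergy.cylCover n) (InterfaceEnergy.slitCyl n) u →
      ∃ v : ℕ → InterfaceEnergy.Cyl n → ℝ,
        InterfaceEnergy.L1LocTendsto (InterfaceEnergy.upperHalf n)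
          (fun j => InterfaceEnergy.shiftUp (M * ε j) (v j)) u ∧
        InterfaceEnergy.L1LocTendsto (InterfaceEnergy.upperHalf n)
          (fun j => InterfaceEnergy.shiftDown (M * ε j) (v j)) (fun p => u (p.1, -p.2)) ∧
        limsup (fun j => InterfaceEnergy.energyEps g (ε j) (v j)) atTop ≤
          InterfaceEnergy.energyLimit g u) := by
  have hg2 : MemLp g 2 volume := by simpa using hg.memLp
  exact ⟨fun u ⟨C, hC⟩ => InterfaceEnergy.compactness hg2 hM hε_pos hε_anti hε_lim hC,
    fun u up um hup hum =>
      InterfaceEnergy.energyLimit_glue_le hg2 hM hε_pos hε_anti hε_lim hup hum,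
    fun u hu => InterfaceEnergy.exists_recovery_sequence hg hM hε_pos hε_lim hu⟩
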